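/- **Setting.** Fix a universe SET of small sets. Let $\mathcal V=(\mathcal V,\otimes,I,a,\ell,r)$ be a (SET-small) monoidal category and let $\mathrm V=(\mathcal V,\otimes,\star)$ be a *normal duoidal category* on it: $\mathcal V$ carries a second monoidal structure $(\star,J,\alpha,\lambda,\rho)$ together with a natural interchange $\xi:(Y\otimes X)\star(Y'\otimes X')\to(Y\star Y')\otimes(X\star X')$ and morphisms $\mu:I\star I\to I$, $\nu:J\to I$, $\gamma:J\to J\otimes J$ making $\star$ and $J$ opmonoidal functors and $\alpha,\lambda,\rho$ opmonoidal transformations with respect to $\otimes$, and $\nu$ is invertible. Via $\nu$ we regard $I$ as the unit of $\star$, with unitors $\rho_X:X\star I\to X$ and $\lambda_X:I\star X\to X$. Let $$\sigma:X\star X'\cong(X\otimes I)\star(I\otimes X')\xrightarrow{\ \xi\ }(X\star I)\otimes(I\star X')\cong X\otimes X',$$ $$\tau:X\star X'\cong(I\otimes X)\star(X'\otimes I)\xrightarrow{\ \xi\ }(I\star X')\otimes(X\star I)\cong X'\otimes X.$$ Let $\hat{\mathcal V}=[\mathcal V^{\mathrm{op}},\mathrm{SET}]$. It carries the normal duoidal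 structure $\hat{\mathrm V}$ whose two tensor products are the Day convolutions of $\otimes$ and $\star$, whose units are the representables on $I$ and $J$, and whose structural morphisms are induced by $\xi,\mu,\nu,\gamma$. **Enriched and graded categories.** $\mathcal V$-categories are left $\mathcal V$-categories, with composition $m:\mathscr C(B,C)\otimes\mathscr C(A,B)\to\mathscr C(A,C)$ and SET-small sets of objects; with $\mathcal V$-functors and $\mathcal V$-natural transformations they form the 2-category $\mathcal V\text{-CAT}$. A *$\mathcal V$-graded category* is a category enriched in $(\hat{\mathcal V},\otimes)$; write $\mathrm{GCAT}_{\mathcal V}=\hat{\mathcal V}\text{-CAT}$. The elements of $\mathscr C(A,B)(X)$ are called graded morphisms $f:X\,'A\to B$; they can be reindexed along morphisms $w:Y\to X$, giving $w^*(f):Y\,'A\to B$, and graded morphisms $f:X\,'A\to B$ and $g:Y\,'B\to C$ have a composite $g\circ f:Y\otimes X\,'A\to C$. Change of base along the Yoneda embedding $\mathsf Y:\mathcal V\to\hat{\mathcal V}$ is a 2-functor $\mathsf Y_*:\mathcal V\text{-CAT}\to\mathrm{GCAT}_{\mathcal V}$. Every opmonoidal functor $U:\mathcal W\to\mathcal V$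 between SET-small monoidal categories gives a 2-functor $U^*:\mathrm{GCAT}_{\mathcal V}\to\mathrm{GCAT}_{\mathcal W}$, where a graded morphism $X\,'A\to B$ in $U^*\mathscr C$ is a graded morphism $UX\,'A\to B$ in $\mathscr C$. Write $\mathscr C\mapsto\mathscr C_\star$ for the 2-functor $\star^*:\mathrm{GCAT}_{\mathcal V}\to\mathrm{GCAT}_{\mathcal V\times\mathcal V}$ given by $\star:\mathcal V\times\mathcal V\to\mathcal V$ with $\xi,\mu$. For SET-small monoidal categories $\mathcal V,\mathcal W$ let $U_\ell=(-,I):\mathcal V\to\mathcal V\times\mathcal W$ and $U_r=(I,-):\mathcal W\to\mathcal V\times\mathcal W$. **Bifunctors.** * Let $\mathscr A,\mathscr B,\mathscr C$ be $\mathcal V$-categories. A *$\mathrm V$-enriched bifunctor* $F:\mathscr A,\mathscr B\to\mathscr C$ (Garner–López Franco) consists of $\mathcal V$-functors $F(-,B):\mathscr A\to\mathscr C$ and $F(A,-):\mathscr B\to\mathscr C$ agreeing on objects such that, for all $A,A',B,B'$, $$m\cdot\bigl(F(-,B')_{AA'}\otimes F(A,-)_{BB'}\bigr)\cdot\sigma=m\cdot\bigl(F(A',-)_{BB'}\otimes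 F(-,B)_{AA'}\bigr)\cdot\tau$$ as morphisms $\mathscr A(A,A')\star\mathscr B(B,B')\to\mathscr C(F(A,B),F(A',B'))$. * Let $\mathscr A,\mathscr B,\mathscr C$ be $\mathcal V$-graded categories. A *$\mathrm V$-graded bifunctor* $F:\mathscr A,\mathscr B\to\mathscr C$ consists of $\mathcal V$-graded functors $F(-,B):\mathscr A\to\mathscr C$ and $F(A,-):\mathscr B\to\mathscr C$ agreeing on objects such that, for all $f:X\,'A\to A'$ in $\mathscr A$ and $g:X'\,'B\to B'$ in $\mathscr B$, $$\sigma^*\bigl(F(f,B')\circ F(A,g)\bigr)=\tau^*\bigl(F(A',g)\circ F(f,B)\bigr):X\star X'\,'F(A,B)\to F(A',B').$$ * Let $\mathscr A$ be $\mathcal V$-graded, $\mathscr B$ be $\mathcal W$-graded and $\mathscr D$ be $(\mathcal V\times\mathcal W)$-graded. A *graded bifunctor* $F:\mathscr A,\mathscr B\to\mathscr D$ consists of graded functors $F(-,B):\mathscr A\to U_\ell^*\mathscr D$ and $F(A,-):\mathscr B\to U_r^*\mathscr D$ agreeing on objects such that, for all $f:X\,'A\to A'$ in $\mathscr A$ and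 $g:X'\,'B\to B'$ in $\mathscr B$, $$(r^{-1},\ell^{-1})^*\bigl(F(f,B')\circ F(A,g)\bigr)=(\ell^{-1},r^{-1})^*\bigl(F(A',g)\circ F(f,B)\bigr):(X,X')\,'F(A,B)\to F(A',B')$$ in $\mathscr D$. In each case a morphism $F\to G$ is a family of morphisms $F(A,B)\to G(A,B)$ of the underlying ordinary category of the codomain that is (enriched, respectively graded) natural in each variable separately. This gives categories $\mathrm V\text{-}\mathsf{Bif}(\mathscr A,\mathscr B;\mathscr C)$, $\mathrm V\text{-}\mathsf{GBif}(\mathscr A,\mathscr B;\mathscr C)$, $\mathsf{GBif}(\mathscr A,\mathscr B;\mathscr D)$ and 2-functors into $\mathrm{CAT}$, contravariant on 1-cells in the first two variables and covariant in the third, on $\mathcal V\text{-CAT}^{\mathrm{op}}\times\mathcal V\text{-CAT}^{\mathrm{op}}\times\mathcal V\text{-CAT}$, on $\mathrm{GCAT}_{\mathcal V}^{\mathrm{op}}\times\mathrm{GCAT}_{\mathcal V}^{\mathrm{op}}\times\mathrm{GCAT}_{\mathcal V}$ and on $\mathrm{GCAT}_{\mathcal V}^{\mathrm{op}}\times\mathrm{GCAT}_{\mathcal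 W}^{\mathrm{op}}\times\mathrm{GCAT}_{\mathcal V\times\mathcal W}$ respectively. **Theorem.** Let $\mathrm V$ be a normal duoidal category as above. 1. There are isomorphisms of categories $$\mathrm V\text{-}\mathsf{Bif}(\mathscr A,\mathscr B;\mathscr C)\;\cong\;\mathrm V\text{-}\mathsf{GBif}(\mathsf Y_*\mathscr A,\mathsf Y_*\mathscr B;\mathsf Y_*\mathscr C)\;\cong\;\mathsf{GBif}(\mathsf Y_*\mathscr A,\mathsf Y_*\mathscr B;(\mathsf Y_*\mathscr C)_\star),$$ (strictly) 2-natural in $\mathscr A,\mathscr B,\mathscr C\in\mathcal V\text{-CAT}$. The first sends an enriched bifunctor $F$ to the graded bifunctor with the same object assignment given by the functors $\mathsf Y_*(F(-,B))$, $\mathsf Y_*(F(A,-))$, and a morphism to its image under $\mathsf Y_*$. The second keeps the object assignment, composes $F(-,B)$ and $F(A,-)$ with the identity-on-objects functors $\mathscr C\to U_\ell^*\mathscr C_\star$ and $\mathscr C\to U_r^*\mathscr C_\star$ which reindex graded morphisms along $\rho:X\star I\to X$ and $\lambda:I\star X\to X$ (where $\mathscr C$ is written for $\mathsf Y_*\mathscr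 C$), and sends a morphism to its image under $\star^*$. Thus a $\mathrm V$-enriched bifunctor $\mathscr A,\mathscr B\to\mathscr C$ is equivalently a $\mathrm V$-graded bifunctor, and equivalently a graded bifunctor into $\mathscr C_\star$. 2. For all $\mathcal V$-graded categories $\mathscr A,\mathscr B,\mathscr C$, families of $\mathcal V$-graded functors $F(-,B):\mathscr A\to\mathscr C$, $F(A,-):\mathscr B\to\mathscr C$ agreeing on objects form a $\mathrm V$-graded bifunctor if and only if they form a $\hat{\mathrm V}$-enriched bifunctor; moreover $$\mathrm V\text{-}\mathsf{GBif}=\hat{\mathrm V}\text{-}\mathsf{Bif}:\mathrm{GCAT}_{\mathcal V}^{\mathrm{op}}\times\mathrm{GCAT}_{\mathcal V}^{\mathrm{op}}\times\mathrm{GCAT}_{\mathcal V}\to\mathrm{CAT}.$$ -/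

import Mathlib

open CategoryTheory MonoidalCategory Opposite

universe u v w v₁ v₂ v₃ w₁ w₂ w₃ u₁ u₂ u₃ w₁' w₂' w₃' v₁' v₂' v₃' u₁' u₂' u₃'

set_option linter.unusedVariables false
set_option linter.unusedSectionVars false

/-- The category `[Vᵒᵖ, SET]` of presheaves on `V`, as a type synonym of the functor category
(so that it can carry the Day convolution instead of the pointwise tensor product). -/
def Psh (V : Type u) [SmallCategory V] : Type (u + 1) := Vᵒᵖ ⥤ Type u

namespace Psh

variable {V : Type u} [SmallCategory V]

instance : Category.{u} (Psh V) := inferInstanceAs (Category (Vᵒᵖ ⥤ Type u))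

/-- The set of elements of the presheaf `P` at `X`. -/
def el (P : Psh V) (X : V) : Type u := CategoryTheory.Functor.obj (C := Vᵒᵖ) (D := Type u) P (op X)

/-- Reindexing of elements of a presheaf. -/
def res (P : Psh V) {X Y : V} (w : Y ⟶ X) (p : P.el X) : P.el Y :=
  (CategoryTheory.Functor.map (C := Vᵒᵖ) (D := Type u) P w.op) p

/-- The action of a morphism of presheaves on elements. -/
def ap {P Q : Psh V} (f : P ⟶ Q) {X : V} (p : P.el X) : Q.el X :=
  (NatTrans.app (C := Vᵒᵖ) (D := Type u) (F := P) (G := Q) f (op X)) p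

@[simp] theorem res_id (P : Psh V) {X : V} (p : P.el X) : P.res (𝟙 X) p = p :=
  ConcreteCategory.congr_hom (CategoryTheory.Functor.map_id (C := Vᵒᵖ) (D := Type u) P (op X)) p

@[simp] theorem res_res (P : Psh V) {X Y Z : V} (w : Y ⟶ X) (z : Z ⟶ Y) (p : P.el X) :
    P.res z (P.res w p) = P.res (z ≫ w) p :=
  (ConcreteCategory.congr_hom
    (CategoryTheory.Functor.map_comp (C := Vᵒᵖ) (D := Type u) P w.op z.op) p).symm

@[simp] theorem ap_id (P : Psh V) {X : V} (p : P.el X) : ap (𝟙 P) p = p := rfl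

@[simp] theorem ap_comp {P Q R : Psh V} (f : P ⟶ Q) (g : Q ⟶ R) {X : V} (p : P.el X) :
    ap (f ≫ g) p = ap g (ap f p) := rfl

@[simp] theorem ap_res {P Q : Psh V} (f : P ⟶ Q) {X Y : V} (w : Y ⟶ X) (p : P.el X) :
    ap f (P.res w p) = Q.res w (ap f p) :=
  ConcreteCategory.congr_hom
    (NatTrans.naturality (C := Vᵒᵖ) (D := Type u) (F := P) (G := Q) f w.op) p

theorem hom_ext {P Q : Psh V} {f g : P ⟶ Q} (h : ∀ (X : V) (p : P.el X), ap f p = ap g p) :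
    f = g := by
  apply NatTrans.ext
  funext X
  exact ConcreteCategory.hom_ext _ _ (fun p => h X.unop p)

/-- Construct a presheaf from its elements and reindexing maps. -/
def ofEl (E : V → Type u) (r : ∀ {X Y : V}, (Y ⟶ X) → E X → E Y)
    (h₁ : ∀ {X : V} (p : E X), r (𝟙 X) p = p)
    (h₂ : ∀ {X Y Z : V} (w : Y ⟶ X) (z : Z ⟶ Y) (p : E X), r z (r w p) = r (z ≫ w) p) :
    Psh V :=
  CategoryTheory.Functor.mk (C := Vᵒᵖ) (D := Type u)
    (obj := fun X => E X.unop)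
    (map := fun w => TypeCat.ofHom (fun p => r w.unop p))
    (map_id := fun _ => ConcreteCategory.hom_ext _ _ (fun p => h₁ p))
    (map_comp := fun w z => ConcreteCategory.hom_ext _ _ (fun p => (h₂ w.unop z.unop p).symm))

/-- Construct a morphism of presheaves from its action on elements. -/
def homMk {P Q : Psh V} (f : ∀ {X' : V}, P.el X' → Q.el X')
    (h : ∀ {X Y : V} (w : Y ⟶ X) (p : P.el X), f (P.res w p) = Q.res w (f p)) : P ⟶ Q :=
  NatTrans.mk (C := Vᵒᵖ) (D := Type u) (F := P) (G := Q)
    (app := fun X => TypeCat.ofHom (@f X.unop))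
    (naturality := fun _ _ w => ConcreteCategory.hom_ext _ _ (fun p => h w.unop p))

@[simp] theorem ap_homMk {P Q : Psh V} (f : ∀ {X : V}, P.el X → Q.el X)
    (h : ∀ {X Y : V} (w : Y ⟶ X) (p : P.el X), f (P.res w p) = Q.res w (f p)) {X : V}
    (p : P.el X) : ap (homMk f h) p = f p := rfl

/-- An isomorphism of presheaves from mutually inverse morphisms. -/
def isoMk {P Q : Psh V} (f : P ⟶ Q) (g : Q ⟶ P)
    (h₁ : ∀ {X : V} (p : P.el X), ap g (ap f p) = p)
    (h₂ : ∀ {X : V} (q : Q.el X), ap f (ap g q) = q) : P ≅ Q where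
  hom := f
  inv := g
  hom_inv_id := hom_ext fun _ p => h₁ p
  inv_hom_id := hom_ext fun _ p => h₂ p

@[simp] theorem ap_isoMk_hom {P Q : Psh V} (f : P ⟶ Q) (g : Q ⟶ P) (h₁) (h₂) {X : V}
    (p : P.el X) : ap (isoMk f g h₁ h₂).hom p = ap f p := rfl

@[simp] theorem ap_isoMk_inv {P Q : Psh V} (f : P ⟶ Q) (g : Q ⟶ P) (h₁) (h₂) {X : V}
    (p : Q.el X) : ap (isoMk f g h₁ h₂).inv p = ap g p := rfl

/-- The representable presheaf. -/
def yo (X : V) : Psh V :=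
  ofEl (fun Y => Y ⟶ X) (fun w p => w ≫ p) (by simp) (by simp)

/-- A morphism as an element of a representable presheaf. -/
def toYo {X Y : V} (f : Y ⟶ X) : (yo X).el Y := f

/-- An element of a representable presheaf as a morphism. -/
def ofYo {X Y : V} (f : (yo X).el Y) : Y ⟶ X := f

@[simp] theorem toYo_ofYo {X Y : V} (f : (yo X).el Y) : toYo (ofYo f) = f := Eq.trans rfl rfl

@[simp] theorem ofYo_toYo {X Y : V} (f : Y ⟶ X) : ofYo (toYo f) = f := Eq.trans rfl rfl

theorem exists_toYo {X Y : V} (f : (yo X).el Y) : ∃ f' : Y ⟶ X, f = toYo f' := ⟨f, rfl⟩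

@[simp] theorem yo_res (X : V) {Y Z : V} (w : Z ⟶ Y) (f : Y ⟶ X) :
    (yo X).res w (toYo f) = toYo (w ≫ f) := Eq.trans rfl rfl

@[simp] theorem ofYo_res (X : V) {Y Z : V} (w : Z ⟶ Y) (f : (yo X).el Y) :
    ofYo ((yo X).res w f) = w ≫ ofYo f := Eq.trans rfl rfl

/-- The presheaf `X ↦ S (F X)`. -/
def pre {W : Type u} [SmallCategory W] (F : V ⥤ W) (S : Psh W) : Psh V :=
  ofEl (fun X => S.el (F.obj X)) (fun w p => S.res (F.map w) p) (by simp) (by simp)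

@[simp] theorem pre_res {W : Type u} [SmallCategory W] (F : V ⥤ W) (S : Psh W) {X Y : V}
    (w : Y ⟶ X) (p : S.el (F.obj X)) : (pre F S).res w p = S.res (F.map w) p := rfl

attribute [irreducible] ap yo toYo ofYo

end Psh

namespace Day

open Psh

variable {V : Type u} [SmallCategory V] (M : MonoidalCategory V)

/-- Representatives of elements at `X` of the Day convolution of `P` and `Q`. -/
structure Rep (P Q : Psh V) (X : V) : Type u where
  Y : V
  Z : V
  w : X ⟶ M.tensorObj Y Z
  p : P.el Y
  q : Q.el Z

/-- The relation generating the coend `∫^{Y,Z} V(X, Y ⊗ Z) × P Y × Q Z`. -/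
inductive Rel (P Q : Psh V) (X : V) : Rep M P Q X → Rep M P Q X → Prop
  | mk {Y Z Y' Z' : V} (w : X ⟶ M.tensorObj Y Z) (f : Y ⟶ Y') (g : Z ⟶ Z') (p : P.el Y')
      (q : Q.el Z') :
      Rel P Q X ⟨Y, Z, w, P.res f p, Q.res g q⟩ ⟨Y', Z', w ≫ M.tensorHom f g, p, q⟩

/-- The Day convolution of two presheaves,
`(P ⊗ Q) X = ∫^{Y,Z} V(X, Y ⊗ Z) × P Y × Q Z`. -/
def conv (P Q : Psh V) : Psh V :=
  ofEl (fun X => Quot (Rel M P Q X))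
    (fun {X X'} z => Quot.map (fun t => ⟨t.Y, t.Z, z ≫ t.w, t.p, t.q⟩) (by
      rintro _ _ ⟨w, f, g, p, q⟩
      simpa using Rel.mk (M := M) (z ≫ w) f g p q))
    (by rintro X ⟨t⟩; simp [Quot.map])
    (by rintro X Y Z w z ⟨t⟩; simp [Quot.map])

/-- The element of the Day convolution given by a pair of elements. -/
def kap {P Q : Psh V} {Y Z : V} (p : P.el Y) (q : Q.el Z) :
    (conv M P Q).el (M.tensorObj Y Z) :=
  Quot.mk _ ⟨Y, Z, 𝟙 _, p, q⟩

variable {M}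

theorem exists_rep {P Q : Psh V} {X : V} (t : (conv M P Q).el X) :
    ∃ (Y Z : V) (w : X ⟶ M.tensorObj Y Z) (p : P.el Y) (q : Q.el Z),
      t = (conv M P Q).res w (kap M p q) := by
  induction t using Quot.ind with | mk t
  refine ⟨t.Y, t.Z, t.w, t.p, t.q, ?_⟩
  change _ = Quot.mk _ (Rep.mk t.Y t.Z (t.w ≫ 𝟙 _) t.p t.q)
  simp

theorem kap_res {P Q : Psh V} {Y Z Y' Z' : V} (f : Y ⟶ Y') (g : Z ⟶ Z') (p : P.el Y')
    (q : Q.el Z') :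
    kap M (P.res f p) (Q.res g q) = (conv M P Q).res (M.tensorHom f g) (kap M p q) := by
  refine (Quot.sound (Rel.mk (M := M) (𝟙 _) f g p q)).trans ?_
  change Quot.mk _ (Rep.mk Y' Z' (𝟙 _ ≫ M.tensorHom f g) p q) =
    Quot.mk _ (Rep.mk Y' Z' (M.tensorHom f g ≫ 𝟙 _) p q)
  simp

@[simp] theorem kap_res_left {P Q : Psh V} {Y Z Y' : V} (f : Y ⟶ Y') (p : P.el Y')
    (q : Q.el Z) :
    kap M (P.res f p) q = (conv M P Q).res (M.whiskerRight f Z) (kap M p q) := by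
  have := kap_res (M := M) f (𝟙 Z) p q
  rw [res_id] at this
  rw [this, MonoidalCategory.tensorHom_id]

@[simp] theorem kap_res_right {P Q : Psh V} {Y Z Z' : V} (g : Z ⟶ Z') (p : P.el Y)
    (q : Q.el Z') :
    kap M p (Q.res g q) = (conv M P Q).res (M.whiskerLeft Y g) (kap M p q) := by
  have := kap_res (M := M) (𝟙 Y) g p q
  rw [res_id] at this
  rw [this, MonoidalCategory.id_tensorHom]

/-- The underlying function of `desc`. -/
def descFun {P Q S : Psh V} (θ : ∀ {Y Z : V}, P.el Y → Q.el Z → S.el (M.tensorObj Y Z))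
    (hθ : ∀ {Y Z Y' Z' : V} (f : Y ⟶ Y') (g : Z ⟶ Z') (p : P.el Y') (q : Q.el Z'),
      θ (P.res f p) (Q.res g q) = S.res (M.tensorHom f g) (θ p q)) {X : V}
    (t : (conv M P Q).el X) : S.el X :=
  Quot.lift (fun t : Rep M P Q X => S.res t.w (θ t.p t.q)) (by
    rintro _ _ ⟨w, f, g, p, q⟩
    simp [hθ]) t

theorem descFun_res {P Q S : Psh V} (θ : ∀ {Y Z : V}, P.el Y → Q.el Z → S.el (M.tensorObj Y Z))
    (hθ) {X Y : V} (w : Y ⟶ X) (t : (conv M P Q).el X) :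
    descFun θ hθ ((conv M P Q).res w t) = S.res w (descFun θ hθ t) := by
  obtain ⟨t⟩ := t
  exact (res_res S t.w w (θ t.p t.q)).symm

/-- The universal property of the Day convolution. -/
def desc {P Q S : Psh V} (θ : ∀ {Y Z : V}, P.el Y → Q.el Z → S.el (M.tensorObj Y Z))
    (hθ : ∀ {Y Z Y' Z' : V} (f : Y ⟶ Y') (g : Z ⟶ Z') (p : P.el Y') (q : Q.el Z'),
      θ (P.res f p) (Q.res g q) = S.res (M.tensorHom f g) (θ p q)) : conv M P Q ⟶ S :=
  homMk (descFun θ hθ) (descFun_res θ hθ)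

@[simp] theorem desc_kap {P Q S : Psh V}
    (θ : ∀ {Y Z : V}, P.el Y → Q.el Z → S.el (M.tensorObj Y Z)) (hθ) {Y Z : V} (p : P.el Y)
    (q : Q.el Z) : ap (desc θ hθ) (kap M p q) = θ p q :=
  (ap_homMk _ (descFun_res θ hθ) _).trans (res_id S _)

theorem conv_ext {P Q S : Psh V} {f g : conv M P Q ⟶ S}
    (h : ∀ {Y Z : V} (p : P.el Y) (q : Q.el Z), ap f (kap M p q) = ap g (kap M p q)) :
    f = g := by
  apply hom_ext
  intro X t
  obtain ⟨Y, Z, w, p, q, rfl⟩ := exists_rep t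
  simp [h]

theorem aux_left {X Y Z A B : V} (f : X ⟶ Y) (w : Y ⟶ A) (g : Z ⟶ B) :
    M.whiskerRight (f ≫ w) Z ≫ M.tensorHom (𝟙 A) g = M.tensorHom f g ≫ M.whiskerRight w B := by
  simp [MonoidalCategory.tensorHom_def, MonoidalCategory.whisker_exchange]

theorem aux_right {X Y Z A B : V} (g : X ⟶ Y) (w : Y ⟶ A) (f : Z ⟶ B) :
    M.whiskerLeft Z (g ≫ w) ≫ M.tensorHom f (𝟙 A) = M.tensorHom f g ≫ M.whiskerLeft B w := by
  rw [MonoidalCategory.whiskerLeft_comp, Category.assoc, MonoidalCategory.tensorHom_def',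
    MonoidalCategory.tensorHom_def', MonoidalCategory.whiskerLeft_id, Category.id_comp,
    Category.assoc, MonoidalCategory.whisker_exchange]

theorem tensorHom_id_eq {X Y : V} (Z : V) (f : X ⟶ Y) :
    M.tensorHom f (𝟙 Z) = M.whiskerRight f Z := MonoidalCategory.tensorHom_id _ _

theorem id_tensorHom_eq {X Y : V} (Z : V) (f : X ⟶ Y) :
    M.tensorHom (𝟙 Z) f = M.whiskerLeft Z f := MonoidalCategory.id_tensorHom _ _

theorem id_tensorHom_id_eq (X Y : V) : M.tensorHom (𝟙 X) (𝟙 Y) = 𝟙 (M.tensorObj X Y) :=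
  MonoidalCategory.id_tensorHom_id _ _

section

variable {N : MonoidalCategory V}

theorem conv_ext_left {P Q R S : Psh V} {f g : conv M (conv N P Q) R ⟶ S}
    (h : ∀ {X Y Z : V} (p : P.el X) (q : Q.el Y) (r : R.el Z),
      ap f (kap M (kap N p q) r) = ap g (kap M (kap N p q) r)) : f = g := by
  apply conv_ext
  intro X Z t r
  obtain ⟨Y, Z, w, p, q, rfl⟩ := exists_rep t
  simp [h]

theorem conv_ext_right {P Q R S : Psh V} {f g : conv M P (conv N Q R) ⟶ S}
    (h : ∀ {X Y Z : V} (p : P.el X) (q : Q.el Y) (r : R.el Z),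
      ap f (kap M p (kap N q r)) = ap g (kap M p (kap N q r))) : f = g := by
  apply conv_ext
  intro X Z p t
  obtain ⟨Y, Z, w, q, r, rfl⟩ := exists_rep t
  simp [h]

theorem conv_ext_both {P Q P' Q' S : Psh V} {f g : conv M (conv N P Q) (conv N P' Q') ⟶ S}
    (h : ∀ {X Y X' Y' : V} (p : P.el X) (q : Q.el Y) (p' : P'.el X') (q' : Q'.el Y'),
      ap f (kap M (kap N p q) (kap N p' q')) = ap g (kap M (kap N p q) (kap N p' q'))) :
    f = g := by
  apply conv_ext_left
  intro X Y Z p q t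
  obtain ⟨Y, Z, w, p', q', rfl⟩ := exists_rep t
  simp [h]

/-- The universal property of a convolution with a convolution on the left. -/
def descLeft {P Q R S : Psh V}
    (θ : ∀ {X Y Z : V}, P.el X → Q.el Y → R.el Z →
      S.el (M.tensorObj (N.tensorObj X Y) Z))
    (hθ : ∀ {X Y Z X' Y' Z' : V} (f : X ⟶ X') (g : Y ⟶ Y') (h : Z ⟶ Z') (p : P.el X')
      (q : Q.el Y') (r : R.el Z'), θ (P.res f p) (Q.res g q) (R.res h r) =
        S.res (M.tensorHom (N.tensorHom f g) h) (θ p q r)) :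
    conv M (conv N P Q) R ⟶ S :=
  let D {Z : V} (r : R.el Z) : conv N P Q ⟶ pre (@MonoidalCategory.tensorRight V _ M Z) S :=
    desc (fun p q => θ p q r) (fun f g p q => by
      have h := hθ f g (𝟙 Z) p q r
      rw [res_id, tensorHom_id_eq (M := M)] at h
      exact h)
  desc (fun t r => ap (D r) t) (fun {Y Z Y' Z'} f g t r => by
    obtain ⟨A, B, w, p, q, rfl⟩ := exists_rep t
    have h := hθ (𝟙 _) (𝟙 _) g p q r
    simp only [res_id, id_tensorHom_id_eq (M := N)] at h
    have e₁ : ap (D (R.res g r)) (kap N p q) = θ p q (R.res g r) := desc_kap _ _ _ _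
    have e₂ : ap (D r) (kap N p q) = θ p q r := desc_kap _ _ _ _
    simp only [ap_res, res_res]
    rw [e₁, e₂, h]
    change S.res (M.whiskerRight (f ≫ w) Z) (S.res _ _) = S.res _ (S.res (M.whiskerRight w Z') _)
    rw [res_res, res_res]
    exact congrFun (congrArg _ (aux_left _ _ _)) _)

@[simp] theorem descLeft_kap {P Q R S : Psh V}
    (θ : ∀ {X Y Z : V}, P.el X → Q.el Y → R.el Z →
      S.el (M.tensorObj (N.tensorObj X Y) Z)) (hθ) {X Y Z : V} (p : P.el X) (q : Q.el Y)
    (r : R.el Z) : ap (descLeft θ hθ) (kap M (kap N p q) r) = θ p q r := by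
  unfold descLeft
  exact (desc_kap _ _ _ _).trans (desc_kap (M := N) _ _ _ _)

/-- The universal property of a convolution with a convolution on the right. -/
def descRight {P Q R S : Psh V}
    (θ : ∀ {X Y Z : V}, P.el X → Q.el Y → R.el Z →
      S.el (M.tensorObj X (N.tensorObj Y Z)))
    (hθ : ∀ {X Y Z X' Y' Z' : V} (f : X ⟶ X') (g : Y ⟶ Y') (h : Z ⟶ Z') (p : P.el X')
      (q : Q.el Y') (r : R.el Z'), θ (P.res f p) (Q.res g q) (R.res h r) =
        S.res (M.tensorHom f (N.tensorHom g h)) (θ p q r)) :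
    conv M P (conv N Q R) ⟶ S :=
  let D {X : V} (p : P.el X) : conv N Q R ⟶ pre (@MonoidalCategory.tensorLeft V _ M X) S :=
    desc (fun q r => θ p q r) (fun f g q r => by
      have h := hθ (𝟙 X) f g p q r
      rw [res_id, id_tensorHom_eq (M := M)] at h
      exact h)
  desc (fun p t => ap (D p) t) (fun {Y Z Y' Z'} f g p t => by
    obtain ⟨A, B, w, q, r, rfl⟩ := exists_rep t
    have h := hθ f (𝟙 _) (𝟙 _) p q r
    simp only [res_id, id_tensorHom_id_eq (M := N)] at h
    have e₁ : ap (D (P.res f p)) (kap N q r) = θ (P.res f p) q r := desc_kap _ _ _ _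
    have e₂ : ap (D p) (kap N q r) = θ p q r := desc_kap _ _ _ _
    simp only [ap_res, res_res]
    rw [e₁, e₂, h]
    change S.res (M.whiskerLeft Y (g ≫ w)) (S.res _ _) = S.res _ (S.res (M.whiskerLeft Y' w) _)
    rw [res_res, res_res]
    exact congrFun (congrArg _ (aux_right _ _ _)) _)

@[simp] theorem descRight_kap {P Q R S : Psh V}
    (θ : ∀ {X Y Z : V}, P.el X → Q.el Y → R.el Z →
      S.el (M.tensorObj X (N.tensorObj Y Z))) (hθ) {X Y Z : V} (p : P.el X) (q : Q.el Y)
    (r : R.el Z) : ap (descRight θ hθ) (kap M p (kap N q r)) = θ p q r := by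
  unfold descRight
  exact (desc_kap _ _ _ _).trans (desc_kap (M := N) _ _ _ _)

/-- The universal property of a convolution of two convolutions. -/
def descBoth {P Q P' Q' S : Psh V}
    (θ : ∀ {X Y X' Y' : V}, P.el X → Q.el Y → P'.el X' → Q'.el Y' →
      S.el (M.tensorObj (N.tensorObj X Y) (N.tensorObj X' Y')))
    (hθ : ∀ {X Y X' Y' Z W Z' W' : V} (f : X ⟶ Z) (g : Y ⟶ W) (f' : X' ⟶ Z') (g' : Y' ⟶ W')
      (p : P.el Z) (q : Q.el W) (p' : P'.el Z') (q' : Q'.el W'),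
      θ (P.res f p) (Q.res g q) (P'.res f' p') (Q'.res g' q') =
        S.res (M.tensorHom (N.tensorHom f g) (N.tensorHom f' g')) (θ p q p' q')) :
    conv M (conv N P Q) (conv N P' Q') ⟶ S :=
  let D {X Y : V} (p : P.el X) (q : Q.el Y) : conv N P' Q' ⟶
      pre (@MonoidalCategory.tensorLeft V _ M (N.tensorObj X Y)) S :=
    desc (fun p' q' => θ p q p' q') (fun f g p' q' => by
      have h := hθ (𝟙 X) (𝟙 Y) f g p q p' q'
      rw [res_id, res_id, id_tensorHom_id_eq (M := N), id_tensorHom_eq (M := M)] at h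
      exact h)
  descLeft (fun p q t => ap (D p q) t) (fun {X Y Z X' Y' Z'} f g k p q t => by
    obtain ⟨A, B, w, p', q', rfl⟩ := exists_rep t
    have h := hθ f g (𝟙 _) (𝟙 _) p q p' q'
    simp only [res_id, id_tensorHom_id_eq (M := N)] at h
    have e₁ : ap (D (P.res f p) (Q.res g q)) (kap N p' q') = θ (P.res f p) (Q.res g q) p' q' := desc_kap _ _ _ _
    have e₂ : ap (D p q) (kap N p' q') = θ p q p' q' := desc_kap _ _ _ _
    simp only [ap_res, res_res]
    rw [e₁, e₂, h]
    change S.res (M.whiskerLeft (N.tensorObj X Y) (k ≫ w)) (S.res _ _) = S.res _ (S.res (M.whiskerLeft (N.tensorObj X' Y') w) _)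
    rw [res_res, res_res]
    exact congrFun (congrArg _ (aux_right _ _ _)) _)

@[simp] theorem descBoth_kap {P Q P' Q' S : Psh V}
    (θ : ∀ {X Y X' Y' : V}, P.el X → Q.el Y → P'.el X' → Q'.el Y' →
      S.el (M.tensorObj (N.tensorObj X Y) (N.tensorObj X' Y'))) (hθ) {X Y X' Y' : V}
    (p : P.el X) (q : Q.el Y) (p' : P'.el X') (q' : Q'.el Y') :
    ap (descBoth θ hθ) (kap M (kap N p q) (kap N p' q')) = θ p q p' q' := by
  unfold descBoth
  exact (descLeft_kap _ _ _ _ _).trans (desc_kap (M := N) _ _ _ _)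

end

attribute [irreducible] conv kap desc descLeft descRight descBoth

end Day
namespace Day

open Psh

variable {V : Type u} [SmallCategory V] (M : MonoidalCategory V)

/-- Functoriality of Day convolution. -/
def map {P Q P' Q' : Psh V} (f : P ⟶ P') (g : Q ⟶ Q') : conv M P Q ⟶ conv M P' Q' :=
  desc (fun p q => kap M (ap f p) (ap g q)) (fun w z p q => by simp only [ap_res, kap_res])

@[simp] theorem map_kap {P Q P' Q' : Psh V} (f : P ⟶ P') (g : Q ⟶ Q') {Y Z : V} (p : P.el Y)
    (q : Q.el Z) : ap (map M f g) (kap M p q) = kap M (ap f p) (ap g q) :=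
  desc_kap _ _ _ _

/-- The associator of Day convolution. -/
def assoc (P Q R : Psh V) : conv M (conv M P Q) R ≅ conv M P (conv M Q R) :=
  isoMk
    (descLeft (fun {X Y Z} p q r =>
        (conv M P (conv M Q R)).res (M.associator X Y Z).hom (kap M p (kap M q r)))
      (fun f g h p q r => by
        simp only [kap_res, res_res, MonoidalCategory.associator_naturality]))
    (descRight (fun {X Y Z} p q r =>
        (conv M (conv M P Q) R).res (M.associator X Y Z).inv (kap M (kap M p q) r))
      (fun f g h p q r => by
        simp only [kap_res, res_res, MonoidalCategory.associator_inv_naturality]))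
    (fun {X} t => by
      obtain ⟨A, B, w, p, q, rfl⟩ := exists_rep t
      obtain ⟨A, B, w, p, q, rfl⟩ := exists_rep p
      simp)
    (fun {X} t => by
      obtain ⟨A, B, w, p, q, rfl⟩ := exists_rep t
      obtain ⟨A, B, w, q, r, rfl⟩ := exists_rep q
      simp)

@[simp] theorem assoc_kap (P Q R : Psh V) {X Y Z : V} (p : P.el X) (q : Q.el Y) (r : R.el Z) :
    ap (assoc M P Q R).hom (kap M (kap M p q) r) =
      (conv M P (conv M Q R)).res (M.associator X Y Z).hom (kap M p (kap M q r)) := by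
  simp [assoc]

/-- The left unitor of Day convolution. -/
def leftUnitor (P : Psh V) : conv M (yo M.tensorUnit) P ≅ P :=
  isoMk
    (desc (fun {Y Z} j p => P.res (M.whiskerRight (ofYo j) Z ≫ (M.leftUnitor Z).hom) p)
      (fun f g j p => by simp [MonoidalCategory.tensorHom_def, MonoidalCategory.whisker_exchange_assoc]))
    (homMk (fun {X} p => (conv M (yo M.tensorUnit) P).res (M.leftUnitor X).inv
        (kap M (toYo (𝟙 M.tensorUnit)) p))
      (fun w p => by simp))
    (fun {X} t => by
      obtain ⟨A, B, w, j, p, rfl⟩ := exists_rep t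
      have h := kap_res_left (M := M) (ofYo j) (toYo (𝟙 M.tensorUnit)) p
      simp at h
      simp [h])
    (fun {X} p => by simp)

@[simp] theorem leftUnitor_kap (P : Psh V) {Y Z : V} (j : Y ⟶ M.tensorUnit) (p : P.el Z) :
    ap (leftUnitor M P).hom (kap M (toYo j) p) =
      P.res (M.whiskerRight j Z ≫ (M.leftUnitor Z).hom) p := by
  simp [leftUnitor]

@[simp] theorem leftUnitor_inv (P : Psh V) {X : V} (p : P.el X) :
    ap (leftUnitor M P).inv p = (conv M (yo M.tensorUnit) P).res (M.leftUnitor X).inv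
        (kap M (toYo (𝟙 M.tensorUnit)) p) := by
  simp [leftUnitor]

/-- The right unitor of Day convolution. -/
def rightUnitor (P : Psh V) : conv M P (yo M.tensorUnit) ≅ P :=
  isoMk
    (desc (fun {Y Z} p j => P.res (M.whiskerLeft Y (ofYo j) ≫ (M.rightUnitor Y).hom) p)
      (fun f g p j => by simp [MonoidalCategory.tensorHom_def', ← MonoidalCategory.whisker_exchange_assoc]))
    (homMk (fun {X} p => (conv M P (yo M.tensorUnit)).res (M.rightUnitor X).inv
        (kap M p (toYo (𝟙 M.tensorUnit))))
      (fun w p => by simp))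
    (fun {X} t => by
      obtain ⟨A, B, w, p, j, rfl⟩ := exists_rep t
      have h := kap_res_right (M := M) (ofYo j) p (toYo (𝟙 M.tensorUnit))
      simp at h
      simp [h])
    (fun {X} p => by simp)

@[simp] theorem rightUnitor_kap (P : Psh V) {Y Z : V} (p : P.el Y) (j : Z ⟶ M.tensorUnit) :
    ap (rightUnitor M P).hom (kap M p (toYo j)) =
      P.res (M.whiskerLeft Y j ≫ (M.rightUnitor Y).hom) p := by
  simp [rightUnitor]

@[simp] theorem rightUnitor_inv (P : Psh V) {X : V} (p : P.el X) :
    ap (rightUnitor M P).inv p = (conv M P (yo M.tensorUnit)).res (M.rightUnitor X).inv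
        (kap M p (toYo (𝟙 M.tensorUnit))) := by
  simp [rightUnitor]

theorem map_id (P Q : Psh V) : map M (𝟙 P) (𝟙 Q) = 𝟙 (conv M P Q) :=
  conv_ext fun p q => by simp

theorem map_comp {P Q P' Q' P'' Q'' : Psh V} (f : P ⟶ P') (g : Q ⟶ Q') (f' : P' ⟶ P'')
    (g' : Q' ⟶ Q'') : map M f g ≫ map M f' g' = map M (f ≫ f') (g ≫ g') :=
  conv_ext fun p q => by simp

theorem assoc_naturality {P Q R P' Q' R' : Psh V} (f : P ⟶ P') (g : Q ⟶ Q') (h : R ⟶ R') :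
    map M (map M f g) h ≫ (assoc M P' Q' R').hom =
      (assoc M P Q R).hom ≫ map M f (map M g h) :=
  conv_ext_left fun p q r => by simp

theorem leftUnitor_naturality {P Q : Psh V} (f : P ⟶ Q) :
    map M (𝟙 (yo M.tensorUnit)) f ≫ (leftUnitor M Q).hom = (leftUnitor M P).hom ≫ f :=
  conv_ext fun j p => by
    obtain ⟨j, rfl⟩ := exists_toYo j
    simp

theorem rightUnitor_naturality {P Q : Psh V} (f : P ⟶ Q) :
    map M f (𝟙 (yo M.tensorUnit)) ≫ (rightUnitor M Q).hom = (rightUnitor M P).hom ≫ f :=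
  conv_ext fun p j => by
    obtain ⟨j, rfl⟩ := exists_toYo j
    simp

theorem pentagon (P Q R S : Psh V) :
    map M (assoc M P Q R).hom (𝟙 S) ≫ (assoc M P (conv M Q R) S).hom ≫
        map M (𝟙 P) (assoc M Q R S).hom =
      (assoc M (conv M P Q) R S).hom ≫ (assoc M P Q (conv M R S)).hom :=
  conv_ext_left fun t r s => by
    obtain ⟨A, B, w, p, q, rfl⟩ := exists_rep t
    simp

theorem triangle (P Q : Psh V) :
    (assoc M P (yo M.tensorUnit) Q).hom ≫ map M (𝟙 P) (leftUnitor M Q).hom =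
      map M (rightUnitor M P).hom (𝟙 Q) :=
  conv_ext_left fun p j q => by
    obtain ⟨j, rfl⟩ := exists_toYo j
    simp

/-- The tensor product, unit and structural isomorphisms of Day convolution. -/
abbrev monoidalStruct : MonoidalCategoryStruct (Psh V) where
  tensorObj P Q := conv M P Q
  whiskerLeft P _ _ g := map M (𝟙 P) g
  whiskerRight f Q := map M f (𝟙 Q)
  tensorHom f g := map M f g
  tensorUnit := yo M.tensorUnit
  associator P Q R := assoc M P Q R
  leftUnitor P := leftUnitor M P
  rightUnitor P := rightUnitor M P

/-- The Day convolution monoidal structure on presheaves. -/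
@[reducible] def monoidal : MonoidalCategory (Psh V) :=
  letI := monoidalStruct M
  MonoidalCategory.ofTensorHom (C := Psh V)
    (id_tensorHom_id := map_id M)
    (id_tensorHom := fun _ _ _ _ => rfl)
    (tensorHom_id := fun _ _ => rfl)
    (tensorHom_comp_tensorHom := map_comp M)
    (associator_naturality := assoc_naturality M)
    (leftUnitor_naturality := leftUnitor_naturality M)
    (rightUnitor_naturality := rightUnitor_naturality M)
    (pentagon := pentagon M)
    (triangle := triangle M)

end Day

/-- A category with a second monoidal structure. -/
class StarMonoidal (V : Type v) [Category.{w} V] where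
  str : MonoidalCategory V

/-- The second monoidal structure `(⋆, J)`. -/
@[reducible] def starM (V : Type v) [Category.{w} V] [StarMonoidal V] : MonoidalCategory V :=
  StarMonoidal.str

/-- The tensor product `A ⋆ B`. -/
abbrev starObj {V : Type v} [Category.{w} V] [StarMonoidal V] (A B : V) : V :=
  (starM V).tensorObj A B

/-- The tensor product `f ⋆ g`. -/
abbrev starHom {V : Type v} [Category.{w} V] [StarMonoidal V] {A B A' B' : V} (f : A ⟶ B)
    (g : A' ⟶ B') : starObj A A' ⟶ starObj B B' :=
  (starM V).tensorHom f g

/-- The unit object `J` of the second monoidal structure. -/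
abbrev starUnit (V : Type v) [Category.{w} V] [StarMonoidal V] : V :=
  (starM V).tensorUnit

/-- The associator of the second monoidal structure. -/
abbrev starAssoc {V : Type v} [Category.{w} V] [StarMonoidal V] (A B C : V) :
    starObj (starObj A B) C ≅ starObj A (starObj B C) :=
  (starM V).associator A B C

/-- The left unitor of the second monoidal structure. -/
abbrev starLeft {V : Type v} [Category.{w} V] [StarMonoidal V] (A : V) :
    starObj (starUnit V) A ≅ A :=
  (starM V).leftUnitor A

/-- The right unitor of the second monoidal structure. -/
abbrev starRight {V : Type v} [Category.{w} V] [StarMonoidal V] (A : V) :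
    starObj A (starUnit V) ≅ A :=
  (starM V).rightUnitor A

/-- A duoidal category: a monoidal category `(V, ⊗, I)` with a second monoidal structure
`(⋆, J)` whose tensor product, unit and structural isomorphisms are opmonoidal
with respect to `(⊗, I)`. -/
class DuoidalCategory (V : Type v) [Category.{w} V] [MonoidalCategory V] [StarMonoidal V] where
  /-- the interchange morphism `(A ⊗ B) ⋆ (C ⊗ D) ⟶ (A ⋆ C) ⊗ (B ⋆ D)` -/
  ξ (A B C D : V) : starObj (A ⊗ B) (C ⊗ D) ⟶ starObj A C ⊗ starObj B D
  /-- the morphism `I ⋆ I ⟶ I` -/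
  μ : starObj (𝟙_ V) (𝟙_ V) ⟶ 𝟙_ V
  /-- the morphism `J ⟶ I` -/
  ν : starUnit V ⟶ 𝟙_ V
  /-- the morphism `J ⟶ J ⊗ J` -/
  γ : starUnit V ⟶ starUnit V ⊗ starUnit V
  ξ_natural {A B C D A' B' C' D' : V} (f : A ⟶ A') (g : B ⟶ B') (h : C ⟶ C') (k : D ⟶ D') :
    starHom (f ⊗ₘ g) (h ⊗ₘ k) ≫ ξ A' B' C' D' =
      ξ A B C D ≫ (starHom f h ⊗ₘ starHom g k)
  ξ_assoc (A B C A' B' C' : V) :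
    ξ (A ⊗ B) C (A' ⊗ B') C' ≫ (ξ A B A' B' ▷ starObj C C') ≫ (α_ _ _ _).hom =
      starHom (α_ A B C).hom (α_ A' B' C').hom ≫ ξ A (B ⊗ C) A' (B' ⊗ C') ≫
        (starObj A A' ◁ ξ B C B' C')
  ξ_left_unit (A A' : V) :
    ξ (𝟙_ V) A (𝟙_ V) A' ≫ (μ ▷ starObj A A') ≫ (λ_ _).hom =
      starHom (λ_ A).hom (λ_ A').hom
  ξ_right_unit (A A' : V) :
    ξ A (𝟙_ V) A' (𝟙_ V) ≫ (starObj A A' ◁ μ) ≫ (ρ_ _).hom =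
      starHom (ρ_ A).hom (ρ_ A').hom
  γ_coassoc :
    γ ≫ (γ ▷ starUnit V) ≫ (α_ _ _ _).hom = γ ≫ (starUnit V ◁ γ)
  γ_left_counit : γ ≫ (ν ▷ starUnit V) ≫ (λ_ _).hom = 𝟙 _
  γ_right_counit : γ ≫ (starUnit V ◁ ν) ≫ (ρ_ _).hom = 𝟙 _
  ξ_star_assoc (A A' B B' C C' : V) :
    starHom (ξ A A' B B') (𝟙 (C ⊗ C')) ≫ ξ (starObj A B) (starObj A' B') C C' ≫
        ((starAssoc A B C).hom ⊗ₘ (starAssoc A' B' C').hom) =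
      (starAssoc (A ⊗ A') (B ⊗ B') (C ⊗ C')).hom ≫
        starHom (𝟙 (A ⊗ A')) (ξ B B' C C') ≫
          ξ A A' (starObj B C) (starObj B' C')
  μ_star_assoc :
    starHom μ (𝟙 (𝟙_ V)) ≫ μ =
      (starAssoc (𝟙_ V) (𝟙_ V) (𝟙_ V)).hom ≫ starHom (𝟙 (𝟙_ V)) μ ≫ μ
  ξ_star_left_unit (A B : V) :
    starHom γ (𝟙 (A ⊗ B)) ≫ ξ (starUnit V) (starUnit V) A B ≫
      ((starLeft A).hom ⊗ₘ (starLeft B).hom) = (starLeft (A ⊗ B)).hom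
  μ_star_left_unit : starHom ν (𝟙 (𝟙_ V)) ≫ μ = (starLeft (𝟙_ V)).hom
  ξ_star_right_unit (A B : V) :
    starHom (𝟙 (A ⊗ B)) γ ≫ ξ A B (starUnit V) (starUnit V) ≫
      ((starRight A).hom ⊗ₘ (starRight B).hom) = (starRight (A ⊗ B)).hom
  μ_star_right_unit : starHom (𝟙 (𝟙_ V)) ν ≫ μ = (starRight (𝟙_ V)).hom

/-- A duoidal category is normal if its structural morphism `J ⟶ I` is invertible. -/
class NormalDuoidal (V : Type v) [Category.{w} V] [MonoidalCategory V] [StarMonoidal V]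
    [DuoidalCategory V] : Prop where
  isIso_ν : IsIso (DuoidalCategory.ν (V := V))

attribute [instance] NormalDuoidal.isIso_ν

section

open DuoidalCategory

variable {V : Type v} [Category.{w} V] [StarMonoidal V]

theorem starHom_comp {A B C A' B' C' : V} (f : A ⟶ B) (f' : A' ⟶ B') (g : B ⟶ C) (g' : B' ⟶ C') :
    starHom f f' ≫ starHom g g' = starHom (f ≫ g) (f' ≫ g') :=
  @MonoidalCategory.tensorHom_comp_tensorHom V _ (starM V) _ _ _ _ _ _ f f' g g'

theorem starHom_comp_assoc {A B C A' B' C' D : V} (f : A ⟶ B) (f' : A' ⟶ B') (g : B ⟶ C)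
    (g' : B' ⟶ C') (h : starObj C C' ⟶ D) :
    starHom f f' ≫ starHom g g' ≫ h = starHom (f ≫ g) (f' ≫ g') ≫ h := by
  rw [← Category.assoc, starHom_comp]

theorem starHom_id (A B : V) : starHom (𝟙 A) (𝟙 B) = 𝟙 (starObj A B) :=
  @MonoidalCategory.id_tensorHom_id V _ (starM V) A B

theorem star_whiskerRight {A B : V} (f : A ⟶ B) (C : V) :
    (starM V).whiskerRight f C = starHom f (𝟙 C) :=
  (@MonoidalCategory.tensorHom_id V _ (starM V) _ _ f C).symm

theorem star_whiskerLeft {A B : V} (C : V) (f : A ⟶ B) :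
    (starM V).whiskerLeft C f = starHom (𝟙 C) f :=
  (@MonoidalCategory.id_tensorHom V _ (starM V) C _ _ f).symm

theorem starLeft_naturality {A B : V} (f : A ⟶ B) :
    starHom (𝟙 (starUnit V)) f ≫ (starLeft B).hom = (starLeft A).hom ≫ f := by
  have h := @MonoidalCategory.leftUnitor_naturality V _ (starM V) _ _ f
  rwa [star_whiskerLeft] at h

theorem starRight_naturality {A B : V} (f : A ⟶ B) :
    starHom f (𝟙 (starUnit V)) ≫ (starRight B).hom = (starRight A).hom ≫ f := by
  have h := @MonoidalCategory.rightUnitor_naturality V _ (starM V) _ _ f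
  rwa [star_whiskerRight] at h

theorem starAssoc_naturality {A B C A' B' C' : V} (f : A ⟶ A') (g : B ⟶ B') (h : C ⟶ C') :
    starHom (starHom f g) h ≫ (starAssoc A' B' C').hom =
      (starAssoc A B C).hom ≫ starHom f (starHom g h) :=
  @MonoidalCategory.associator_naturality V _ (starM V) _ _ _ _ _ _ f g h

variable [MonoidalCategory V] [DuoidalCategory V]

theorem ξ_whiskerRight {A A' B C C' D : V} (f : A ⟶ A') (g : C ⟶ C') :
    starHom (f ▷ B) (g ▷ D) ≫ ξ A' B C' D = ξ A B C D ≫ (starHom f g ▷ starObj B D) := by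
  have h := ξ_natural f (𝟙 B) g (𝟙 D)
  rwa [tensorHom_id, tensorHom_id, starHom_id, tensorHom_id] at h

theorem ξ_whiskerLeft {A B B' C D D' : V} (f : B ⟶ B') (g : D ⟶ D') :
    starHom (A ◁ f) (C ◁ g) ≫ ξ A B' C D' = ξ A B C D ≫ (starObj A C ◁ starHom f g) := by
  have h := ξ_natural (𝟙 A) f (𝟙 C) g
  rwa [id_tensorHom, id_tensorHom, starHom_id, id_tensorHom] at h

end

namespace Day

open Psh DuoidalCategory

variable {V : Type u} [SmallCategory V] (M : MonoidalCategory V)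

theorem yoMap_res {X Y : V} (f : X ⟶ Y) {A B : V} (w : B ⟶ A) (p : (yo X).el A) :
    toYo (ofYo ((yo X).res w p) ≫ f) = (yo Y).res w (toYo (ofYo p ≫ f)) := by
  simp

/-- The morphism of presheaves induced by a morphism between representing objects. -/
def yoMap {X Y : V} (f : X ⟶ Y) : yo X ⟶ yo Y :=
  homMk (fun {_} p => toYo (ofYo p ≫ f)) (yoMap_res f)

@[simp] theorem yoMap_toYo {X Y Z : V} (f : X ⟶ Y) (p : Z ⟶ X) :
    ap (yoMap f) (toYo p) = toYo (p ≫ f) :=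
  (ap_homMk _ (yoMap_res f) _).trans (congrArg (fun q => toYo (q ≫ f)) (ofYo_toYo p))

/-- The comparison `yo X ⊗ yo Y ⟶ yo (X ⊗ Y)`. -/
def yoTensor (X Y : V) : conv M (yo X) (yo Y) ⟶ yo (M.tensorObj X Y) :=
  desc (fun p q => toYo (M.tensorHom (ofYo p) (ofYo q))) (fun f g p q => by simp [MonoidalCategory.tensorHom_comp_tensorHom])

@[simp] theorem yoTensor_kap {X Y A B : V} (p : A ⟶ X) (q : B ⟶ Y) :
    ap (yoTensor M X Y) (kap M (toYo p) (toYo q)) = toYo (M.tensorHom p q) := by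
  unfold yoTensor
  rw [desc_kap, ofYo_toYo, ofYo_toYo]

variable {M} [StarMonoidal V] [DuoidalCategory V]

/-- The interchange of the Day convolutions of the two monoidal structures. -/
def xi (P Q P' Q' : Psh V) :
    conv (starM V) (conv M P Q) (conv M P' Q') ⟶ conv M (conv (starM V) P P') (conv (starM V) Q Q') :=
  descBoth (fun {X Y X' Y'} p q p' q' =>
      (conv M (conv (starM V) P P') (conv (starM V) Q Q')).res (ξ X Y X' Y')
        (kap M (kap (starM V) p p') (kap (starM V) q q')))
    (fun f g f' g' p q p' q' => by
      simp only [kap_res, res_res]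
      rw [← ξ_natural])

@[simp] theorem xi_kap {P Q P' Q' : Psh V} {X Y X' Y' : V} (p : P.el X) (q : Q.el Y)
    (p' : P'.el X') (q' : Q'.el Y') :
    ap (xi P Q P' Q') (kap (starM V) (kap M p q) (kap M p' q')) =
      (conv M (conv (starM V) P P') (conv (starM V) Q Q')).res (ξ X Y X' Y')
        (kap M (kap (starM V) p p') (kap (starM V) q q')) := by
  simp [xi]

/-- The structural morphism `I ⋆ I ⟶ I` for Day convolution. -/
def mu : conv (starM V) (yo (𝟙_ V)) (yo (𝟙_ V)) ⟶ yo (𝟙_ V) :=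
  yoTensor (starM V) (𝟙_ V) (𝟙_ V) ≫ yoMap μ

/-- The structural morphism `J ⟶ J ⊗ J` for Day convolution. -/
def gam : yo (starUnit V) ⟶
    conv M (yo (starUnit V)) (yo (starUnit V)) :=
  homMk (fun {_} p => (conv M (yo (starUnit V))
      (yo (starUnit V))).res (ofYo p ≫ γ) (kap M (toYo (𝟙 _)) (toYo (𝟙 _))))
    (fun w p => by simp)

@[simp] theorem gam_toYo {X : V} (p : X ⟶ (starUnit V)) :
    ap gam (toYo p) = (conv M (yo (starUnit V))
      (yo (starUnit V))).res (p ≫ γ) (kap M (toYo (𝟙 _)) (toYo (𝟙 _))) := by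
  simp [gam]

@[simp] theorem mu_kap {X Y : V} (p : X ⟶ 𝟙_ V) (q : Y ⟶ 𝟙_ V) :
    ap mu (kap (starM V) (toYo p) (toYo q)) = toYo (starHom p q ≫ μ) := by
  simp [mu]

theorem xi_natural {A B C D A' B' C' D' : Psh V} (f : A ⟶ A') (g : B ⟶ B') (h : C ⟶ C')
    (k : D ⟶ D') : map (starM V) (map M f g) (map M h k) ≫ xi A' B' C' D' =
      xi A B C D ≫ map M (map (starM V) f h) (map (starM V) g k) :=
  conv_ext_both fun p q p' q' => by simp

theorem xi_assoc (A B C A' B' C' : Psh V) :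
    xi (conv M A B) C (conv M A' B') C' ≫
      map M (xi A B A' B') (𝟙 (conv (starM V) C C')) ≫ (assoc M _ _ _).hom =
    map (starM V) (assoc M A B C).hom (assoc M A' B' C').hom ≫
      xi A (conv M B C) A' (conv M B' C') ≫
        map M (𝟙 (conv (starM V) A A')) (xi B C B' C') :=
  conv_ext_both fun {_ Z _ Z'} t c t' c' => by
    obtain ⟨X, Y, w, a, b, rfl⟩ := exists_rep t
    obtain ⟨X', Y', w', a', b', rfl⟩ := exists_rep t'
    have h := DuoidalCategory.ξ_assoc X Y Z X' Y' Z'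
    rw [starHom, @MonoidalCategory.tensorHom_def' V _ (starM V), Category.assoc] at h
    simp [h]

theorem xi_left_unit (A A' : Psh V) :
    xi (yo (𝟙_ V)) A (yo (𝟙_ V)) A' ≫ map M mu (𝟙 (conv (starM V) A A')) ≫
      (leftUnitor M _).hom = map (starM V) (leftUnitor M A).hom (leftUnitor M A').hom :=
  conv_ext_both fun t c t' c' => by
    obtain ⟨t, rfl⟩ := exists_toYo t
    obtain ⟨t', rfl⟩ := exists_toYo t'
    simp only [ap_comp, xi_kap, map_kap, ap_res, mu_kap, leftUnitor_kap, ap_id, res_res, kap_res,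
      MonoidalCategory.comp_whiskerRight, Category.assoc]
    refine congrFun (congrArg _ ?_) _
    change _ = starHom _ _
    rw [← starHom_comp, ← ξ_left_unit, ← Category.assoc (starHom _ _), ξ_whiskerRight,
      Category.assoc]

theorem xi_right_unit (A A' : Psh V) :
    xi A (yo (𝟙_ V)) A' (yo (𝟙_ V)) ≫ map M (𝟙 (conv (starM V) A A')) mu ≫
      (rightUnitor M _).hom = map (starM V) (rightUnitor M A).hom (rightUnitor M A').hom :=
  conv_ext_both fun c t c' t' => by
    obtain ⟨t, rfl⟩ := exists_toYo t
    obtain ⟨t', rfl⟩ := exists_toYo t'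
    simp only [ap_comp, xi_kap, map_kap, ap_res, mu_kap, rightUnitor_kap, ap_id, res_res, kap_res,
      MonoidalCategory.whiskerLeft_comp, Category.assoc]
    refine congrFun (congrArg _ ?_) _
    change _ = starHom _ _
    rw [← starHom_comp, ← ξ_right_unit, ← Category.assoc (starHom _ _), ξ_whiskerLeft,
      Category.assoc]

theorem gam_coassoc :
    gam ≫ map M gam (𝟙 (yo (starUnit V))) ≫ (assoc M _ _ _).hom =
      gam ≫ map M (𝟙 (yo (starUnit V))) gam :=
  hom_ext fun X p => by
    obtain ⟨p, rfl⟩ := exists_toYo p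
    simp [γ_coassoc]

theorem gam_left_counit :
    gam ≫ map M (yoMap ν) (𝟙 (yo (starUnit V))) ≫ (leftUnitor M _).hom = 𝟙 _ :=
  hom_ext fun X p => by
    obtain ⟨p, rfl⟩ := exists_toYo p
    simp [γ_left_counit]

theorem gam_right_counit :
    gam ≫ map M (𝟙 (yo (starUnit V))) (yoMap ν) ≫ (rightUnitor M _).hom = 𝟙 _ :=
  hom_ext fun X p => by
    obtain ⟨p, rfl⟩ := exists_toYo p
    simp [γ_right_counit]

theorem xi_star_assoc (A A' B B' C C' : Psh V) :
    map (starM V) (xi A A' B B') (𝟙 (conv M C C')) ≫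
      xi (conv (starM V) A B) (conv (starM V) A' B') C C' ≫
        map M (assoc (starM V) A B C).hom (assoc (starM V) A' B' C').hom =
    (assoc (starM V) (conv M A A') (conv M B B') (conv M C C')).hom ≫
      map (starM V) (𝟙 (conv M A A')) (xi B B' C C') ≫
        xi A A' (conv (starM V) B C) (conv (starM V) B' C') :=
  conv_ext_left fun t s r => by
    obtain ⟨X₁, Y₁, w₁, a, a', rfl⟩ := exists_rep t
    obtain ⟨X₂, Y₂, w₂, b, b', rfl⟩ := exists_rep s
    obtain ⟨X₃, Y₃, w₃, c, c', rfl⟩ := exists_rep r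
    have h := DuoidalCategory.ξ_star_assoc X₁ Y₁ X₂ Y₂ X₃ Y₃
    rw [starHom, @MonoidalCategory.tensorHom_id V _ (starM V), MonoidalCategory.tensorHom_def',
      starHom, @MonoidalCategory.id_tensorHom V _ (starM V)] at h
    simp [h]

theorem mu_star_assoc :
    map (starM V) mu (𝟙 (yo (𝟙_ V))) ≫ mu =
      (assoc (starM V) (yo (𝟙_ V)) (yo (𝟙_ V)) (yo (𝟙_ V))).hom ≫
        map (starM V) (𝟙 (yo (𝟙_ V))) mu ≫ mu :=
  conv_ext_left fun a b c => by
    obtain ⟨a, rfl⟩ := exists_toYo a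
    obtain ⟨b, rfl⟩ := exists_toYo b
    obtain ⟨c, rfl⟩ := exists_toYo c
    simp only [ap_comp, map_kap, mu_kap, ap_id, assoc_kap, ap_res, yo_res]
    refine congrArg _ ?_
    have h := μ_star_assoc (V := V)
    have h₁ : starHom (starHom a b ≫ μ) c = starHom (starHom a b) c ≫ starHom μ (𝟙 _) := by
      rw [starHom_comp, Category.comp_id]
    have h₂ : starHom a (starHom b c ≫ μ) = starHom a (starHom b c) ≫ starHom (𝟙 _) μ := by
      rw [starHom_comp, Category.comp_id]
    rw [h₁, h₂, Category.assoc, Category.assoc, h, ← Category.assoc, starAssoc_naturality,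
      Category.assoc]

theorem xi_star_left_unit (A B : Psh V) :
    map (starM V) gam (𝟙 (conv M A B)) ≫ xi (yo (starUnit V)) (yo (starUnit V)) A B ≫
      map M (leftUnitor (starM V) A).hom (leftUnitor (starM V) B).hom =
        (leftUnitor (starM V) (conv M A B)).hom :=
  conv_ext_right fun {_ Y₁ Z₁} j a b => by
    obtain ⟨j, rfl⟩ := exists_toYo j
    have h := DuoidalCategory.ξ_star_left_unit (V := V) Y₁ Z₁
    simp only [ap_comp, xi_kap, map_kap, ap_res, gam_toYo, leftUnitor_kap, ap_id, res_res,
      kap_res_left, kap_res_right]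
    refine congrFun (congrArg _ ?_) _
    simp only [star_whiskerRight, starHom_id, Category.id_comp]
    rw [MonoidalCategory.tensorHom_def'] at h
    have h₁ : starHom (j ≫ γ) (𝟙 (Y₁ ⊗ Z₁)) = starHom j (𝟙 _) ≫ starHom γ (𝟙 _) := by
      rw [starHom_comp, Category.comp_id]
    rw [h₁, Category.assoc, h]

theorem mu_star_left_unit :
    map (starM V) (yoMap ν) (𝟙 (yo (𝟙_ V))) ≫ mu = (leftUnitor (starM V) (yo (𝟙_ V))).hom :=
  conv_ext fun a b => by
    obtain ⟨a, rfl⟩ := exists_toYo a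
    obtain ⟨b, rfl⟩ := exists_toYo b
    simp only [ap_comp, map_kap, mu_kap, ap_id, yoMap_toYo, leftUnitor_kap, yo_res]
    refine congrArg _ ?_
    rw [star_whiskerRight, Category.assoc, ← starLeft_naturality, ← μ_star_left_unit,
      starHom_comp_assoc, starHom_comp_assoc]
    simp

theorem xi_star_right_unit (A B : Psh V) :
    map (starM V) (𝟙 (conv M A B)) gam ≫ xi A B (yo (starUnit V)) (yo (starUnit V)) ≫
      map M (rightUnitor (starM V) A).hom (rightUnitor (starM V) B).hom =
        (rightUnitor (starM V) (conv M A B)).hom :=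
  conv_ext_left fun {Y₁ Z₁ _} a b j => by
    obtain ⟨j, rfl⟩ := exists_toYo j
    have h := DuoidalCategory.ξ_star_right_unit (V := V) Y₁ Z₁
    simp only [ap_comp, xi_kap, map_kap, ap_res, gam_toYo, rightUnitor_kap, ap_id, res_res,
      kap_res_left, kap_res_right]
    refine congrFun (congrArg _ ?_) _
    simp only [star_whiskerLeft, starHom_id, Category.id_comp]
    rw [MonoidalCategory.tensorHom_def'] at h
    have h₁ : starHom (𝟙 (Y₁ ⊗ Z₁)) (j ≫ γ) = starHom (𝟙 _) j ≫ starHom (𝟙 _) γ := by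
      rw [starHom_comp, Category.comp_id]
    rw [h₁, Category.assoc, h]

theorem mu_star_right_unit :
    map (starM V) (𝟙 (yo (𝟙_ V))) (yoMap ν) ≫ mu = (rightUnitor (starM V) (yo (𝟙_ V))).hom :=
  conv_ext fun a b => by
    obtain ⟨a, rfl⟩ := exists_toYo a
    obtain ⟨b, rfl⟩ := exists_toYo b
    simp only [ap_comp, map_kap, mu_kap, ap_id, yoMap_toYo, rightUnitor_kap, yo_res]
    refine congrArg _ ?_
    rw [star_whiskerLeft, Category.assoc, ← starRight_naturality, ← μ_star_right_unit,
      starHom_comp_assoc, starHom_comp_assoc]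
    simp

end Day

section

variable (V : Type u) [SmallCategory V] [M : MonoidalCategory V]

instance : MonoidalCategory (Psh V) := Day.monoidal M

instance [StarMonoidal V] : StarMonoidal (Psh V) where
  str := Day.monoidal (starM V)

instance [StarMonoidal V] [DuoidalCategory V] : DuoidalCategory (Psh V) where
  ξ := Day.xi
  μ := Day.mu
  ν := Day.yoMap DuoidalCategory.ν
  γ := Day.gam
  ξ_natural := Day.xi_natural
  ξ_assoc := Day.xi_assoc
  ξ_left_unit := Day.xi_left_unit
  ξ_right_unit := Day.xi_right_unit
  γ_coassoc := Day.gam_coassoc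
  γ_left_counit := Day.gam_left_counit
  γ_right_counit := Day.gam_right_counit
  ξ_star_assoc := Day.xi_star_assoc
  μ_star_assoc := Day.mu_star_assoc
  ξ_star_left_unit := Day.xi_star_left_unit
  μ_star_left_unit := Day.mu_star_left_unit
  ξ_star_right_unit := Day.xi_star_right_unit
  μ_star_right_unit := Day.mu_star_right_unit

end

instance (V : Type u) [SmallCategory V] [MonoidalCategory V] [StarMonoidal V]
    [DuoidalCategory V] [NormalDuoidal V] : NormalDuoidal (Psh V) where
  isIso_ν := ⟨Day.yoMap (inv DuoidalCategory.ν),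
    Psh.hom_ext fun _ p => by
      obtain ⟨p, rfl⟩ := Psh.exists_toYo p
      change Psh.ap (Day.yoMap _ ≫ Day.yoMap _) _ = _
      simp,
    Psh.hom_ext fun _ p => by
      obtain ⟨p, rfl⟩ := Psh.exists_toYo p
      change Psh.ap (Day.yoMap _ ≫ Day.yoMap _) _ = _
      simp⟩

/-- A (left) `W`-category: composition is a family of morphisms
`C(B, C) ⊗ C(A, B) ⟶ C(A, C)`. -/
structure LCat (W : Type v) [Category.{u} W] [MonoidalCategory W] where
  ob : Type u
  hom : ob → ob → W
  one (a : ob) : 𝟙_ W ⟶ hom a a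
  comp (a b c : ob) : hom b c ⊗ hom a b ⟶ hom a c
  one_comp (a b : ob) : one b ▷ hom a b ≫ comp a b b = (λ_ (hom a b)).hom
  comp_one (a b : ob) : hom a b ◁ one a ≫ comp a a b = (ρ_ (hom a b)).hom
  assoc (a b c d : ob) : comp b c d ▷ hom a b ≫ comp a b d =
    (α_ (hom c d) (hom b c) (hom a b)).hom ≫ hom c d ◁ comp a b c ≫ comp a c d

namespace LCat

variable {W : Type v} [Category.{u} W] [MonoidalCategory W] (C : LCat.{u} W)

/-- The morphisms of the underlying ordinary category of a `W`-category. -/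
abbrev Und (a b : C.ob) : Type u := 𝟙_ W ⟶ C.hom a b

variable {C}

/-- Composition with a morphism of the underlying category. -/
def post {b c : C.ob} (y : C.Und b c) (a : C.ob) : C.hom a b ⟶ C.hom a c :=
  (λ_ (C.hom a b)).inv ≫ y ▷ C.hom a b ≫ C.comp a b c

/-- Composition with a morphism of the underlying category. -/
def pre {a b : C.ob} (x : C.Und a b) (c : C.ob) : C.hom b c ⟶ C.hom a c :=
  (ρ_ (C.hom b c)).inv ≫ C.hom b c ◁ x ≫ C.comp a b c

@[simp] theorem post_one (b a : C.ob) : post (C.one b) a = 𝟙 (C.hom a b) := by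
  simp [post, C.one_comp]

@[simp] theorem pre_one (a c : C.ob) : pre (C.one a) c = 𝟙 (C.hom a c) := by
  simp [pre, C.comp_one]

theorem und_comp {a b c : C.ob} (x : C.Und a b) (y : C.Und b c) :
    x ≫ post y a = y ≫ pre x c := by
  simp only [post, pre]
  rw [← Category.assoc, leftUnitor_inv_naturality, Category.assoc, ← Category.assoc (𝟙_ W ◁ x),
    whisker_exchange, Category.assoc, ← Category.assoc y, rightUnitor_inv_naturality,
    Category.assoc, unitors_inv_equal]

@[simp] theorem one_post {a b : C.ob} (y : C.Und a b) : C.one a ≫ post y a = y := by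
  rw [und_comp, pre_one, Category.comp_id]

@[simp] theorem one_pre {a b : C.ob} (x : C.Und a b) : C.one b ≫ pre x b = x := by
  rw [← und_comp, post_one, Category.comp_id]

theorem comp_post {a b c d : C.ob} (y : C.Und c d) :
    C.comp a b c ≫ post y a = (post y b ▷ C.hom a b) ≫ C.comp a b d := by
  simp only [post, comp_whiskerRight, Category.assoc, C.assoc]
  rw [← Category.assoc, leftUnitor_inv_naturality, Category.assoc, ← Category.assoc (𝟙_ W ◁ _),
    whisker_exchange]
  simp

theorem comp_pre {a b c d : C.ob} (x : C.Und a b) :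
    C.comp b c d ≫ pre x d = (C.hom c d ◁ pre x c) ≫ C.comp a c d := by
  have h := C.assoc a b c d
  simp only [pre, whiskerLeft_comp, Category.assoc]
  rw [← Category.assoc, rightUnitor_inv_naturality, Category.assoc,
    ← Category.assoc (_ ▷ 𝟙_ W), ← whisker_exchange, Category.assoc, h]
  simp

theorem pre_whisker_comp {a b c d : C.ob} (x : C.Und b c) :
    (pre x d ▷ C.hom a b) ≫ C.comp a b d = (C.hom c d ◁ post x a) ≫ C.comp a c d := by
  have h := C.assoc a b c d
  simp only [pre, post, whiskerLeft_comp, comp_whiskerRight, Category.assoc, h]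
  simp

theorem post_post {a b c d : C.ob} (y : C.Und b c) (z : C.Und c d) :
    post y a ≫ post z a = post (y ≫ post z b) a := by
  have h : post y a = (λ_ (C.hom a b)).inv ≫ y ▷ C.hom a b ≫ C.comp a b c := rfl
  rw [h, Category.assoc, Category.assoc, comp_post]
  change _ = (λ_ (C.hom a b)).inv ≫ (y ≫ post z b) ▷ C.hom a b ≫ C.comp a b d
  rw [comp_whiskerRight, Category.assoc]

theorem pre_pre {a b c d : C.ob} (x : C.Und a b) (y : C.Und b c) :
    pre y d ≫ pre x d = pre (x ≫ post y a) d := by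
  have h : pre y d = (ρ_ (C.hom c d)).inv ≫ C.hom c d ◁ y ≫ C.comp b c d := rfl
  rw [und_comp, h, Category.assoc, Category.assoc, comp_pre]
  change _ = (ρ_ (C.hom c d)).inv ≫ C.hom c d ◁ (y ≫ pre x c) ≫ C.comp a c d
  rw [whiskerLeft_comp, Category.assoc]

theorem post_pre {a b c d : C.ob} (x : C.Und a b) (y : C.Und c d) :
    post y b ≫ pre x d = pre x c ≫ post y a := by
  rw [post, Category.assoc, Category.assoc, comp_pre, post, ← Category.assoc (pre x c),
    leftUnitor_inv_naturality, Category.assoc, ← Category.assoc (𝟙_ W ◁ _), whisker_exchange]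
  simp

end LCat

/-- A functor of (left) `W`-categories. -/
@[ext] structure LFunctor {W : Type v} [Category.{u} W] [MonoidalCategory W] (A B : LCat.{u} W) where
  obj : A.ob → B.ob
  map (a a' : A.ob) : A.hom a a' ⟶ B.hom (obj a) (obj a')
  map_one (a : A.ob) : A.one a ≫ map a a = B.one (obj a)
  map_comp (a b c : A.ob) :
    A.comp a b c ≫ map a c = (map b c ⊗ₘ map a b) ≫ B.comp (obj a) (obj b) (obj c)

namespace LFunctor

variable {W : Type v} [Category.{u} W] [MonoidalCategory W] {A B C D : LCat.{u} W}

attribute [simp] map_one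

/-- The identity functor. -/
@[reducible] protected def id (A : LCat.{u} W) : LFunctor A A where
  obj a := a
  map _ _ := 𝟙 _
  map_one _ := Category.comp_id _
  map_comp _ _ _ := by simp

/-- Composition of functors. -/
@[reducible] protected def comp (F : LFunctor A B) (G : LFunctor B C) : LFunctor A C where
  obj a := G.obj (F.obj a)
  map a a' := F.map a a' ≫ G.map _ _
  map_one _ := by rw [← Category.assoc, F.map_one, G.map_one]
  map_comp a b c := by
    rw [← Category.assoc, F.map_comp, Category.assoc, G.map_comp, ← Category.assoc,
      tensorHom_comp_tensorHom]

theorem post_map (F : LFunctor A B) {a b c : A.ob} (y : A.Und b c) :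
    LCat.post y a ≫ F.map a c = F.map a b ≫ LCat.post (y ≫ F.map b c) (F.obj a) := by
  simp only [LCat.post, Category.assoc, F.map_comp, comp_whiskerRight, MonoidalCategory.tensorHom_def]
  rw [← Category.assoc (F.map a b), leftUnitor_inv_naturality, Category.assoc,
    ← Category.assoc (𝟙_ W ◁ _), whisker_exchange, Category.assoc,
    ← Category.assoc (_ ◁ _), whisker_exchange, Category.assoc]

theorem pre_map (F : LFunctor A B) {a b c : A.ob} (x : A.Und a b) :
    LCat.pre x c ≫ F.map a c = F.map b c ≫ LCat.pre (x ≫ F.map a b) (F.obj c) := by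
  simp only [LCat.pre, Category.assoc, F.map_comp, whiskerLeft_comp, MonoidalCategory.tensorHom_def']
  rw [← Category.assoc (F.map b c), rightUnitor_inv_naturality, Category.assoc,
    ← Category.assoc (_ ▷ 𝟙_ W), ← whisker_exchange, Category.assoc,
    ← Category.assoc (_ ▷ _), ← whisker_exchange, Category.assoc]

end LFunctor

/-- A `W`-natural transformation. -/
@[ext] structure LNatTrans {W : Type v} [Category.{u} W] [MonoidalCategory W] {A B : LCat.{u} W}
    (F G : LFunctor A B) where
  app (a : A.ob) : B.Und (F.obj a) (G.obj a)
  naturality (a a' : A.ob) :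
    F.map a a' ≫ LCat.post (app a') (F.obj a) = G.map a a' ≫ LCat.pre (app a) (G.obj a')

namespace LNatTrans

variable {W : Type v} [Category.{u} W] [MonoidalCategory W] {A B C : LCat.{u} W}

/-- The identity transformation. -/
@[simps] protected def id (F : LFunctor A B) : LNatTrans F F where
  app a := B.one (F.obj a)
  naturality _ _ := by simp

/-- Vertical composition. -/
@[simps] protected def comp {F G H : LFunctor A B} (θ : LNatTrans F G) (κ : LNatTrans G H) :
    LNatTrans F H where
  app a := θ.app a ≫ LCat.post (κ.app a) (F.obj a)
  naturality a a' := by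
    rw [← LCat.post_post, ← Category.assoc, θ.naturality, Category.assoc, ← LCat.post_pre,
      ← Category.assoc, κ.naturality, Category.assoc, LCat.pre_pre]

end LNatTrans

namespace LCat

variable {W : Type v} [Category.{u} W] [MonoidalCategory W]

instance : CategoryStruct (LCat.{u} W) where
  Hom A B := LFunctor A B
  id A := LFunctor.id A
  comp F G := LFunctor.comp F G

instance homCategory (A B : LCat.{u} W) : Category (LFunctor A B) where
  Hom F G := LNatTrans F G
  id F := LNatTrans.id F
  comp θ κ := LNatTrans.comp θ κ
  id_comp θ := LNatTrans.ext (funext fun a => one_post _)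
  comp_id θ := LNatTrans.ext (funext fun a => by
    change θ.app a ≫ post (B.one _) _ = _
    simp)
  assoc θ κ σ := LNatTrans.ext (funext fun a => by
    change (θ.app a ≫ post (κ.app a) _) ≫ post (σ.app a) _ =
      θ.app a ≫ post (κ.app a ≫ post (σ.app a) _) _
    rw [Category.assoc, post_post])

end LCat

namespace LNatTrans

variable {W : Type v} [Category.{u} W] [MonoidalCategory W] {A B C D : LCat.{u} W}

theorem ext' {F G : LFunctor A B} {θ κ : F ⟶ G} (h : ∀ a, LNatTrans.app θ a = LNatTrans.app κ a) :
    θ = κ :=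
  LNatTrans.ext (funext h)

theorem comp_app' {F G H : LFunctor A B} (θ : F ⟶ G) (κ : G ⟶ H) (a : A.ob) :
    app (θ ≫ κ) a = app θ a ≫ LCat.post (app κ a) (F.obj a) := rfl

theorem id_app' (F : LFunctor A B) (a : A.ob) : app (𝟙 F) a = B.one (F.obj a) := rfl

theorem app_eqToHom {F G : LFunctor A B} (h : F = G) (a : A.ob)
    (e : B.Und (F.obj a) (G.obj a)) (he : HEq e (B.one (F.obj a))) :
    app (eqToHom h) a = e := by
  subst h
  exact (eq_of_heq he).symm

/-- Whiskering of a transformation by a functor. -/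
@[simps] def whiskerLeft (F : LFunctor A B) {G H : LFunctor B C} (θ : LNatTrans G H) :
    LNatTrans (F.comp G) (F.comp H) where
  app a := θ.app (F.obj a)
  naturality a a' := by
    dsimp only [LFunctor.comp]
    simp only [Category.assoc]
    rw [θ.naturality]

/-- Whiskering of a transformation by a functor. -/
@[simps] def whiskerRight {F G : LFunctor A B} (θ : LNatTrans F G) (H : LFunctor B C) :
    LNatTrans (F.comp H) (G.comp H) where
  app a := θ.app a ≫ H.map _ _
  naturality a a' := by
    dsimp only [LFunctor.comp]
    simp only [Category.assoc]
    rw [← H.post_map, ← H.pre_map, ← Category.assoc, θ.naturality, Category.assoc]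

/-- The (identity) associator of composition of functors. -/
def assocIso (F : LFunctor A B) (G : LFunctor B C) (H : LFunctor C D) :
    (F.comp G).comp H ≅ F.comp (G.comp H) where
  hom := LNatTrans.mk (fun _ => D.one _) (by dsimp only [LFunctor.comp, LFunctor.id]; simp)
  inv := LNatTrans.mk (fun _ => D.one _) (by dsimp only [LFunctor.comp, LFunctor.id]; simp)
  hom_inv_id := ext' fun _ => LCat.one_post _
  inv_hom_id := ext' fun _ => LCat.one_post _

/-- The (identity) left unitor of composition of functors. -/
def leftIso (F : LFunctor A B) : (LFunctor.id A).comp F ≅ F where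
  hom := LNatTrans.mk (fun _ => B.one _) (by dsimp only [LFunctor.comp, LFunctor.id]; simp)
  inv := LNatTrans.mk (fun _ => B.one _) (by dsimp only [LFunctor.comp, LFunctor.id]; simp)
  hom_inv_id := ext' fun _ => LCat.one_post _
  inv_hom_id := ext' fun _ => LCat.one_post _

/-- The (identity) right unitor of composition of functors. -/
def rightIso (F : LFunctor A B) : F.comp (LFunctor.id B) ≅ F where
  hom := LNatTrans.mk (fun _ => B.one _) (by dsimp only [LFunctor.comp, LFunctor.id]; simp)
  inv := LNatTrans.mk (fun _ => B.one _) (by dsimp only [LFunctor.comp, LFunctor.id]; simp)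
  hom_inv_id := ext' fun _ => LCat.one_post _
  inv_hom_id := ext' fun _ => LCat.one_post _

end LNatTrans

theorem LFunctor.comp_assoc {W : Type v} [Category.{u} W] [MonoidalCategory W]
    {A B C D : LCat.{u} W} (F : LFunctor A B) (G : LFunctor B C) (H : LFunctor C D) :
    (F.comp G).comp H = F.comp (G.comp H) := by
  simp only [LFunctor.comp, Category.assoc]

theorem LFunctor.id_comp {W : Type v} [Category.{u} W] [MonoidalCategory W]
    {A B : LCat.{u} W} (F : LFunctor A B) : (LFunctor.id A).comp F = F := by
  simp only [LFunctor.comp, LFunctor.id, Category.id_comp]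

theorem LFunctor.comp_id {W : Type v} [Category.{u} W] [MonoidalCategory W]
    {A B : LCat.{u} W} (F : LFunctor A B) : F.comp (LFunctor.id B) = F := by
  simp only [LFunctor.comp, LFunctor.id, Category.comp_id]

/-- The 2-category of `W`-categories. -/
instance LCat.bicategory {W : Type v} [Category.{u} W] [MonoidalCategory W] :
    Bicategory (LCat.{u} W) where
  homCategory A B := LCat.homCategory A B
  whiskerLeft F _ _ θ := LNatTrans.whiskerLeft F θ
  whiskerRight θ H := LNatTrans.whiskerRight θ H
  associator F G H := LNatTrans.assocIso F G H
  leftUnitor F := LNatTrans.leftIso F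
  rightUnitor F := LNatTrans.rightIso F
  whiskerLeft_id _ _ := rfl
  whiskerLeft_comp _ _ _ _ _ _ := rfl
  id_whiskerLeft θ := LNatTrans.ext' fun a => by
    change LNatTrans.app θ a = LCat.one _ _ ≫ LCat.post (LNatTrans.app θ a ≫ LCat.post (LCat.one _ _) _) _
    rw [LCat.post_one, Category.comp_id, LCat.one_post]
  comp_whiskerLeft F G _ _ θ := LNatTrans.ext' fun a => by
    change LNatTrans.app θ (G.obj (F.obj a)) =
      LCat.one _ _ ≫ LCat.post (LNatTrans.app θ (G.obj (F.obj a)) ≫ LCat.post (LCat.one _ _) _) _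
    rw [LCat.post_one, Category.comp_id, LCat.one_post]
  id_whiskerRight F G := LNatTrans.ext' fun a => G.map_one _
  comp_whiskerRight θ κ H := LNatTrans.ext' fun a => by
    change (LNatTrans.app θ a ≫ LCat.post (LNatTrans.app κ a) _) ≫ H.map _ _ =
      (LNatTrans.app θ a ≫ H.map _ _) ≫ LCat.post (LNatTrans.app κ a ≫ H.map _ _) _
    rw [Category.assoc, Category.assoc, LFunctor.post_map]
  whiskerRight_id θ := LNatTrans.ext' fun a => by
    change LNatTrans.app θ a ≫ 𝟙 _ = LCat.one _ _ ≫ LCat.post (LNatTrans.app θ a ≫ LCat.post (LCat.one _ _) _) _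
    rw [LCat.post_one, Category.comp_id, LCat.one_post]
  whiskerRight_comp θ G H := LNatTrans.ext' fun a => by
    change LNatTrans.app θ a ≫ G.map _ _ ≫ H.map _ _ =
      LCat.one _ _ ≫ LCat.post (((LNatTrans.app θ a ≫ G.map _ _) ≫ H.map _ _) ≫ LCat.post (LCat.one _ _) _) _
    rw [LCat.post_one, Category.comp_id, Category.assoc, LCat.one_post]
  whisker_assoc F _ _ θ H := LNatTrans.ext' fun a => by
    change LNatTrans.app θ (F.obj a) ≫ H.map _ _ =
      LCat.one _ _ ≫ LCat.post ((LNatTrans.app θ (F.obj a) ≫ H.map _ _) ≫ LCat.post (LCat.one _ _) _) _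
    rw [LCat.post_one, Category.comp_id, LCat.one_post]
  whisker_exchange {_ _ _ F G H K} θ κ := LNatTrans.ext' fun a => by
    change LNatTrans.app κ (F.obj a) ≫ LCat.post (LNatTrans.app θ a ≫ K.map _ _) _ =
      (LNatTrans.app θ a ≫ H.map _ _) ≫ LCat.post (LNatTrans.app κ _) _
    rw [LCat.und_comp, Category.assoc, Category.assoc, LNatTrans.naturality]
  pentagon {_ _ _ _ E} F G H K := LNatTrans.ext' fun a => by
    change (LCat.one _ _ ≫ K.map _ _) ≫ LCat.post (LCat.one E _ ≫ LCat.post (LCat.one _ _) _) _ =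
      LCat.one E _ ≫ LCat.post (LCat.one _ _) _
    rw [LFunctor.map_one, LCat.one_post, LCat.one_post]
  triangle {_ _ C} F G := LNatTrans.ext' fun a => by
    change LCat.one C _ ≫ LCat.post (LCat.one _ _) _ = LCat.one _ _ ≫ G.map _ _
    rw [LFunctor.map_one, LCat.one_post]

instance LCat.strict {W : Type v} [Category.{u} W] [MonoidalCategory W] :
    Bicategory.Strict (LCat.{u} W) where
  id_comp F := LFunctor.id_comp F
  comp_id F := LFunctor.comp_id F
  assoc F G H := LFunctor.comp_assoc F G H
  leftUnitor_eqToIso F := Iso.ext (LNatTrans.ext' fun a =>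
    (LNatTrans.app_eqToHom (LFunctor.id_comp F) a _ HEq.rfl).symm)
  rightUnitor_eqToIso F := Iso.ext (LNatTrans.ext' fun a =>
    (LNatTrans.app_eqToHom (LFunctor.comp_id F) a _ HEq.rfl).symm)
  associator_eqToIso F G H := Iso.ext (LNatTrans.ext' fun a =>
    (LNatTrans.app_eqToHom (LFunctor.comp_assoc F G H) a _ HEq.rfl).symm)

theorem LNatTrans.eqToHom_comp_comp_eqToHom {W : Type v} [Category.{u} W] [MonoidalCategory W]
    {A B : LCat.{u} W} {F G F' G' : LFunctor A B} (h : F' = F) (h' : G = G') (θ : F ⟶ G)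
    (κ : F' ⟶ G') (hθ : ∀ a, HEq (LNatTrans.app θ a) (LNatTrans.app κ a)) :
    eqToHom h ≫ θ ≫ eqToHom h' = κ := by
  subst h h'
  rw [eqToHom_refl, eqToHom_refl, Category.id_comp, Category.comp_id]
  exact LNatTrans.ext' fun a => eq_of_heq (hθ a)

namespace LCat

open Functor.LaxMonoidal

variable {W : Type v₁} [Category.{u} W] [MonoidalCategory W] {W' : Type v₂} [Category.{u} W']
  [MonoidalCategory W'] (Φ : W ⥤ W') [Φ.LaxMonoidal]

/-- Change of base of a `W`-category along a lax monoidal functor `W ⥤ W'`. -/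
@[reducible] def baseObj (C : LCat.{u} W) : LCat.{u} W' where
  ob := C.ob
  hom a b := Φ.obj (C.hom a b)
  one a := ε Φ ≫ Φ.map (C.one a)
  comp a b c := μ Φ _ _ ≫ Φ.map (C.comp a b c)
  one_comp a b := by
    rw [comp_whiskerRight, Category.assoc, μ_natural_left_assoc, ← Φ.map_comp, C.one_comp,
      left_unitality]
  comp_one a b := by
    rw [whiskerLeft_comp, Category.assoc, μ_natural_right_assoc, ← Φ.map_comp, C.comp_one,
      right_unitality]
  assoc a b c d := by
    rw [comp_whiskerRight, whiskerLeft_comp, Category.assoc, Category.assoc,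
      μ_natural_left_assoc, μ_natural_right_assoc, ← Φ.map_comp, C.assoc, Φ.map_comp,
      associativity_assoc, Φ.map_comp]

/-- The action of change of base on morphisms of the underlying category. -/
def hom0 {C : LCat.{u} W} {a b : C.ob} (x : C.Und a b) : (baseObj Φ C).Und a b :=
  ε Φ ≫ Φ.map x

theorem post_hom0 {C : LCat.{u} W} {b c : C.ob} (y : C.Und b c) (a : C.ob) :
    post (C := baseObj Φ C) (hom0 Φ y) a = Φ.map (post y a) := by
  simp only [post, hom0, comp_whiskerRight, Category.assoc, μ_natural_left_assoc, Φ.map_comp]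
  rw [left_unitality_inv_assoc]

theorem pre_hom0 {C : LCat.{u} W} {a b : C.ob} (x : C.Und a b) (c : C.ob) :
    pre (C := baseObj Φ C) (hom0 Φ x) c = Φ.map (pre x c) := by
  simp only [pre, hom0, whiskerLeft_comp, Category.assoc, μ_natural_right_assoc, Φ.map_comp]
  rw [right_unitality_inv_assoc]

/-- Change of base of a functor. -/
@[reducible] def baseMap {C D : LCat.{u} W} (F : LFunctor C D) :
    LFunctor (baseObj Φ C) (baseObj Φ D) where
  obj a := F.obj a
  map a b := Φ.map (F.map a b)
  map_one a := by rw [Category.assoc, ← Φ.map_comp, F.map_one]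
  map_comp a b c := by
    rw [Category.assoc, ← Φ.map_comp, F.map_comp, μ_natural_assoc, Φ.map_comp]

/-- Change of base of a transformation. -/
@[reducible] def baseMap₂ {C D : LCat.{u} W} {F G : LFunctor C D} (θ : LNatTrans F G) :
    LNatTrans (baseMap Φ F) (baseMap Φ G) where
  app a := hom0 Φ (θ.app a)
  naturality a b := by
    change Φ.map (F.map a b) ≫ post (C := baseObj Φ D) (hom0 Φ (θ.app b)) (F.obj a) =
      Φ.map (G.map a b) ≫ pre (C := baseObj Φ D) (hom0 Φ (θ.app a)) (G.obj b)
    rw [post_hom0, pre_hom0, ← Φ.map_comp, ← Φ.map_comp, θ.naturality]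

theorem baseMap_id (C : LCat.{u} W) : baseMap Φ (LFunctor.id C) = LFunctor.id (baseObj Φ C) := by
  simp only [baseMap, LFunctor.id, Φ.map_id]

theorem baseMap_comp {C D E : LCat.{u} W} (F : LFunctor C D) (G : LFunctor D E) :
    baseMap Φ (F.comp G) = (baseMap Φ F).comp (baseMap Φ G) := by
  simp only [baseMap, LFunctor.comp, Φ.map_comp]

/-- The 2-functor given by change of base along a lax monoidal functor. -/
def changeBase : StrictPseudofunctor (LCat.{u} W) (LCat.{u} W') :=
  StrictPseudofunctor.mk''
    { obj := fun C => baseObj Φ C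
      map := fun F => baseMap Φ F
      map₂ := fun θ => baseMap₂ Φ θ
      map₂_id := fun F => rfl
      map₂_comp := fun θ κ => LNatTrans.ext' fun a => by
        change hom0 Φ (LNatTrans.app θ a ≫ post (LNatTrans.app κ a) _) =
          hom0 Φ (LNatTrans.app θ a) ≫ post (C := baseObj Φ _) (hom0 Φ (LNatTrans.app κ a)) _
        rw [post_hom0, hom0, hom0, Φ.map_comp, Category.assoc]
      map_id := baseMap_id Φ
      map_comp := baseMap_comp Φ
      map₂_whisker_left := fun F G H θ => by
        refine (LNatTrans.eqToHom_comp_comp_eqToHom _ _ _ _ fun a => ?_).symm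
        exact HEq.rfl
      map₂_whisker_right := fun θ H => by
        refine (LNatTrans.eqToHom_comp_comp_eqToHom _ _ _ _ fun a => ?_).symm
        refine heq_of_eq ?_
        change (ε Φ ≫ Φ.map _) ≫ Φ.map _ = ε Φ ≫ Φ.map (_ ≫ _)
        rw [Φ.map_comp, Category.assoc] }

end LCat

namespace LCat

variable {W : Type v} [Category.{u} W] [MonoidalCategory W] {C : LCat.{u} W}

/-- Composition in the underlying category of a `W`-category. -/
@[reducible] def ucomp {a b c : C.ob} (x : C.Und a b) (y : C.Und b c) : C.Und a c := x ≫ post y a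

theorem ucomp_assoc {a b c d : C.ob} (x : C.Und a b) (y : C.Und b c) (z : C.Und c d) :
    ucomp (ucomp x y) z = ucomp x (ucomp y z) := by
  simp only [ucomp, Category.assoc, post_post]

theorem one_ucomp {a b : C.ob} (x : C.Und a b) : ucomp (C.one a) x = x := one_post x

theorem ucomp_one {a b : C.ob} (x : C.Und a b) : ucomp x (C.one b) = x := by
  rw [ucomp, post_one, Category.comp_id]

theorem ucomp_map {D : LCat.{u} W} (F : LFunctor C D) {a b c : C.ob} (x : C.Und a b)
    (y : C.Und b c) : ucomp x y ≫ F.map a c = ucomp (x ≫ F.map a b) (y ≫ F.map b c) := by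
  simp only [ucomp, Category.assoc, F.post_map]

theorem ucomp_naturality {D : LCat.{u} W} {F G : LFunctor C D} (θ : LNatTrans F G) {a b : C.ob}
    (x : C.Und a b) : ucomp (x ≫ F.map a b) (θ.app b) = ucomp (θ.app a) (x ≫ G.map a b) := by
  rw [ucomp, ucomp, und_comp (θ.app a), Category.assoc, Category.assoc, θ.naturality]

end LCat

/-- A pair of families of `W`-functors `F(-, b) : A ⟶ C` and `F(a, -) : B ⟶ C` which agree on
objects. -/
@[ext] structure Sesq {W : Type v} [Category.{u} W] [MonoidalCategory W] (A B C : LCat.{u} W) where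
  obj : A.ob → B.ob → C.ob
  mapL (a a' : A.ob) (b : B.ob) : A.hom a a' ⟶ C.hom (obj a b) (obj a' b)
  mapR (a : A.ob) (b b' : B.ob) : B.hom b b' ⟶ C.hom (obj a b) (obj a b')
  mapL_one (a : A.ob) (b : B.ob) : A.one a ≫ mapL a a b = C.one (obj a b)
  mapL_comp (a a' a'' : A.ob) (b : B.ob) : A.comp a a' a'' ≫ mapL a a'' b =
    (mapL a' a'' b ⊗ₘ mapL a a' b) ≫ C.comp (obj a b) (obj a' b) (obj a'' b)
  mapR_one (a : A.ob) (b : B.ob) : B.one b ≫ mapR a b b = C.one (obj a b)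
  mapR_comp (a : A.ob) (b b' b'' : B.ob) : B.comp b b' b'' ≫ mapR a b b'' =
    (mapR a b' b'' ⊗ₘ mapR a b b') ≫ C.comp (obj a b) (obj a b') (obj a b'')

namespace Sesq

open LCat

variable {W : Type v} [Category.{u} W] [MonoidalCategory W] {A B C : LCat.{u} W}

/-- The functor `F(-, b)`. -/
@[reducible] def left (F : Sesq A B C) (b : B.ob) : LFunctor A C where
  obj a := F.obj a b
  map a a' := F.mapL a a' b
  map_one a := F.mapL_one a b
  map_comp a a' a'' := F.mapL_comp a a' a'' b

/-- The functor `F(a, -)`. -/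
@[reducible] def right (F : Sesq A B C) (a : A.ob) : LFunctor B C where
  obj b := F.obj a b
  map b b' := F.mapR a b b'
  map_one b := F.mapR_one a b
  map_comp b b' b'' := F.mapR_comp a b b' b''

/-- A family of morphisms of the underlying category which is `W`-natural in each variable. -/
@[ext] structure Trans (F G : Sesq A B C) where
  app (a : A.ob) (b : B.ob) : C.Und (F.obj a b) (G.obj a b)
  natL (a a' : A.ob) (b : B.ob) :
    F.mapL a a' b ≫ post (app a' b) (F.obj a b) = G.mapL a a' b ≫ pre (app a b) (G.obj a' b)
  natR (a : A.ob) (b b' : B.ob) :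
    F.mapR a b b' ≫ post (app a b') (F.obj a b) = G.mapR a b b' ≫ pre (app a b) (G.obj a b')

/-- The component of a transformation in the first variable. -/
@[reducible] def Trans.left {F G : Sesq A B C} (θ : Trans F G) (b : B.ob) :
    LNatTrans (F.left b) (G.left b) where
  app a := θ.app a b
  naturality a a' := θ.natL a a' b

/-- The component of a transformation in the second variable. -/
@[reducible] def Trans.right {F G : Sesq A B C} (θ : Trans F G) (a : A.ob) :
    LNatTrans (F.right a) (G.right a) where
  app b := θ.app a b
  naturality b b' := θ.natR a b b'

instance : Category (Sesq A B C) where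
  Hom F G := Trans F G
  id F :=
    { app := fun a b => C.one (F.obj a b)
      natL := fun a a' b => (LNatTrans.id (F.left b)).naturality a a'
      natR := fun a b b' => (LNatTrans.id (F.right a)).naturality b b' }
  comp θ κ :=
    { app := fun a b => ucomp (θ.app a b) (κ.app a b)
      natL := fun a a' b => (LNatTrans.comp (θ.left b) (κ.left b)).naturality a a'
      natR := fun a b b' => (LNatTrans.comp (θ.right a) (κ.right a)).naturality b b' }
  id_comp θ := Trans.ext (funext fun a => funext fun b => one_ucomp _)
  comp_id θ := Trans.ext (funext fun a => funext fun b => ucomp_one _)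
  assoc θ κ σ := Trans.ext (funext fun a => funext fun b => ucomp_assoc _ _ _)

theorem hom_ext {F G : Sesq A B C} {θ κ : F ⟶ G} (h : ∀ a b, Trans.app θ a b = Trans.app κ a b) :
    θ = κ :=
  Trans.ext (funext fun a => funext fun b => h a b)

theorem app_eqToHom {F G : Sesq A B C} (h : F = G) (a : A.ob) (b : B.ob)
    (e : C.Und (F.obj a b) (G.obj a b)) (he : HEq e (C.one (F.obj a b))) :
    Trans.app (eqToHom h) a b = e := by
  subst h
  exact (eq_of_heq he).symm

/-- Every morphism of the underlying categories of `A`, `B` induces a `W`-natural transformation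
`F(x, -)`, `F(-, y)`. -/
structure Central (F : Sesq A B C) : Prop where
  natL {b b' : B.ob} (y : B.Und b b') (a a' : A.ob) :
    F.mapL a a' b ≫ post (y ≫ F.mapR a' b b') (F.obj a b) =
      F.mapL a a' b' ≫ pre (y ≫ F.mapR a b b') (F.obj a' b')
  natR {a a' : A.ob} (x : A.Und a a') (b b' : B.ob) :
    F.mapR a b b' ≫ post (x ≫ F.mapL a a' b') (F.obj a b) =
      F.mapR a' b b' ≫ pre (x ≫ F.mapL a a' b) (F.obj a' b')

/-- The transformation `F(-, y)`. -/
@[reducible] def Central.left {F : Sesq A B C} (hF : F.Central) {b b' : B.ob} (y : B.Und b b') :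
    LNatTrans (F.left b) (F.left b') where
  app a := y ≫ F.mapR a b b'
  naturality := hF.natL y

/-- The transformation `F(x, -)`. -/
@[reducible] def Central.right {F : Sesq A B C} (hF : F.Central) {a a' : A.ob} (x : A.Und a a') :
    LNatTrans (F.right a) (F.right a') where
  app b := x ≫ F.mapL a a' b
  naturality := hF.natR x

variable {A' B' C' A'' B'' C'' : LCat.{u} W}

/-- The composite `R F(P -, Q -)`. -/
@[reducible] def act (P : LFunctor A' A) (Q : LFunctor B' B) (R : LFunctor C C') (F : Sesq A B C) :
    Sesq A' B' C' where
  obj a b := R.obj (F.obj (P.obj a) (Q.obj b))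
  mapL a a' b := (P.map a a' ≫ F.mapL _ _ _) ≫ R.map _ _
  mapR a b b' := (Q.map b b' ≫ F.mapR _ _ _) ≫ R.map _ _
  mapL_one a b := ((P.comp (F.left (Q.obj b))).comp R).map_one a
  mapL_comp a a' a'' b := ((P.comp (F.left (Q.obj b))).comp R).map_comp a a' a''
  mapR_one a b := ((Q.comp (F.right (P.obj a))).comp R).map_one b
  mapR_comp a b b' b'' := ((Q.comp (F.right (P.obj a))).comp R).map_comp b b' b''

/-- The composite `R θ_{P -, Q -}`. -/
@[reducible] def actMap (P : LFunctor A' A) (Q : LFunctor B' B) (R : LFunctor C C')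
    {F G : Sesq A B C} (θ : F ⟶ G) : act P Q R F ⟶ act P Q R G where
  app a b := Trans.app θ (P.obj a) (Q.obj b) ≫ R.map _ _
  natL a a' b := (LNatTrans.whiskerRight (LNatTrans.whiskerLeft P (Trans.left θ (Q.obj b))) R).naturality a a'
  natR a b b' := (LNatTrans.whiskerRight (LNatTrans.whiskerLeft Q (Trans.right θ (P.obj a))) R).naturality b b'

/-- The action of transformations `P ⟶ P'`, `Q ⟶ Q'`, `R ⟶ R'`, with components
`R F(P a, Q b) ⟶ R F(P' a, Q b) ⟶ R F(P' a, Q' b) ⟶ R' F(P' a, Q' b)`. -/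
@[reducible] def act₂ {P P' : LFunctor A' A} {Q Q' : LFunctor B' B} {R R' : LFunctor C C'}
    (ε : P ⟶ P') (ζ : Q ⟶ Q') (χ : R ⟶ R') (F : Sesq A B C) (hF : F.Central) :
    act P Q R F ⟶ act P' Q' R' F where
  app a b := ucomp (ucomp (LNatTrans.app ε a ≫ F.mapL _ _ (Q.obj b))
    (LNatTrans.app ζ b ≫ F.mapR (P'.obj a) _ _) ≫ R.map _ _) (LNatTrans.app χ _)
  natL a a' b := (LNatTrans.comp (LNatTrans.whiskerRight (LNatTrans.comp
      (LNatTrans.whiskerRight ε (F.left (Q.obj b)))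
      (LNatTrans.whiskerLeft P' (hF.left (LNatTrans.app ζ b)))) R)
      (LNatTrans.whiskerLeft (P'.comp (F.left (Q'.obj b))) χ)).naturality a a'
  natR a b b' := (LNatTrans.comp (LNatTrans.whiskerRight (LNatTrans.comp
      (LNatTrans.whiskerLeft Q (hF.right (LNatTrans.app ε a)))
      (LNatTrans.whiskerRight ζ (F.right (P'.obj a)))) R)
      (LNatTrans.whiskerLeft (Q'.comp (F.right (P'.obj a))) χ)).naturality b b'

theorem act_id (F : Sesq A B C) :
    act (LFunctor.id A) (LFunctor.id B) (LFunctor.id C) F = F := by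
  simp only [act, LFunctor.id, Category.id_comp, Category.comp_id]

theorem act_act (P : LFunctor A' A) (Q : LFunctor B' B) (R : LFunctor C C')
    (P' : LFunctor A'' A') (Q' : LFunctor B'' B') (R' : LFunctor C' C'') (F : Sesq A B C) :
    act P' Q' R' (act P Q R F) = act (P'.comp P) (Q'.comp Q) (R.comp R') F := by
  simp only [act, LFunctor.comp, Category.assoc]

theorem app_id (F : Sesq A B C) (a : A.ob) (b : B.ob) :
    Trans.app (𝟙 F) a b = C.one (F.obj a b) := rfl

theorem app_comp {F G H : Sesq A B C} (θ : F ⟶ G) (κ : G ⟶ H) (a : A.ob) (b : B.ob) :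
    Trans.app (θ ≫ κ) a b = ucomp (Trans.app θ a b) (Trans.app κ a b) := rfl

theorem actMap_id (P : LFunctor A' A) (Q : LFunctor B' B) (R : LFunctor C C') (F : Sesq A B C) :
    actMap P Q R (𝟙 F) = 𝟙 (act P Q R F) :=
  hom_ext fun _ _ => R.map_one _

theorem actMap_comp (P : LFunctor A' A) (Q : LFunctor B' B) (R : LFunctor C C')
    {F G H : Sesq A B C} (θ : F ⟶ G) (κ : G ⟶ H) :
    actMap P Q R (θ ≫ κ) = actMap P Q R θ ≫ actMap P Q R κ :=
  hom_ext fun _ _ => ucomp_map R _ _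

/-- The interchange of `F(x, -)` and `F(-, y)`. -/
theorem Central.exchange {F : Sesq A B C} (hF : F.Central) {a a' : A.ob} {b b' : B.ob}
    (x : A.Und a a') (y : B.Und b b') :
    ucomp (x ≫ F.mapL a a' b) (y ≫ F.mapR a' b b') =
      ucomp (y ≫ F.mapR a b b') (x ≫ F.mapL a a' b') :=
  ucomp_naturality (hF.left y) x

theorem act₂_natural {P P' : LFunctor A' A} {Q Q' : LFunctor B' B} {R R' : LFunctor C C'}
    (ε : P ⟶ P') (ζ : Q ⟶ Q') (χ : R ⟶ R') {F G : Sesq A B C} (hF : F.Central)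
    (hG : G.Central) (θ : F ⟶ G) :
    actMap P Q R θ ≫ act₂ ε ζ χ G hG = act₂ ε ζ χ F hF ≫ actMap P' Q' R' θ :=
  hom_ext fun a b => by
    have h₁ := ucomp_naturality (Trans.left θ (Q.obj b)) (LNatTrans.app ε a)
    have h₂ := ucomp_naturality (Trans.right θ (P'.obj a)) (LNatTrans.app ζ b)
    have h₃ := ucomp_naturality χ (Trans.app θ (P'.obj a) (Q'.obj b))
    change ucomp (Trans.app θ _ _ ≫ R.map _ _) (ucomp (ucomp (LNatTrans.app ε a ≫ G.mapL _ _ _)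
      (LNatTrans.app ζ b ≫ G.mapR _ _ _) ≫ R.map _ _) (LNatTrans.app χ _)) =
      ucomp (ucomp (ucomp (LNatTrans.app ε a ≫ F.mapL _ _ _)
      (LNatTrans.app ζ b ≫ F.mapR _ _ _) ≫ R.map _ _) (LNatTrans.app χ _))
        (Trans.app θ _ _ ≫ R'.map _ _)
    rw [ucomp_assoc, ← h₃, ← ucomp_assoc, ← ucomp_assoc, ← ucomp_map, ← ucomp_map, ← ucomp_assoc,
      ← h₁, ucomp_assoc, ucomp_assoc, ← h₂]

theorem act₂_id (P : LFunctor A' A) (Q : LFunctor B' B) (R : LFunctor C C') (F : Sesq A B C)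
    (hF : F.Central) : act₂ (𝟙 P) (𝟙 Q) (𝟙 R) F hF = 𝟙 (act P Q R F) :=
  hom_ext fun a b => by
    change ucomp (ucomp (A.one _ ≫ F.mapL _ _ _) (B.one _ ≫ F.mapR _ _ _) ≫ R.map _ _) (C'.one _) =
      C'.one _
    rw [F.mapL_one, F.mapR_one, one_ucomp, R.map_one, one_ucomp]

theorem act₂_comp {P P' P'' : LFunctor A' A} {Q Q' Q'' : LFunctor B' B}
    {R R' R'' : LFunctor C C'} (ε : P ⟶ P') (ζ : Q ⟶ Q') (χ : R ⟶ R') (ε' : P' ⟶ P'')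
    (ζ' : Q' ⟶ Q'') (χ' : R' ⟶ R'') (F : Sesq A B C) (hF : F.Central) :
    act₂ (ε ≫ ε') (ζ ≫ ζ') (χ ≫ χ') F hF = act₂ ε ζ χ F hF ≫ act₂ ε' ζ' χ' F hF :=
  hom_ext fun a b => by
    have h₁ := hF.exchange (LNatTrans.app ε' a) (LNatTrans.app ζ b)
    have h₂ := ucomp_naturality χ (ucomp (LNatTrans.app ε' a ≫ F.mapL _ _ _)
      (LNatTrans.app ζ' b ≫ F.mapR _ _ _))
    have h₃ := ucomp_map (F.left (Q.obj b)) (LNatTrans.app ε a) (LNatTrans.app ε' a)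
    have h₄ := ucomp_map (F.right (P''.obj a)) (LNatTrans.app ζ b) (LNatTrans.app ζ' b)
    change ucomp (ucomp (ucomp (LNatTrans.app ε a) (LNatTrans.app ε' a) ≫ F.mapL _ _ _)
      (ucomp (LNatTrans.app ζ b) (LNatTrans.app ζ' b) ≫ F.mapR _ _ _) ≫ R.map _ _)
        (ucomp (LNatTrans.app χ _) (LNatTrans.app χ' _)) =
      ucomp (ucomp (ucomp (LNatTrans.app ε a ≫ F.mapL _ _ _)
        (LNatTrans.app ζ b ≫ F.mapR _ _ _) ≫ R.map _ _) (LNatTrans.app χ _))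
      (ucomp (ucomp (LNatTrans.app ε' a ≫ F.mapL _ _ _)
        (LNatTrans.app ζ' b ≫ F.mapR _ _ _) ≫ R'.map _ _) (LNatTrans.app χ' _))
    have h₅ : ucomp (ucomp (LNatTrans.app ε a) (LNatTrans.app ε' a) ≫ F.mapL _ _ (Q.obj b))
        (ucomp (LNatTrans.app ζ b) (LNatTrans.app ζ' b) ≫ F.mapR (P''.obj a) _ _) =
        ucomp (ucomp (LNatTrans.app ε a ≫ F.mapL _ _ _) (LNatTrans.app ζ b ≫ F.mapR _ _ _))
          (ucomp (LNatTrans.app ε' a ≫ F.mapL _ _ _) (LNatTrans.app ζ' b ≫ F.mapR _ _ _)) := by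
      refine (congrArg₂ ucomp h₃ h₄).trans ?_
      rw [ucomp_assoc, ← ucomp_assoc (LNatTrans.app ε' a ≫ _), h₁]
      rw [ucomp_assoc (LNatTrans.app ζ b ≫ _), ← ucomp_assoc]
    rw [h₅, ucomp_map, ucomp_assoc, ucomp_assoc,
      ← ucomp_assoc _ (LNatTrans.app χ _) (LNatTrans.app χ' _), h₂, ucomp_assoc]

theorem eqToHom_comp_comp_eqToHom {F G F' G' : Sesq A B C} (h : F' = F) (h' : G = G') (θ : F ⟶ G)
    (κ : F' ⟶ G') (hθ : ∀ a b, HEq (Trans.app θ a b) (Trans.app κ a b)) :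
    eqToHom h ≫ θ ≫ eqToHom h' = κ := by
  subst h h'
  rw [eqToHom_refl, eqToHom_refl, Category.id_comp, Category.comp_id]
  exact hom_ext fun a b => eq_of_heq (hθ a b)

theorem act₂_whisker_outer {P₁ P₂ : LFunctor A' A} {Q₁ Q₂ : LFunctor B' B} {R₁ R₂ : LFunctor C C'}
    (ε : P₁ ⟶ P₂) (ζ : Q₁ ⟶ Q₂) (χ : R₁ ⟶ R₂) (P' : LFunctor A'' A') (Q' : LFunctor B'' B')
    (R' : LFunctor C' C'') (F : Sesq A B C) (hF : F.Central) :
    act₂ (LNatTrans.whiskerLeft P' ε) (LNatTrans.whiskerLeft Q' ζ) (LNatTrans.whiskerRight χ R')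
        F hF =
      eqToHom (act_act P₁ Q₁ R₁ P' Q' R' F).symm ≫ actMap P' Q' R' (act₂ ε ζ χ F hF) ≫
        eqToHom (act_act P₂ Q₂ R₂ P' Q' R' F) := by
  refine (eqToHom_comp_comp_eqToHom (A := A'') (B := B'') (C := C'')
    (act_act P₁ Q₁ R₁ P' Q' R' F).symm (act_act P₂ Q₂ R₂ P' Q' R' F) (actMap P' Q' R' (act₂ ε ζ χ F hF))
    (act₂ (LNatTrans.whiskerLeft P' ε) (LNatTrans.whiskerLeft Q' ζ) (LNatTrans.whiskerRight χ R') F hF) fun a b => heq_of_eq ?_).symm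
  change ucomp (_ ≫ _) _ ≫ R'.map _ _ = ucomp (_ ≫ _ ≫ R'.map _ _) (_ ≫ R'.map _ _)
  rw [ucomp_map, Category.assoc]
  rfl

theorem act₂_whisker_inner {P₁ P₂ : LFunctor A'' A'} {Q₁ Q₂ : LFunctor B'' B'}
    {R₁ R₂ : LFunctor C' C''} (ε : P₁ ⟶ P₂) (ζ : Q₁ ⟶ Q₂) (χ : R₁ ⟶ R₂) (P : LFunctor A' A)
    (Q : LFunctor B' B) (R : LFunctor C C') (F : Sesq A B C) (hF : F.Central)
    (hF' : (act P Q R F).Central) :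
    act₂ (LNatTrans.whiskerRight ε P) (LNatTrans.whiskerRight ζ Q) (LNatTrans.whiskerLeft R χ)
        F hF =
      eqToHom (act_act P Q R P₁ Q₁ R₁ F).symm ≫ act₂ ε ζ χ (act P Q R F) hF' ≫
        eqToHom (act_act P Q R P₂ Q₂ R₂ F) := by
  refine (eqToHom_comp_comp_eqToHom (A := A'') (B := B'') (C := C'')
    (act_act P Q R P₁ Q₁ R₁ F).symm (act_act P Q R P₂ Q₂ R₂ F) (act₂ ε ζ χ (act P Q R F) hF')
    (act₂ (LNatTrans.whiskerRight ε P) (LNatTrans.whiskerRight ζ Q) (LNatTrans.whiskerLeft R χ) F hF) fun a b => heq_of_eq ?_).symm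
  change ucomp (ucomp (LNatTrans.app ε a ≫ (P.map _ _ ≫ F.mapL _ _ _) ≫ R.map _ _)
    (LNatTrans.app ζ b ≫ (Q.map _ _ ≫ F.mapR _ _ _) ≫ R.map _ _) ≫ R₁.map _ _) _ =
    ucomp (ucomp ((LNatTrans.app ε a ≫ P.map _ _) ≫ F.mapL _ _ _)
      ((LNatTrans.app ζ b ≫ Q.map _ _) ≫ F.mapR _ _ _) ≫ R.map _ _ ≫ R₁.map _ _) _
  simp only [← Category.assoc]
  rw [ucomp_map R]
  rfl

end Sesq

/-- A lax monoidal functor `Φ` is normal if it induces bijections `W(I, S) ≅ W'(I, Φ S)`, so that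
change of base along `Φ` preserves underlying categories. -/
class NormalLax {W : Type v₁} [Category.{u} W] [MonoidalCategory W] {W' : Type v₂} [Category.{u} W']
    [MonoidalCategory W'] (Φ : W ⥤ W') [Φ.LaxMonoidal] : Prop where
  bij (S : W) : Function.Bijective fun x : 𝟙_ W ⟶ S => Functor.LaxMonoidal.ε Φ ≫ Φ.map x

namespace LCat

variable {W : Type v₁} [Category.{u} W] [MonoidalCategory W] {W' : Type v₂} [Category.{u} W']
  [MonoidalCategory W'] (Φ : W ⥤ W') [Φ.LaxMonoidal]

theorem hom0_one (C : LCat.{u} W) (a : C.ob) : hom0 Φ (C.one a) = (baseObj Φ C).one a := rfl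

theorem hom0_ucomp {C : LCat.{u} W} {a b c : C.ob} (x : C.Und a b) (y : C.Und b c) :
    hom0 Φ (ucomp x y) = ucomp (C := baseObj Φ C) (hom0 Φ x) (hom0 Φ y) := by
  rw [ucomp, ucomp, post_hom0, hom0, hom0, Φ.map_comp, Category.assoc]

theorem hom0_map {C D : LCat.{u} W} (F : LFunctor C D) {a b : C.ob} (x : C.Und a b) :
    hom0 Φ (x ≫ F.map a b) = hom0 Φ x ≫ Φ.map (F.map a b) := by
  rw [hom0, hom0, Φ.map_comp, Category.assoc]

variable [NormalLax Φ]

/-- The inverse of the isomorphism of underlying categories `C₀ ≅ (Φ_* C)₀`. -/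
noncomputable def und0 {C : LCat.{u} W} {a b : C.ob} (z : (baseObj Φ C).Und a b) : C.Und a b :=
  (NormalLax.bij (Φ := Φ) (C.hom a b)).2 z |>.choose

theorem hom0_und0 {C : LCat.{u} W} {a b : C.ob} (z : (baseObj Φ C).Und a b) :
    hom0 Φ (und0 Φ z) = z :=
  ((NormalLax.bij (Φ := Φ) (C.hom a b)).2 z).choose_spec

theorem hom0_inj {C : LCat.{u} W} {a b : C.ob} {x y : C.Und a b} (h : hom0 Φ x = hom0 Φ y) :
    x = y :=
  (NormalLax.bij (Φ := Φ) (C.hom a b)).1 h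

theorem und0_one (C : LCat.{u} W) (a : C.ob) : und0 Φ ((baseObj Φ C).one a) = C.one a :=
  hom0_inj Φ ((hom0_und0 Φ _).trans (hom0_one Φ C a).symm)

theorem und0_ucomp {C : LCat.{u} W} {a b c : C.ob} (x : (baseObj Φ C).Und a b)
    (y : (baseObj Φ C).Und b c) : und0 Φ (ucomp x y) = ucomp (und0 Φ x) (und0 Φ y) :=
  hom0_inj Φ (by rw [hom0_ucomp, hom0_und0, hom0_und0, hom0_und0])

theorem und0_map {C D : LCat.{u} W} (F : LFunctor C D) {a b : C.ob} (x : (baseObj Φ C).Und a b) :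
    und0 Φ (C := D) (a := F.obj a) (b := F.obj b) (x ≫ Φ.map (F.map a b)) =
      und0 Φ x ≫ F.map a b :=
  hom0_inj Φ (by rw [hom0_map, hom0_und0, hom0_und0])

end LCat

/-- Let `L : W₀ ⥤ W₁`, `R : W₀ ⥤ W₂` be lax monoidal. For a `W₁`-category `A`, a `W₂`-category `B`
and a `W₀`-category `C`, a pair of families of functors `F(-, b) : A ⟶ L_* C` and
`F(a, -) : B ⟶ R_* C` which agree on objects. -/
@[ext] structure BiSesq {W₀ : Type v} {W₁ : Type v₁} {W₂ : Type v₂} [Category.{u} W₀] [MonoidalCategory W₀]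
    [Category.{u} W₁] [MonoidalCategory W₁] [Category.{u} W₂] [MonoidalCategory W₂] (L : W₀ ⥤ W₁)
    [L.LaxMonoidal] (R : W₀ ⥤ W₂) [R.LaxMonoidal] (A : LCat.{u} W₁) (B : LCat.{u} W₂)
    (C : LCat.{u} W₀) where
  obj : A.ob → B.ob → C.ob
  mapL (a a' : A.ob) (b : B.ob) : A.hom a a' ⟶ L.obj (C.hom (obj a b) (obj a' b))
  mapR (a : A.ob) (b b' : B.ob) : B.hom b b' ⟶ R.obj (C.hom (obj a b) (obj a b'))
  mapL_one (a : A.ob) (b : B.ob) : A.one a ≫ mapL a a b = (LCat.baseObj L C).one (obj a b)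
  mapL_comp (a a' a'' : A.ob) (b : B.ob) : A.comp a a' a'' ≫ mapL a a'' b =
    (mapL a' a'' b ⊗ₘ mapL a a' b) ≫ (LCat.baseObj L C).comp (obj a b) (obj a' b) (obj a'' b)
  mapR_one (a : A.ob) (b : B.ob) : B.one b ≫ mapR a b b = (LCat.baseObj R C).one (obj a b)
  mapR_comp (a : A.ob) (b b' b'' : B.ob) : B.comp b b' b'' ≫ mapR a b b'' =
    (mapR a b' b'' ⊗ₘ mapR a b b') ≫ (LCat.baseObj R C).comp (obj a b) (obj a b') (obj a b'')

namespace BiSesq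

open LCat

variable {W₀ : Type v} {W₁ : Type v₁} {W₂ : Type v₂} [Category.{u} W₀] [MonoidalCategory W₀]
  [Category.{u} W₁] [MonoidalCategory W₁] [Category.{u} W₂] [MonoidalCategory W₂] {L : W₀ ⥤ W₁}
  [L.LaxMonoidal] {R : W₀ ⥤ W₂} [R.LaxMonoidal] {A : LCat.{u} W₁} {B : LCat.{u} W₂}
  {C : LCat.{u} W₀}

/-- The functor `F(-, b)`. -/
@[reducible] def left (F : BiSesq L R A B C) (b : B.ob) : LFunctor A (baseObj L C) where
  obj a := F.obj a b
  map a a' := F.mapL a a' b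
  map_one a := F.mapL_one a b
  map_comp a a' a'' := F.mapL_comp a a' a'' b

/-- The functor `F(a, -)`. -/
@[reducible] def right (F : BiSesq L R A B C) (a : A.ob) : LFunctor B (baseObj R C) where
  obj b := F.obj a b
  map b b' := F.mapR a b b'
  map_one b := F.mapR_one a b
  map_comp b b' b'' := F.mapR_comp a b b' b''

/-- A family of morphisms of the underlying category of `C` which is natural in each variable. -/
@[ext] structure Trans (F G : BiSesq L R A B C) where
  app (a : A.ob) (b : B.ob) : C.Und (F.obj a b) (G.obj a b)
  natL (a a' : A.ob) (b : B.ob) :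
    F.mapL a a' b ≫ post (C := baseObj L C) (hom0 L (app a' b)) (F.obj a b) =
      G.mapL a a' b ≫ pre (C := baseObj L C) (hom0 L (app a b)) (G.obj a' b)
  natR (a : A.ob) (b b' : B.ob) :
    F.mapR a b b' ≫ post (C := baseObj R C) (hom0 R (app a b')) (F.obj a b) =
      G.mapR a b b' ≫ pre (C := baseObj R C) (hom0 R (app a b)) (G.obj a b')

/-- The component of a transformation in the first variable. -/
@[reducible] def Trans.left {F G : BiSesq L R A B C} (θ : Trans F G) (b : B.ob) :
    LNatTrans (F.left b) (G.left b) where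
  app a := hom0 L (θ.app a b)
  naturality a a' := θ.natL a a' b

/-- The component of a transformation in the second variable. -/
@[reducible] def Trans.right {F G : BiSesq L R A B C} (θ : Trans F G) (a : A.ob) :
    LNatTrans (F.right a) (G.right a) where
  app b := hom0 R (θ.app a b)
  naturality b b' := θ.natR a b b'

instance : Category (BiSesq L R A B C) where
  Hom F G := Trans F G
  id F :=
    { app := fun a b => C.one (F.obj a b)
      natL := fun a a' b => (LNatTrans.id (F.left b)).naturality a a'
      natR := fun a b b' => (LNatTrans.id (F.right a)).naturality b b' }
  comp θ κ :=
    { app := fun a b => ucomp (θ.app a b) (κ.app a b)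
      natL := fun a a' b => by
        rw [hom0_ucomp, hom0_ucomp]
        exact (LNatTrans.comp (θ.left b) (κ.left b)).naturality a a'
      natR := fun a b b' => by
        rw [hom0_ucomp, hom0_ucomp]
        exact (LNatTrans.comp (θ.right a) (κ.right a)).naturality b b' }
  id_comp θ := Trans.ext (funext fun a => funext fun b => one_ucomp _)
  comp_id θ := Trans.ext (funext fun a => funext fun b => ucomp_one _)
  assoc θ κ σ := Trans.ext (funext fun a => funext fun b => ucomp_assoc _ _ _)

theorem hom_ext {F G : BiSesq L R A B C} {θ κ : F ⟶ G}
    (h : ∀ a b, Trans.app θ a b = Trans.app κ a b) : θ = κ :=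
  Trans.ext (funext fun a => funext fun b => h a b)

theorem eqToHom_comp_comp_eqToHom {F G F' G' : BiSesq L R A B C} (h : F' = F) (h' : G = G')
    (θ : F ⟶ G) (κ : F' ⟶ G') (hθ : ∀ a b, HEq (Trans.app θ a b) (Trans.app κ a b)) :
    eqToHom h ≫ θ ≫ eqToHom h' = κ := by
  subst h h'
  rw [eqToHom_refl, eqToHom_refl, Category.id_comp, Category.comp_id]
  exact hom_ext fun a b => eq_of_heq (hθ a b)

section

variable [NormalLax L] [NormalLax R]

/-- The morphism `F(x, b)` of the underlying category of `C`. -/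
noncomputable def onL (F : BiSesq L R A B C) {a a' : A.ob} (x : A.Und a a') (b : B.ob) :
    C.Und (F.obj a b) (F.obj a' b) :=
  und0 L (x ≫ F.mapL a a' b)

/-- The morphism `F(a, y)` of the underlying category of `C`. -/
noncomputable def onR (F : BiSesq L R A B C) (a : A.ob) {b b' : B.ob} (y : B.Und b b') :
    C.Und (F.obj a b) (F.obj a b') :=
  und0 R (y ≫ F.mapR a b b')

theorem hom0_onL (F : BiSesq L R A B C) {a a' : A.ob} (x : A.Und a a') (b : B.ob) :
    hom0 L (F.onL x b) = x ≫ F.mapL a a' b := hom0_und0 L _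

theorem hom0_onR (F : BiSesq L R A B C) (a : A.ob) {b b' : B.ob} (y : B.Und b b') :
    hom0 R (F.onR a y) = y ≫ F.mapR a b b' := hom0_und0 R _

theorem onL_one (F : BiSesq L R A B C) (a : A.ob) (b : B.ob) :
    F.onL (A.one a) b = C.one (F.obj a b) := by
  rw [onL, F.mapL_one, und0_one]

theorem onR_one (F : BiSesq L R A B C) (a : A.ob) (b : B.ob) :
    F.onR a (B.one b) = C.one (F.obj a b) := by
  rw [onR, F.mapR_one, und0_one]

theorem onL_ucomp (F : BiSesq L R A B C) {a a' a'' : A.ob} (x : A.Und a a') (x' : A.Und a' a'')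
    (b : B.ob) : F.onL (ucomp x x') b = ucomp (F.onL x b) (F.onL x' b) :=
  (congrArg (und0 L) (ucomp_map (F.left b) x x')).trans (und0_ucomp L _ _)

theorem onR_ucomp (F : BiSesq L R A B C) (a : A.ob) {b b' b'' : B.ob} (y : B.Und b b')
    (y' : B.Und b' b'') : F.onR a (ucomp y y') = ucomp (F.onR a y) (F.onR a y') :=
  (congrArg (und0 R) (ucomp_map (F.right a) y y')).trans (und0_ucomp R _ _)

theorem onL_natural {F G : BiSesq L R A B C} (θ : F ⟶ G) {a a' : A.ob} (x : A.Und a a')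
    (b : B.ob) : ucomp (F.onL x b) (Trans.app θ a' b) = ucomp (Trans.app θ a b) (G.onL x b) :=
  hom0_inj L (by
    rw [hom0_ucomp, hom0_ucomp, hom0_onL, hom0_onL]
    exact ucomp_naturality (Trans.left θ b) x)

theorem onR_natural {F G : BiSesq L R A B C} (θ : F ⟶ G) (a : A.ob) {b b' : B.ob}
    (y : B.Und b b') : ucomp (F.onR a y) (Trans.app θ a b') = ucomp (Trans.app θ a b) (G.onR a y) :=
  hom0_inj R (by
    rw [hom0_ucomp, hom0_ucomp, hom0_onR, hom0_onR]
    exact ucomp_naturality (Trans.right θ a) y)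

/-- Every morphism of the underlying categories of `A`, `B` induces a
natural transformation `F(x, -)`, `F(-, y)`. -/
structure Central (F : BiSesq L R A B C) : Prop where
  natL {b b' : B.ob} (y : B.Und b b') (a a' : A.ob) :
    F.mapL a a' b ≫ post (C := baseObj L C) (hom0 L (F.onR a' y)) (F.obj a b) =
      F.mapL a a' b' ≫ pre (C := baseObj L C) (hom0 L (F.onR a y)) (F.obj a' b')
  natR {a a' : A.ob} (x : A.Und a a') (b b' : B.ob) :
    F.mapR a b b' ≫ post (C := baseObj R C) (hom0 R (F.onL x b')) (F.obj a b) =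
      F.mapR a' b b' ≫ pre (C := baseObj R C) (hom0 R (F.onL x b)) (F.obj a' b')

/-- The transformation `F(-, y)`. -/
@[reducible] noncomputable def Central.left {F : BiSesq L R A B C} (hF : F.Central) {b b' : B.ob}
    (y : B.Und b b') : LNatTrans (F.left b) (F.left b') where
  app a := hom0 L (F.onR a y)
  naturality := hF.natL y

/-- The transformation `F(x, -)`. -/
@[reducible] noncomputable def Central.right {F : BiSesq L R A B C} (hF : F.Central) {a a' : A.ob}
    (x : A.Und a a') : LNatTrans (F.right a) (F.right a') where
  app b := hom0 R (F.onL x b)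
  naturality := hF.natR x

/-- The interchange of `F(x, -)` and `F(-, y)`. -/
theorem Central.exchange {F : BiSesq L R A B C} (hF : F.Central) {a a' : A.ob} {b b' : B.ob}
    (x : A.Und a a') (y : B.Und b b') :
    ucomp (F.onL x b) (F.onR a' y) = ucomp (F.onR a y) (F.onL x b') :=
  hom0_inj L (by
    rw [hom0_ucomp, hom0_ucomp, hom0_onL, hom0_onL]
    exact ucomp_naturality (hF.left y) x)

end

variable {A' A'' : LCat.{u} W₁} {B' B'' : LCat.{u} W₂} {C' C'' : LCat.{u} W₀}

/-- The composite `S F(P -, Q -)`. -/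
@[reducible] def act (P : LFunctor A' A) (Q : LFunctor B' B) (S : LFunctor C C')
    (F : BiSesq L R A B C) : BiSesq L R A' B' C' where
  obj a b := S.obj (F.obj (P.obj a) (Q.obj b))
  mapL a a' b := (P.map a a' ≫ F.mapL _ _ _) ≫ L.map (S.map _ _)
  mapR a b b' := (Q.map b b' ≫ F.mapR _ _ _) ≫ R.map (S.map _ _)
  mapL_one a b := ((P.comp (F.left (Q.obj b))).comp (baseMap L S)).map_one a
  mapL_comp a a' a'' b := ((P.comp (F.left (Q.obj b))).comp (baseMap L S)).map_comp a a' a''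
  mapR_one a b := ((Q.comp (F.right (P.obj a))).comp (baseMap R S)).map_one b
  mapR_comp a b b' b'' := ((Q.comp (F.right (P.obj a))).comp (baseMap R S)).map_comp b b' b''

/-- The composite `S θ_{P -, Q -}`. -/
@[reducible] def actMap (P : LFunctor A' A) (Q : LFunctor B' B) (S : LFunctor C C')
    {F G : BiSesq L R A B C} (θ : F ⟶ G) : act P Q S F ⟶ act P Q S G where
  app a b := Trans.app θ (P.obj a) (Q.obj b) ≫ S.map _ _
  natL a a' b := by
    rw [hom0_map, hom0_map]
    exact (LNatTrans.whiskerRight (LNatTrans.whiskerLeft P (Trans.left θ (Q.obj b)))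
      (baseMap L S)).naturality a a'
  natR a b b' := by
    rw [hom0_map, hom0_map]
    exact (LNatTrans.whiskerRight (LNatTrans.whiskerLeft Q (Trans.right θ (P.obj a)))
      (baseMap R S)).naturality b b'

theorem act_id (F : BiSesq L R A B C) :
    act (LFunctor.id A) (LFunctor.id B) (LFunctor.id C) F = F := by
  simp only [act, LFunctor.id, Category.id_comp, CategoryTheory.Functor.map_id, Category.comp_id]

theorem act_act (P : LFunctor A' A) (Q : LFunctor B' B) (S : LFunctor C C')
    (P' : LFunctor A'' A') (Q' : LFunctor B'' B') (S' : LFunctor C' C'') (F : BiSesq L R A B C) :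
    act P' Q' S' (act P Q S F) = act (P'.comp P) (Q'.comp Q) (S.comp S') F := by
  simp only [act, LFunctor.comp, Category.assoc, Functor.map_comp]

theorem actMap_id (P : LFunctor A' A) (Q : LFunctor B' B) (S : LFunctor C C')
    (F : BiSesq L R A B C) : actMap P Q S (𝟙 F) = 𝟙 (act P Q S F) :=
  hom_ext fun _ _ => S.map_one _

theorem actMap_comp (P : LFunctor A' A) (Q : LFunctor B' B) (S : LFunctor C C')
    {F G H : BiSesq L R A B C} (θ : F ⟶ G) (κ : G ⟶ H) :
    actMap P Q S (θ ≫ κ) = actMap P Q S θ ≫ actMap P Q S κ :=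
  hom_ext fun _ _ => ucomp_map S _ _

variable [NormalLax L] [NormalLax R]

theorem act_onL (P : LFunctor A' A) (Q : LFunctor B' B) (S : LFunctor C C')
    (F : BiSesq L R A B C) {a a' : A'.ob} (x : A'.Und a a') (b : B'.ob) :
    (act P Q S F).onL x b = F.onL (x ≫ P.map a a') (Q.obj b) ≫ S.map _ _ := by
  rw [onL, onL, ← und0_map]
  simp only [Category.assoc]

theorem act_onR (P : LFunctor A' A) (Q : LFunctor B' B) (S : LFunctor C C')
    (F : BiSesq L R A B C) (a : A'.ob) {b b' : B'.ob} (y : B'.Und b b') :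
    (act P Q S F).onR a y = F.onR (P.obj a) (y ≫ Q.map b b') ≫ S.map _ _ := by
  rw [onR, onR, ← und0_map]
  simp only [Category.assoc]

/-- The action of transformations `P ⟶ P'`, `Q ⟶ Q'`, `S ⟶ S'`, with components
`S F(P a, Q b) ⟶ S F(P' a, Q b) ⟶ S F(P' a, Q' b) ⟶ S' F(P' a, Q' b)`. -/
@[reducible] noncomputable def act₂ {P P' : LFunctor A' A} {Q Q' : LFunctor B' B}
    {S S' : LFunctor C C'} (ε : P ⟶ P') (ζ : Q ⟶ Q') (χ : S ⟶ S') (F : BiSesq L R A B C)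
    (hF : F.Central) : act P Q S F ⟶ act P' Q' S' F where
  app a b := ucomp (ucomp (F.onL (LNatTrans.app ε a) (Q.obj b))
    (F.onR (P'.obj a) (LNatTrans.app ζ b)) ≫ S.map _ _) (LNatTrans.app χ _)
  natL a a' b := by
    rw [hom0_ucomp, hom0_ucomp, hom0_map, hom0_map, hom0_ucomp, hom0_ucomp, hom0_onL, hom0_onL]
    exact (LNatTrans.comp (LNatTrans.whiskerRight (LNatTrans.comp
      (LNatTrans.whiskerRight ε (F.left (Q.obj b)))
      (LNatTrans.whiskerLeft P' (hF.left (LNatTrans.app ζ b)))) (baseMap L S))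
      (LNatTrans.whiskerLeft (P'.comp (F.left (Q'.obj b))) (baseMap₂ L χ))).naturality a a'
  natR a b b' := by
    rw [hom0_ucomp, hom0_ucomp, hom0_map, hom0_map, hom0_ucomp, hom0_ucomp, hom0_onR, hom0_onR]
    exact (LNatTrans.comp (LNatTrans.whiskerRight (LNatTrans.comp
      (LNatTrans.whiskerLeft Q (hF.right (LNatTrans.app ε a)))
      (LNatTrans.whiskerRight ζ (F.right (P'.obj a)))) (baseMap R S))
      (LNatTrans.whiskerLeft (Q'.comp (F.right (P'.obj a))) (baseMap₂ R χ))).naturality b b'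

theorem act₂_natural {P P' : LFunctor A' A} {Q Q' : LFunctor B' B} {S S' : LFunctor C C'}
    (ε : P ⟶ P') (ζ : Q ⟶ Q') (χ : S ⟶ S') {F G : BiSesq L R A B C} (hF : F.Central)
    (hG : G.Central) (θ : F ⟶ G) :
    actMap P Q S θ ≫ act₂ ε ζ χ G hG = act₂ ε ζ χ F hF ≫ actMap P' Q' S' θ :=
  hom_ext fun a b => by
    have h₁ := onL_natural θ (LNatTrans.app ε a) (Q.obj b)
    have h₂ := onR_natural θ (P'.obj a) (LNatTrans.app ζ b)
    have h₃ := ucomp_naturality χ (Trans.app θ (P'.obj a) (Q'.obj b))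
    change ucomp (Trans.app θ _ _ ≫ S.map _ _) (ucomp (ucomp (G.onL (LNatTrans.app ε a) _)
      (G.onR _ (LNatTrans.app ζ b)) ≫ S.map _ _) (LNatTrans.app χ _)) =
      ucomp (ucomp (ucomp (F.onL (LNatTrans.app ε a) _)
      (F.onR _ (LNatTrans.app ζ b)) ≫ S.map _ _) (LNatTrans.app χ _))
        (Trans.app θ _ _ ≫ S'.map _ _)
    rw [ucomp_assoc, ← h₃, ← ucomp_assoc, ← ucomp_assoc, ← ucomp_map, ← ucomp_map, ← ucomp_assoc,
      ← h₁, ucomp_assoc, ucomp_assoc, ← h₂]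

theorem act₂_id (P : LFunctor A' A) (Q : LFunctor B' B) (S : LFunctor C C')
    (F : BiSesq L R A B C) (hF : F.Central) :
    act₂ (𝟙 P) (𝟙 Q) (𝟙 S) F hF = 𝟙 (act P Q S F) :=
  hom_ext fun a b => by
    change ucomp (ucomp (F.onL (A.one _) _) (F.onR _ (B.one _)) ≫ S.map _ _) (C'.one _) =
      C'.one _
    rw [F.onL_one, F.onR_one, one_ucomp, S.map_one, one_ucomp]

theorem act₂_comp {P P' P'' : LFunctor A' A} {Q Q' Q'' : LFunctor B' B}
    {S S' S'' : LFunctor C C'} (ε : P ⟶ P') (ζ : Q ⟶ Q') (χ : S ⟶ S') (ε' : P' ⟶ P'')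
    (ζ' : Q' ⟶ Q'') (χ' : S' ⟶ S'') (F : BiSesq L R A B C) (hF : F.Central) :
    act₂ (ε ≫ ε') (ζ ≫ ζ') (χ ≫ χ') F hF = act₂ ε ζ χ F hF ≫ act₂ ε' ζ' χ' F hF :=
  hom_ext fun a b => by
    have h₁ := hF.exchange (LNatTrans.app ε' a) (LNatTrans.app ζ b)
    have h₂ := ucomp_naturality χ (ucomp (F.onL (LNatTrans.app ε' a) (Q'.obj b))
      (F.onR (P''.obj a) (LNatTrans.app ζ' b)))
    change ucomp (ucomp (F.onL (ucomp (LNatTrans.app ε a) (LNatTrans.app ε' a)) _)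
      (F.onR _ (ucomp (LNatTrans.app ζ b) (LNatTrans.app ζ' b))) ≫ S.map _ _)
        (ucomp (LNatTrans.app χ _) (LNatTrans.app χ' _)) =
      ucomp (ucomp (ucomp (F.onL (LNatTrans.app ε a) _)
        (F.onR _ (LNatTrans.app ζ b)) ≫ S.map _ _) (LNatTrans.app χ _))
      (ucomp (ucomp (F.onL (LNatTrans.app ε' a) _)
        (F.onR _ (LNatTrans.app ζ' b)) ≫ S'.map _ _) (LNatTrans.app χ' _))
    have h₅ : ucomp (F.onL (ucomp (LNatTrans.app ε a) (LNatTrans.app ε' a)) (Q.obj b))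
        (F.onR (P''.obj a) (ucomp (LNatTrans.app ζ b) (LNatTrans.app ζ' b))) =
        ucomp (ucomp (F.onL (LNatTrans.app ε a) _) (F.onR _ (LNatTrans.app ζ b)))
          (ucomp (F.onL (LNatTrans.app ε' a) _) (F.onR _ (LNatTrans.app ζ' b))) := by
      rw [onL_ucomp, onR_ucomp, ucomp_assoc, ← ucomp_assoc (F.onL (LNatTrans.app ε' a) _), h₁]
      rw [ucomp_assoc (F.onR _ (LNatTrans.app ζ b)), ← ucomp_assoc]
    rw [h₅, ucomp_map, ucomp_assoc, ucomp_assoc,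
      ← ucomp_assoc _ (LNatTrans.app χ _) (LNatTrans.app χ' _), h₂, ucomp_assoc]

theorem act₂_whisker_outer {P₁ P₂ : LFunctor A' A} {Q₁ Q₂ : LFunctor B' B} {S₁ S₂ : LFunctor C C'}
    (ε : P₁ ⟶ P₂) (ζ : Q₁ ⟶ Q₂) (χ : S₁ ⟶ S₂) (P' : LFunctor A'' A') (Q' : LFunctor B'' B')
    (S' : LFunctor C' C'') (F : BiSesq L R A B C) (hF : F.Central) :
    act₂ (LNatTrans.whiskerLeft P' ε) (LNatTrans.whiskerLeft Q' ζ) (LNatTrans.whiskerRight χ S')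
        F hF =
      eqToHom (act_act P₁ Q₁ S₁ P' Q' S' F).symm ≫ actMap P' Q' S' (act₂ ε ζ χ F hF) ≫
        eqToHom (act_act P₂ Q₂ S₂ P' Q' S' F) := by
  refine (eqToHom_comp_comp_eqToHom (A := A'') (B := B'') (C := C'')
    (act_act P₁ Q₁ S₁ P' Q' S' F).symm (act_act P₂ Q₂ S₂ P' Q' S' F)
    (actMap P' Q' S' (act₂ ε ζ χ F hF))
    (act₂ (LNatTrans.whiskerLeft P' ε) (LNatTrans.whiskerLeft Q' ζ) (LNatTrans.whiskerRight χ S')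
      F hF) fun a b => heq_of_eq ?_).symm
  change ucomp (_ ≫ _) _ ≫ S'.map _ _ = ucomp (_ ≫ _ ≫ S'.map _ _) (_ ≫ S'.map _ _)
  rw [ucomp_map, Category.assoc]
  rfl

theorem act₂_whisker_inner {P₁ P₂ : LFunctor A'' A'} {Q₁ Q₂ : LFunctor B'' B'}
    {S₁ S₂ : LFunctor C' C''} (ε : P₁ ⟶ P₂) (ζ : Q₁ ⟶ Q₂) (χ : S₁ ⟶ S₂) (P : LFunctor A' A)
    (Q : LFunctor B' B) (S : LFunctor C C') (F : BiSesq L R A B C) (hF : F.Central)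
    (hF' : (act P Q S F).Central) :
    act₂ (LNatTrans.whiskerRight ε P) (LNatTrans.whiskerRight ζ Q) (LNatTrans.whiskerLeft S χ)
        F hF =
      eqToHom (act_act P Q S P₁ Q₁ S₁ F).symm ≫ act₂ ε ζ χ (act P Q S F) hF' ≫
        eqToHom (act_act P Q S P₂ Q₂ S₂ F) := by
  refine (eqToHom_comp_comp_eqToHom (A := A'') (B := B'') (C := C'')
    (act_act P Q S P₁ Q₁ S₁ F).symm (act_act P Q S P₂ Q₂ S₂ F)
    (act₂ ε ζ χ (act P Q S F) hF')
    (act₂ (LNatTrans.whiskerRight ε P) (LNatTrans.whiskerRight ζ Q) (LNatTrans.whiskerLeft S χ)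
      F hF) fun a b => heq_of_eq ?_).symm
  change ucomp (ucomp ((act P Q S F).onL (LNatTrans.app ε a) _)
    ((act P Q S F).onR _ (LNatTrans.app ζ b)) ≫ S₁.map _ _) _ =
    ucomp (ucomp (F.onL (LNatTrans.app ε a ≫ P.map _ _) _)
      (F.onR _ (LNatTrans.app ζ b ≫ Q.map _ _)) ≫ S.map _ _ ≫ S₁.map _ _) _
  rw [act_onL, act_onR, ← ucomp_map S, Category.assoc]
  rfl

end BiSesq

/-- A (strict) 2-functor `B₁ᵒᵖ × B₂ᵒᵖ × B₃ ⟶ CAT`, where `(-)ᵒᵖ` reverses 1-cells only, written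
out in terms of its three variables. -/
@[ext] structure TriFunctor (B₁ : Type u₁) [Bicategory.{w₁, v₁} B₁] [Bicategory.Strict B₁]
    (B₂ : Type u₂) [Bicategory.{w₂, v₂} B₂] [Bicategory.Strict B₂]
    (B₃ : Type u₃) [Bicategory.{w₃, v₃} B₃] [Bicategory.Strict B₃] where
  obj : B₁ → B₂ → B₃ → Cat.{u, u}
  map {A A' : B₁} {B B' : B₂} {C C' : B₃} (P : A' ⟶ A) (Q : B' ⟶ B) (R : C ⟶ C') :
    obj A B C ⥤ obj A' B' C'
  map₂ {A A' : B₁} {B B' : B₂} {C C' : B₃} {P P' : A' ⟶ A} {Q Q' : B' ⟶ B} {R R' : C ⟶ C'}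
    (ε : P ⟶ P') (ζ : Q ⟶ Q') (χ : R ⟶ R') : map P Q R ⟶ map P' Q' R'
  map_id (A : B₁) (B : B₂) (C : B₃) : map (𝟙 A) (𝟙 B) (𝟙 C) = 𝟭 (obj A B C)
  map_comp {A A' A'' : B₁} {B B' B'' : B₂} {C C' C'' : B₃} (P : A' ⟶ A) (Q : B' ⟶ B) (R : C ⟶ C')
    (P' : A'' ⟶ A') (Q' : B'' ⟶ B') (R' : C' ⟶ C'') :
    map (P' ≫ P) (Q' ≫ Q) (R ≫ R') = map P Q R ⋙ map P' Q' R'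
  map₂_id {A A' : B₁} {B B' : B₂} {C C' : B₃} (P : A' ⟶ A) (Q : B' ⟶ B) (R : C ⟶ C') :
    map₂ (𝟙 P) (𝟙 Q) (𝟙 R) = 𝟙 (map P Q R)
  map₂_comp {A A' : B₁} {B B' : B₂} {C C' : B₃} {P P' P'' : A' ⟶ A} {Q Q' Q'' : B' ⟶ B}
    {R R' R'' : C ⟶ C'} (ε : P ⟶ P') (ζ : Q ⟶ Q') (χ : R ⟶ R') (ε' : P' ⟶ P'')
    (ζ' : Q' ⟶ Q'') (χ' : R' ⟶ R'') :
    map₂ (ε ≫ ε') (ζ ≫ ζ') (χ ≫ χ') = map₂ ε ζ χ ≫ map₂ ε' ζ' χ'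
  map₂_outer {A A' A'' : B₁} {B B' B'' : B₂} {C C' C'' : B₃} {P₁ P₂ : A' ⟶ A} {Q₁ Q₂ : B' ⟶ B}
    {R₁ R₂ : C ⟶ C'} (ε : P₁ ⟶ P₂) (ζ : Q₁ ⟶ Q₂) (χ : R₁ ⟶ R₂) (P' : A'' ⟶ A') (Q' : B'' ⟶ B')
    (R' : C' ⟶ C'') : map₂ (Bicategory.whiskerLeft P' ε) (Bicategory.whiskerLeft Q' ζ)
      (Bicategory.whiskerRight χ R') =
      eqToHom (map_comp P₁ Q₁ R₁ P' Q' R') ≫ Functor.whiskerRight (map₂ ε ζ χ) (map P' Q' R') ≫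
        eqToHom (map_comp P₂ Q₂ R₂ P' Q' R').symm
  map₂_inner {A A' A'' : B₁} {B B' B'' : B₂} {C C' C'' : B₃} {P₁ P₂ : A'' ⟶ A'} {Q₁ Q₂ : B'' ⟶ B'}
    {R₁ R₂ : C' ⟶ C''} (ε : P₁ ⟶ P₂) (ζ : Q₁ ⟶ Q₂) (χ : R₁ ⟶ R₂) (P : A' ⟶ A) (Q : B' ⟶ B)
    (R : C ⟶ C') : map₂ (Bicategory.whiskerRight ε P) (Bicategory.whiskerRight ζ Q)
      (Bicategory.whiskerLeft R χ) =
      eqToHom (map_comp P Q R P₁ Q₁ R₁) ≫ Functor.whiskerLeft (map P Q R) (map₂ ε ζ χ) ≫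
        eqToHom (map_comp P Q R P₂ Q₂ R₂).symm

/-- A 2-natural isomorphism `S(F₁ -, F₂ -, F₃ -) ≅ T(G₁ -, G₂ -, G₃ -)`, for 2-functors `Fᵢ`, `Gᵢ`:
isomorphisms of categories which are strictly natural with respect to 1-cells and 2-cells. -/
structure TwoNatIso {B₁ : Type u₁} [Bicategory.{w₁, v₁} B₁] {B₂ : Type u₂} [Bicategory.{w₂, v₂} B₂]
    {B₃ : Type u₃} [Bicategory.{w₃, v₃} B₃]
    {D₁ : Type w₁'} [Bicategory D₁] [Bicategory.Strict D₁]
    {D₂ : Type w₂'} [Bicategory D₂] [Bicategory.Strict D₂]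
    {D₃ : Type w₃'} [Bicategory D₃] [Bicategory.Strict D₃]
    {E₁ : Type v₁'} [Bicategory E₁] [Bicategory.Strict E₁]
    {E₂ : Type v₂'} [Bicategory E₂] [Bicategory.Strict E₂]
    {E₃ : Type v₃'} [Bicategory E₃] [Bicategory.Strict E₃]
    (S : TriFunctor.{u} D₁ D₂ D₃) (F₁ : StrictPseudofunctor B₁ D₁) (F₂ : StrictPseudofunctor B₂ D₂)
    (F₃ : StrictPseudofunctor B₃ D₃) (T : TriFunctor.{u} E₁ E₂ E₃)
    (G₁ : StrictPseudofunctor B₁ E₁) (G₂ : StrictPseudofunctor B₂ E₂)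
    (G₃ : StrictPseudofunctor B₃ E₃) where
  hom (A : B₁) (B : B₂) (C : B₃) :
    S.obj (F₁.obj A) (F₂.obj B) (F₃.obj C) ⥤ T.obj (G₁.obj A) (G₂.obj B) (G₃.obj C)
  inv (A : B₁) (B : B₂) (C : B₃) :
    T.obj (G₁.obj A) (G₂.obj B) (G₃.obj C) ⥤ S.obj (F₁.obj A) (F₂.obj B) (F₃.obj C)
  hom_inv (A : B₁) (B : B₂) (C : B₃) : hom A B C ⋙ inv A B C = 𝟭 _
  inv_hom (A : B₁) (B : B₂) (C : B₃) : inv A B C ⋙ hom A B C = 𝟭 _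
  naturality {A A' : B₁} {B B' : B₂} {C C' : B₃} (P : A' ⟶ A) (Q : B' ⟶ B) (R : C ⟶ C') :
    hom A B C ⋙ T.map (G₁.map P) (G₂.map Q) (G₃.map R) =
      S.map (F₁.map P) (F₂.map Q) (F₃.map R) ⋙ hom A' B' C'
  naturality₂ {A A' : B₁} {B B' : B₂} {C C' : B₃} {P P' : A' ⟶ A} {Q Q' : B' ⟶ B} {R R' : C ⟶ C'}
    (ε : P ⟶ P') (ζ : Q ⟶ Q') (χ : R ⟶ R') :
    Functor.whiskerLeft (hom A B C) (T.map₂ (G₁.map₂ ε) (G₂.map₂ ζ) (G₃.map₂ χ)) =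
      eqToHom (naturality P Q R) ≫
        Functor.whiskerRight (S.map₂ (F₁.map₂ ε) (F₂.map₂ ζ) (F₃.map₂ χ)) (hom A' B' C') ≫
          eqToHom (naturality P' Q' R').symm

theorem fullSubcategory_eqToHom {X : Type v} [Category.{w} X] {p : ObjectProperty X}
    {F G : p.FullSubcategory} (h : F = G) :
    (eqToHom h).hom = eqToHom (congrArg ObjectProperty.FullSubcategory.obj h) := by
  subst h
  rfl

namespace Sesq

variable {W : Type v} [Category.{u} W] [MonoidalCategory W]

theorem functor_ext {A B C : LCat.{u} W} {p : ObjectProperty (Sesq A B C)} {X : Type v₁}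
    [Category.{w₁} X] {F G : X ⥤ p.FullSubcategory} (h : ∀ x, (F.obj x).obj = (G.obj x).obj)
    (h' : ∀ {x y : X} (f : x ⟶ y) (a : A.ob) (b : B.ob),
      HEq (Trans.app (F.map f).hom a b) (Trans.app (G.map f).hom a b)) : F = G :=
  CategoryTheory.Functor.ext (fun x => ObjectProperty.FullSubcategory.ext (h x)) (fun x y f =>
    ObjectProperty.hom_ext _ (by
      rw [ObjectProperty.FullSubcategory.comp_hom, ObjectProperty.FullSubcategory.comp_hom,
        fullSubcategory_eqToHom, fullSubcategory_eqToHom]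
      exact (eqToHom_comp_comp_eqToHom _ _ _ _ fun a b => (h' f a b).symm).symm))

theorem nat_ext {A B C : LCat.{u} W} {p : ObjectProperty (Sesq A B C)} {X : Type v₁}
    [Category.{w₁} X] {F G F' G' : X ⥤ p.FullSubcategory} (h : F' = F) (h' : G = G') (θ : F ⟶ G)
    (κ : F' ⟶ G') (H : ∀ x, (κ.app x).hom =
      eqToHom (congrArg (fun F => (CategoryTheory.Functor.obj F x).obj) h) ≫ (θ.app x).hom ≫
        eqToHom (congrArg (fun F => (CategoryTheory.Functor.obj F x).obj) h')) :
    κ = eqToHom h ≫ θ ≫ eqToHom h' := by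
  subst h h'
  apply NatTrans.ext
  funext x
  apply ObjectProperty.hom_ext
  rw [H]
  simp

variable (p : ∀ {A B C : LCat.{u} W}, Sesq A B C → Prop)
  (hp : ∀ {A B C : LCat.{u} W} {F : Sesq A B C}, p F → F.Central)
  (hp' : ∀ {A B C A' B' C' : LCat.{u} W} (P : LFunctor A' A) (Q : LFunctor B' B)
    (R : LFunctor C C') {F : Sesq A B C}, p F → p (act P Q R F))

/-- The 2-functor whose values are the full subcategories of the categories of pairs of families
of functors `F(-, b) : A ⟶ C`, `F(a, -) : B ⟶ C` determined by a predicate. -/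
def triFunctor : TriFunctor.{u} (LCat.{u} W) (LCat.{u} W) (LCat.{u} W) where
  obj A B C := Cat.of (ObjectProperty.FullSubcategory (C := Sesq A B C) (fun F => p F))
  map P Q R :=
    { obj := fun F => ⟨act P Q R F.obj, hp' P Q R F.property⟩
      map := fun θ => ObjectProperty.homMk (actMap P Q R θ.hom)
      map_id := fun F => ObjectProperty.hom_ext _ (actMap_id P Q R F.obj)
      map_comp := fun θ κ => ObjectProperty.hom_ext _ (actMap_comp P Q R θ.hom κ.hom) }
  map₂ ε ζ χ :=
    { app := fun F => ObjectProperty.homMk (act₂ ε ζ χ F.obj (hp F.property))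
      naturality := fun F G θ => ObjectProperty.hom_ext _
        (act₂_natural ε ζ χ (hp F.property) (hp G.property) θ.hom) }
  map_id A B C := functor_ext (fun F => act_id F.obj)
    (fun θ a b => heq_of_eq (Category.comp_id _))
  map_comp P Q R P' Q' R' := functor_ext (fun F => (act_act P Q R P' Q' R' F.obj).symm)
    (fun θ a b => heq_of_eq (Category.assoc _ _ _).symm)
  map₂_id P Q R := NatTrans.ext (funext fun F =>
    ObjectProperty.hom_ext _ (act₂_id P Q R F.obj (hp F.property)))
  map₂_comp ε ζ χ ε' ζ' χ' := NatTrans.ext (funext fun F =>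
    ObjectProperty.hom_ext _ (act₂_comp ε ζ χ ε' ζ' χ' F.obj (hp F.property)))
  map₂_outer ε ζ χ P' Q' R' := nat_ext _ _ _ _ fun F =>
    act₂_whisker_outer ε ζ χ P' Q' R' F.obj (hp F.property)
  map₂_inner ε ζ χ P Q R := nat_ext _ _ _ _ fun F =>
    act₂_whisker_inner ε ζ χ P Q R F.obj (hp F.property) (hp (hp' P Q R F.property))

end Sesq

namespace BiSesq

variable {W₀ : Type v} {W₁ : Type v₁} {W₂ : Type v₂} [Category.{u} W₀] [MonoidalCategory W₀]
  [Category.{u} W₁] [MonoidalCategory W₁] [Category.{u} W₂] [MonoidalCategory W₂] {L : W₀ ⥤ W₁}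
  [L.LaxMonoidal] {R : W₀ ⥤ W₂} [R.LaxMonoidal]

theorem functor_ext {A : LCat.{u} W₁} {B : LCat.{u} W₂} {C : LCat.{u} W₀}
    {p : ObjectProperty (BiSesq L R A B C)} {X : Type v₃}
    [Category.{w₁} X] {F G : X ⥤ p.FullSubcategory} (h : ∀ x, (F.obj x).obj = (G.obj x).obj)
    (h' : ∀ {x y : X} (f : x ⟶ y) (a : A.ob) (b : B.ob),
      HEq (Trans.app (F.map f).hom a b) (Trans.app (G.map f).hom a b)) : F = G :=
  CategoryTheory.Functor.ext (fun x => ObjectProperty.FullSubcategory.ext (h x)) (fun x y f =>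
    ObjectProperty.hom_ext _ (by
      rw [ObjectProperty.FullSubcategory.comp_hom, ObjectProperty.FullSubcategory.comp_hom,
        fullSubcategory_eqToHom, fullSubcategory_eqToHom]
      exact (eqToHom_comp_comp_eqToHom _ _ _ _ fun a b => (h' f a b).symm).symm))

theorem nat_ext {A : LCat.{u} W₁} {B : LCat.{u} W₂} {C : LCat.{u} W₀}
    {p : ObjectProperty (BiSesq L R A B C)} {X : Type v₃}
    [Category.{w₁} X] {F G F' G' : X ⥤ p.FullSubcategory} (h : F' = F) (h' : G = G') (θ : F ⟶ G)
    (κ : F' ⟶ G') (H : ∀ x, (κ.app x).hom =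
      eqToHom (congrArg (fun F => (CategoryTheory.Functor.obj F x).obj) h) ≫ (θ.app x).hom ≫
        eqToHom (congrArg (fun F => (CategoryTheory.Functor.obj F x).obj) h')) :
    κ = eqToHom h ≫ θ ≫ eqToHom h' := by
  subst h h'
  apply NatTrans.ext
  funext x
  apply ObjectProperty.hom_ext
  rw [H]
  simp

variable [NormalLax L] [NormalLax R]
  (p : ∀ {A : LCat.{u} W₁} {B : LCat.{u} W₂} {C : LCat.{u} W₀}, BiSesq L R A B C → Prop)
  (hp : ∀ {A : LCat.{u} W₁} {B : LCat.{u} W₂} {C : LCat.{u} W₀} {F : BiSesq L R A B C},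
    p F → F.Central)
  (hp' : ∀ {A A' : LCat.{u} W₁} {B B' : LCat.{u} W₂} {C C' : LCat.{u} W₀} (P : LFunctor A' A)
    (Q : LFunctor B' B) (S : LFunctor C C') {F : BiSesq L R A B C}, p F → p (act P Q S F))

/-- The 2-functor whose values are the full subcategories of the categories of pairs of families
of functors `F(-, b) : A ⟶ L_* C`, `F(a, -) : B ⟶ R_* C` determined by a predicate. -/
noncomputable def triFunctor : TriFunctor.{u} (LCat.{u} W₁) (LCat.{u} W₂) (LCat.{u} W₀) where
  obj A B C := Cat.of (ObjectProperty.FullSubcategory (C := BiSesq L R A B C) (fun F => p F))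
  map P Q S :=
    { obj := fun F => ⟨act P Q S F.obj, hp' P Q S F.property⟩
      map := fun θ => ObjectProperty.homMk (actMap P Q S θ.hom)
      map_id := fun F => ObjectProperty.hom_ext _ (actMap_id P Q S F.obj)
      map_comp := fun θ κ => ObjectProperty.hom_ext _ (actMap_comp P Q S θ.hom κ.hom) }
  map₂ ε ζ χ :=
    { app := fun F => ObjectProperty.homMk (act₂ ε ζ χ F.obj (hp F.property))
      naturality := fun F G θ => ObjectProperty.hom_ext _
        (act₂_natural ε ζ χ (hp F.property) (hp G.property) θ.hom) }
  map_id A B C := functor_ext (fun F => act_id F.obj)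
    (fun θ a b => heq_of_eq (Category.comp_id _))
  map_comp P Q S P' Q' S' := functor_ext (fun F => (act_act P Q S P' Q' S' F.obj).symm)
    (fun θ a b => heq_of_eq (Category.assoc _ _ _).symm)
  map₂_id P Q S := NatTrans.ext (funext fun F =>
    ObjectProperty.hom_ext _ (act₂_id P Q S F.obj (hp F.property)))
  map₂_comp ε ζ χ ε' ζ' χ' := NatTrans.ext (funext fun F =>
    ObjectProperty.hom_ext _ (act₂_comp ε ζ χ ε' ζ' χ' F.obj (hp F.property)))
  map₂_outer ε ζ χ P' Q' S' := nat_ext _ _ _ _ fun F =>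
    act₂_whisker_outer ε ζ χ P' Q' S' F.obj (hp F.property)
  map₂_inner ε ζ χ P Q S := nat_ext _ _ _ _ fun F =>
    act₂_whisker_inner ε ζ χ P Q S F.obj (hp F.property) (hp (hp' P Q S F.property))

end BiSesq

section

open DuoidalCategory

variable {V : Type v} [Category.{w} V] [MonoidalCategory V] [StarMonoidal V] [DuoidalCategory V]
  [NormalDuoidal V]

/-- The unitor `X ⋆ I ⟶ X` of a normal duoidal category. -/
noncomputable def duoR (X : V) : starObj X (𝟙_ V) ⟶ X :=
  starHom (𝟙 X) (inv ν) ≫ (starRight X).hom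

/-- The unitor `I ⋆ X ⟶ X` of a normal duoidal category. -/
noncomputable def duoL (X : V) : starObj (𝟙_ V) X ⟶ X :=
  starHom (inv ν) (𝟙 X) ≫ (starLeft X).hom

instance (X : V) : IsIso (duoR X) :=
  ⟨(starRight X).inv ≫ starHom (𝟙 X) ν, by
    rw [duoR, Category.assoc, Iso.hom_inv_id_assoc, starHom_comp, IsIso.inv_hom_id,
      Category.id_comp, starHom_id], by
    rw [duoR, Category.assoc, starHom_comp_assoc, IsIso.hom_inv_id, Category.id_comp, starHom_id,
      Category.id_comp, Iso.inv_hom_id]⟩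

instance (X : V) : IsIso (duoL X) :=
  ⟨(starLeft X).inv ≫ starHom ν (𝟙 X), by
    rw [duoL, Category.assoc, Iso.hom_inv_id_assoc, starHom_comp, IsIso.inv_hom_id,
      Category.id_comp, starHom_id], by
    rw [duoL, Category.assoc, starHom_comp_assoc, IsIso.hom_inv_id, Category.id_comp, starHom_id,
      Category.id_comp, Iso.inv_hom_id]⟩

theorem duoR_naturality {X Y : V} (f : X ⟶ Y) :
    starHom f (𝟙 (𝟙_ V)) ≫ duoR Y = duoR X ≫ f := by
  rw [duoR, duoR, Category.assoc, ← starRight_naturality, starHom_comp_assoc,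
    starHom_comp_assoc, Category.id_comp, Category.comp_id, Category.id_comp, Category.comp_id]

theorem duoL_naturality {X Y : V} (f : X ⟶ Y) :
    starHom (𝟙 (𝟙_ V)) f ≫ duoL Y = duoL X ≫ f := by
  rw [duoL, duoL, Category.assoc, ← starLeft_naturality, starHom_comp_assoc,
    starHom_comp_assoc, Category.id_comp, Category.comp_id, Category.id_comp, Category.comp_id]

theorem duoR_unit : duoR (𝟙_ V) = μ := by
  rw [duoR, ← μ_star_right_unit, starHom_comp_assoc, IsIso.inv_hom_id, Category.id_comp,
    starHom_id, Category.id_comp]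

theorem duoL_unit : duoL (𝟙_ V) = μ := by
  rw [duoL, ← μ_star_left_unit, starHom_comp_assoc, IsIso.inv_hom_id, Category.id_comp,
    starHom_id, Category.id_comp]

/-- The morphism
`X ⋆ X' ≅ (X ⊗ I) ⋆ (I ⊗ X') ⟶ (X ⋆ I) ⊗ (I ⋆ X') ≅ X ⊗ X'`. -/
noncomputable def duoSigma (X X' : V) : starObj X X' ⟶ X ⊗ X' :=
  starHom (ρ_ X).inv (λ_ X').inv ≫ ξ X (𝟙_ V) (𝟙_ V) X' ≫ (duoR X ⊗ₘ duoL X')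

/-- The morphism
`X ⋆ X' ≅ (I ⊗ X) ⋆ (X' ⊗ I) ⟶ (I ⋆ X') ⊗ (X ⋆ I) ≅ X' ⊗ X`. -/
noncomputable def duoTau (X X' : V) : starObj X X' ⟶ X' ⊗ X :=
  starHom (λ_ X).inv (ρ_ X').inv ≫ ξ (𝟙_ V) X X' (𝟙_ V) ≫ (duoL X' ⊗ₘ duoR X)

theorem duoSigma_naturality {X Y X' Y' : V} (f : X ⟶ Y) (g : X' ⟶ Y') :
    starHom f g ≫ duoSigma Y Y' = duoSigma X X' ≫ (f ⊗ₘ g) := by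
  have h := ξ_natural f (𝟙 (𝟙_ V)) (𝟙 (𝟙_ V)) g
  rw [duoSigma, duoSigma, Category.assoc, Category.assoc, tensorHom_comp_tensorHom,
    ← duoR_naturality, ← duoL_naturality, ← tensorHom_comp_tensorHom, ← Category.assoc (ξ _ _ _ _),
    ← h, starHom_comp_assoc, Category.assoc, starHom_comp_assoc, tensorHom_id, id_tensorHom,
    rightUnitor_inv_naturality, leftUnitor_inv_naturality]

theorem duoTau_naturality {X Y X' Y' : V} (f : X ⟶ Y) (g : X' ⟶ Y') :
    starHom f g ≫ duoTau Y Y' = duoTau X X' ≫ (g ⊗ₘ f) := by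
  have h := ξ_natural (𝟙 (𝟙_ V)) f g (𝟙 (𝟙_ V))
  rw [duoTau, duoTau, Category.assoc, Category.assoc, tensorHom_comp_tensorHom,
    ← duoR_naturality, ← duoL_naturality, ← tensorHom_comp_tensorHom, ← Category.assoc (ξ _ _ _ _),
    ← h, starHom_comp_assoc, Category.assoc, starHom_comp_assoc, tensorHom_id, id_tensorHom,
    rightUnitor_inv_naturality, leftUnitor_inv_naturality]

theorem ξ_left (X X' : V) : ξ (𝟙_ V) X (𝟙_ V) X' ≫ (μ ▷ starObj X X') =
    starHom (λ_ X).hom (λ_ X').hom ≫ (λ_ _).inv := by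
  rw [← ξ_left_unit, Category.assoc, Category.assoc, Iso.hom_inv_id, Category.comp_id]

theorem ξ_right (X X' : V) : ξ X (𝟙_ V) X' (𝟙_ V) ≫ (starObj X X' ◁ μ) =
    starHom (ρ_ X).hom (ρ_ X').hom ≫ (ρ_ _).inv := by
  rw [← ξ_right_unit, Category.assoc, Category.assoc, Iso.hom_inv_id, Category.comp_id]

theorem duoSigma_unit_right (X : V) : duoSigma X (𝟙_ V) = duoR X ≫ (ρ_ X).inv := by
  rw [duoSigma, duoL_unit, MonoidalCategory.tensorHom_def', ← Category.assoc (ξ _ _ _ _), ξ_right,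
    Category.assoc, ← Category.assoc, starHom_comp, Iso.inv_hom_id, ← unitors_equal, Iso.inv_hom_id,
    starHom_id, Category.id_comp, rightUnitor_inv_naturality]

theorem duoTau_unit_right (X : V) : duoTau X (𝟙_ V) = duoR X ≫ (λ_ X).inv := by
  rw [duoTau, duoL_unit, MonoidalCategory.tensorHom_def, ← Category.assoc (ξ _ _ _ _), ξ_left,
    Category.assoc, ← Category.assoc, starHom_comp, Iso.inv_hom_id, unitors_equal, Iso.inv_hom_id,
    starHom_id, Category.id_comp, leftUnitor_inv_naturality]

theorem duoSigma_unit_left (X : V) : duoSigma (𝟙_ V) X = duoL X ≫ (λ_ X).inv := by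
  rw [duoSigma, duoR_unit, MonoidalCategory.tensorHom_def, ← Category.assoc (ξ _ _ _ _), ξ_left,
    Category.assoc, ← Category.assoc, starHom_comp, Iso.inv_hom_id, unitors_equal, Iso.inv_hom_id,
    starHom_id, Category.id_comp, leftUnitor_inv_naturality]

theorem duoTau_unit_left (X : V) : duoTau (𝟙_ V) X = duoL X ≫ (ρ_ X).inv := by
  rw [duoTau, duoR_unit, MonoidalCategory.tensorHom_def', ← Category.assoc (ξ _ _ _ _), ξ_right,
    Category.assoc, ← Category.assoc, starHom_comp, Iso.inv_hom_id, ← unitors_equal, Iso.inv_hom_id,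
    starHom_id, Category.id_comp, rightUnitor_inv_naturality]

end

namespace LCat

variable {W : Type v} [Category.{u} W] [MonoidalCategory W] [StarMonoidal W] [DuoidalCategory W]
  [NormalDuoidal W]

/-- Enriched squares in a `W`-category. -/
def EnrichedSquare {C : LCat.{u} W} {P Q : W} {a a' b b' : C.ob} (f : P ⟶ C.hom a a')
    (g : P ⟶ C.hom b b') (φ : Q ⟶ C.hom a b) (φ' : Q ⟶ C.hom a' b') : Prop :=
  duoSigma P Q ≫ (g ⊗ₘ φ) ≫ C.comp a b b' = duoTau P Q ≫ (φ' ⊗ₘ f) ≫ C.comp a a' b'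

theorem EnrichedSquare.precomp {C : LCat.{u} W} {P Q P' Q' : W} {a a' b b' : C.ob}
    {f : P ⟶ C.hom a a'} {g : P ⟶ C.hom b b'} {φ : Q ⟶ C.hom a b} {φ' : Q ⟶ C.hom a' b'}
    (h : EnrichedSquare f g φ φ') (p : P' ⟶ P) (q : Q' ⟶ Q) :
    EnrichedSquare (p ≫ f) (p ≫ g) (q ≫ φ) (q ≫ φ') := by
  rw [EnrichedSquare, ← tensorHom_comp_tensorHom, ← tensorHom_comp_tensorHom, Category.assoc,
    Category.assoc, ← Category.assoc (duoSigma _ _), ← Category.assoc (duoTau _ _),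
    ← duoSigma_naturality, ← duoTau_naturality, Category.assoc, Category.assoc, h]

theorem EnrichedSquare.map {C D : LCat.{u} W} (R : LFunctor C D) {P Q : W} {a a' b b' : C.ob}
    {f : P ⟶ C.hom a a'} {g : P ⟶ C.hom b b'} {φ : Q ⟶ C.hom a b} {φ' : Q ⟶ C.hom a' b'}
    (h : EnrichedSquare f g φ φ') : EnrichedSquare (C := D) (f ≫ R.map _ _) (g ≫ R.map _ _)
      (φ ≫ R.map _ _) (φ' ≫ R.map _ _) := by
  rw [EnrichedSquare, ← tensorHom_comp_tensorHom, ← tensorHom_comp_tensorHom, Category.assoc,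
    Category.assoc, ← R.map_comp, ← R.map_comp]
  have h' := congrArg (· ≫ R.map a b') h
  simpa only [Category.assoc] using h'

end LCat

namespace Sesq

open LCat

section

variable {W : Type v} [Category.{u} W] [MonoidalCategory W] [StarMonoidal W] [DuoidalCategory W]
  [NormalDuoidal W] {A B C A' B' C' : LCat.{u} W}

/-- Enriched bifunctors in the sense of Garner and López Franco. -/
def IsEnrichedBifunctor (F : Sesq A B C) : Prop :=
  ∀ (a a' : A.ob) (b b' : B.ob),
    EnrichedSquare (F.mapL a a' b) (F.mapL a a' b') (F.mapR a b b') (F.mapR a' b b')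

theorem IsEnrichedBifunctor.act {F : Sesq A B C} (hF : F.IsEnrichedBifunctor) (P : LFunctor A' A)
    (Q : LFunctor B' B) (R : LFunctor C C') : (act P Q R F).IsEnrichedBifunctor :=
  fun a a' b b' => ((hF _ _ _ _).precomp (P.map a a') (Q.map b b')).map R

theorem IsEnrichedBifunctor.central {F : Sesq A B C} (hF : F.IsEnrichedBifunctor) : F.Central where
  natL {b b'} y a a' := by
    have h := (hF a a' b b').precomp (𝟙 _) y
    rw [EnrichedSquare, duoSigma_unit_right, duoTau_unit_right, Category.assoc, Category.assoc,
      cancel_epi, Category.id_comp, Category.id_comp, MonoidalCategory.tensorHom_def, MonoidalCategory.tensorHom_def',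
      Category.assoc, Category.assoc, ← Category.assoc, ← rightUnitor_inv_naturality,
      ← Category.assoc (λ_ _).inv, ← leftUnitor_inv_naturality, Category.assoc, Category.assoc] at h
    exact h.symm
  natR {a a'} x b b' := by
    have h := (hF a a' b b').precomp x (𝟙 _)
    rw [EnrichedSquare, duoSigma_unit_left, duoTau_unit_left, Category.assoc, Category.assoc,
      cancel_epi, Category.id_comp, Category.id_comp, MonoidalCategory.tensorHom_def', MonoidalCategory.tensorHom_def,
      Category.assoc, Category.assoc, ← Category.assoc, ← leftUnitor_inv_naturality,
      ← Category.assoc (ρ_ _).inv, ← rightUnitor_inv_naturality, Category.assoc, Category.assoc] at h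
    exact h

end

end Sesq

/-- The 2-functor `V-Bif` of enriched bifunctors. -/
noncomputable def enrBif (W : Type v) [Category.{u} W] [MonoidalCategory W] [StarMonoidal W]
    [DuoidalCategory W] [NormalDuoidal W] : TriFunctor.{u} (LCat.{u} W) (LCat.{u} W) (LCat.{u} W) :=
  Sesq.triFunctor Sesq.IsEnrichedBifunctor (fun h => h.central) (fun P Q R _ h => h.act P Q R)

section

open Psh

variable {V : Type u} [SmallCategory V] [MonoidalCategory V]

/-- The element of the Day convolution `P ⊗ Q` given by a pair of elements. -/
def Psh.tmul {P Q : Psh V} {X Y : V} (p : P.el X) (q : Q.el Y) : (P ⊗ Q).el (X ⊗ Y) :=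
  Day.kap inferInstance p q

theorem Psh.ap_tmul {P Q P' Q' : Psh V} (f : P ⟶ P') (g : Q ⟶ Q') {X Y : V} (p : P.el X)
    (q : Q.el Y) : ap (f ⊗ₘ g) (tmul p q) = tmul (ap f p) (ap g q) :=
  Day.map_kap _ f g p q

theorem Psh.ap_whiskerRight_tmul {P Q P' : Psh V} (f : P ⟶ P') {X Y : V} (p : P.el X)
    (q : Q.el Y) : ap (f ▷ Q) (tmul p q) = tmul (ap f p) q := by
  rw [← tensorHom_id, ap_tmul, ap_id]

theorem Psh.ap_whiskerLeft_tmul {P Q Q' : Psh V} (g : Q ⟶ Q') {X Y : V} (p : P.el X)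
    (q : Q.el Y) : ap (P ◁ g) (tmul p q) = tmul p (ap g q) := by
  rw [← id_tensorHom, ap_tmul, ap_id]

theorem Psh.ap_leftUnitor_inv {P : Psh V} {X : V} (p : P.el X) :
    ap (λ_ P).inv p = (𝟙_ (Psh V) ⊗ P).res (λ_ X).inv
      (tmul (P := 𝟙_ (Psh V)) (toYo (𝟙 (𝟙_ V))) p) :=
  Day.leftUnitor_inv _ P p

theorem Psh.ap_rightUnitor_inv {P : Psh V} {X : V} (p : P.el X) :
    ap (ρ_ P).inv p = (P ⊗ 𝟙_ (Psh V)).res (ρ_ X).inv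
      (tmul (Q := 𝟙_ (Psh V)) p (toYo (𝟙 (𝟙_ V)))) :=
  Day.rightUnitor_inv _ P p

theorem Psh.res_cancel {P : Psh V} {X Y Z : V} (e : Y ⟶ X) [IsIso e] {f : X ⟶ Z} {p : P.el Z}
    {Z' : V} {f' : X ⟶ Z'} {p' : P.el Z'} (h : P.res (e ≫ f) p = P.res (e ≫ f') p') :
    P.res f p = P.res f' p' := by
  have h' := congrArg (P.res (inv e)) h
  simpa using h'

namespace LCat

/-- The composite `g ∘ f` of grade `Y ⊗ X` of graded morphisms `f` and `g` of grades `X` and `Y`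
of a `V`-graded category. -/
def gcomp {C : LCat.{u} (Psh V)} {a b c : C.ob} {X Y : V} (g : (C.hom b c).el Y)
    (f : (C.hom a b).el X) : (C.hom a c).el (Y ⊗ X) :=
  ap (C.comp a b c) (tmul g f)

theorem map_gcomp {C D : LCat.{u} (Psh V)} (R : LFunctor C D) {a b c : C.ob} {X Y : V}
    (g : (C.hom b c).el Y) (f : (C.hom a b).el X) :
    ap (R.map a c) (gcomp g f) = gcomp (ap (R.map b c) g) (ap (R.map a b) f) := by
  rw [gcomp, gcomp, ← ap_tmul, ← ap_comp, ← ap_comp, R.map_comp]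

/-- A morphism of the underlying category as a graded morphism of grade `I`. -/
def Und.el {C : LCat.{u} (Psh V)} {a b : C.ob} (x : C.Und a b) : (C.hom a b).el (𝟙_ V) :=
  ap x (toYo (𝟙 (𝟙_ V)))

theorem ap_post {C : LCat.{u} (Psh V)} {a b c : C.ob} (y : C.Und b c) {X : V}
    (f : (C.hom a b).el X) : ap (post y a) f = (C.hom a c).res (λ_ X).inv (gcomp (Und.el y) f) := by
  rw [post, ap_comp, ap_comp, ap_leftUnitor_inv, ap_res, ap_whiskerRight_tmul, ap_res]
  rfl

theorem ap_pre {C : LCat.{u} (Psh V)} {a b c : C.ob} (x : C.Und a b) {X : V}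
    (g : (C.hom b c).el X) : ap (pre x c) g = (C.hom a c).res (ρ_ X).inv (gcomp g (Und.el x)) := by
  rw [pre, ap_comp, ap_comp, ap_rightUnitor_inv, ap_res, ap_whiskerLeft_tmul, ap_res]
  rfl

end LCat

variable [StarMonoidal V] [DuoidalCategory V] [NormalDuoidal V]

/-- Graded squares in a `V`-graded category: `σ^*(g ∘ φ) = τ^*(φ' ∘ f)`. -/
def LCat.GradedSquare {C : LCat.{u} (Psh V)} {X X' : V} {a a' b b' : C.ob} (f : (C.hom a a').el X)
    (g : (C.hom b b').el X) (φ : (C.hom a b).el X') (φ' : (C.hom a' b').el X') : Prop :=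
  (C.hom a b').res (duoSigma X X') (gcomp g φ) = (C.hom a b').res (duoTau X X') (gcomp φ' f)

namespace Sesq

variable {A B C A' B' C' : LCat.{u} (Psh V)}

/-- `V`-graded bifunctors. -/
def IsGradedBifunctor (F : Sesq A B C) : Prop :=
  ∀ (a a' : A.ob) (b b' : B.ob) (X X' : V) (f : (A.hom a a').el X) (g : (B.hom b b').el X'),
    LCat.GradedSquare (ap (F.mapL a a' b) f) (ap (F.mapL a a' b') f) (ap (F.mapR a b b') g)
      (ap (F.mapR a' b b') g)

theorem IsGradedBifunctor.act {F : Sesq A B C} (hF : F.IsGradedBifunctor) (P : LFunctor A' A)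
    (Q : LFunctor B' B) (R : LFunctor C C') : (act P Q R F).IsGradedBifunctor :=
  fun a a' b b' X X' f g => by
    have h := congrArg (ap (R.map _ _)) (hF _ _ _ _ X X' (ap (P.map a a') f) (ap (Q.map b b') g))
    rw [ap_res, ap_res, LCat.map_gcomp, LCat.map_gcomp] at h
    simp only [LCat.GradedSquare, ap_comp]
    exact h

theorem IsGradedBifunctor.central {F : Sesq A B C} (hF : F.IsGradedBifunctor) : F.Central where
  natL {b b'} y a a' := Psh.hom_ext fun X f => by
    have h := hF a a' b b' X (𝟙_ V) f (LCat.Und.el y)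
    rw [LCat.GradedSquare, duoSigma_unit_right, duoTau_unit_right] at h
    rw [ap_comp, ap_comp, LCat.ap_post, LCat.ap_pre]
    simp only [LCat.Und.el, ap_comp] at h ⊢
    exact (res_cancel _ h).symm
  natR {a a'} x b b' := Psh.hom_ext fun X g => by
    have h := hF a a' b b' (𝟙_ V) X (LCat.Und.el x) g
    rw [LCat.GradedSquare, duoSigma_unit_left, duoTau_unit_left] at h
    rw [ap_comp, ap_comp, LCat.ap_post, LCat.ap_pre]
    simp only [LCat.Und.el, ap_comp] at h ⊢
    exact res_cancel _ h

end Sesq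

end

/-- The 2-functor `V-GBif` of `V`-graded bifunctors. -/
noncomputable def grBif (V : Type u) [SmallCategory V] [MonoidalCategory V] [StarMonoidal V]
    [DuoidalCategory V] [NormalDuoidal V] :
    TriFunctor.{u} (LCat.{u} (Psh V)) (LCat.{u} (Psh V)) (LCat.{u} (Psh V)) :=
  Sesq.triFunctor Sesq.IsGradedBifunctor (fun h => h.central) (fun P Q R _ h => h.act P Q R)

namespace Psh

section

variable {V : Type u} [SmallCategory V] [MonoidalCategory V]

theorem tmul_res {P Q : Psh V} {X Y X' Y' : V} (f : X ⟶ X') (g : Y ⟶ Y') (p : P.el X')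
    (q : Q.el Y') : tmul (P.res f p) (Q.res g q) = (P ⊗ Q).res (f ⊗ₘ g) (tmul p q) :=
  Day.kap_res f g p q

theorem tmul_res_left {P Q : Psh V} {X X' Y : V} (f : X ⟶ X') (p : P.el X') (q : Q.el Y) :
    tmul (P.res f p) q = (P ⊗ Q).res (f ▷ Y) (tmul p q) :=
  Day.kap_res_left f p q

theorem tmul_res_right {P Q : Psh V} {X Y Y' : V} (g : Y ⟶ Y') (p : P.el X) (q : Q.el Y') :
    tmul p (Q.res g q) = (P ⊗ Q).res (X ◁ g) (tmul p q) :=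
  Day.kap_res_right g p q

theorem ap_assoc_tmul {P Q R : Psh V} {X Y Z : V} (p : P.el X) (q : Q.el Y) (r : R.el Z) :
    ap (α_ P Q R).hom (tmul (tmul p q) r) =
      (P ⊗ Q ⊗ R).res (α_ X Y Z).hom (tmul p (tmul q r)) :=
  Day.assoc_kap _ P Q R p q r

theorem ap_leftUnitor_tmul {P : Psh V} {Y Z : V} (j : Y ⟶ 𝟙_ V) (p : P.el Z) :
    ap (λ_ P).hom (tmul (P := 𝟙_ (Psh V)) (toYo j) p) = P.res (j ▷ Z ≫ (λ_ Z).hom) p :=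
  Day.leftUnitor_kap _ P j p

theorem ap_rightUnitor_tmul {P : Psh V} {Y Z : V} (p : P.el Y) (j : Z ⟶ 𝟙_ V) :
    ap (ρ_ P).hom (tmul (Q := 𝟙_ (Psh V)) p (toYo j)) = P.res (Y ◁ j ≫ (ρ_ Y).hom) p :=
  Day.rightUnitor_kap _ P p j

theorem tensor_ext {P Q S : Psh V} {f g : P ⊗ Q ⟶ S}
    (h : ∀ {Y Z : V} (p : P.el Y) (q : Q.el Z), ap f (tmul p q) = ap g (tmul p q)) : f = g :=
  Day.conv_ext h

theorem tensor_ext_left {P Q R S : Psh V} {f g : (P ⊗ Q) ⊗ R ⟶ S}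
    (h : ∀ {X Y Z : V} (p : P.el X) (q : Q.el Y) (r : R.el Z),
      ap f (tmul (tmul p q) r) = ap g (tmul (tmul p q) r)) : f = g :=
  Day.conv_ext_left h

/-- The Yoneda embedding. -/
@[reducible] def yonedaFunctor (V : Type u) [SmallCategory V] : V ⥤ Psh V where
  obj X := yo X
  map f := Day.yoMap f
  map_id X := hom_ext fun _ p => by
    obtain ⟨p, rfl⟩ := exists_toYo p
    rw [Day.yoMap_toYo, Category.comp_id, ap_id]
  map_comp f g := hom_ext fun _ p => by
    obtain ⟨p, rfl⟩ := exists_toYo p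
    rw [ap_comp, Day.yoMap_toYo, Day.yoMap_toYo, Day.yoMap_toYo, Category.assoc]

/-- The comparison `yo X ⊗ yo Y ⟶ yo (X ⊗ Y)`. -/
def yoMul (X Y : V) : yo X ⊗ yo Y ⟶ yo (X ⊗ Y) := Day.yoTensor inferInstance X Y

theorem ap_yoMul {X Y A B : V} (p : A ⟶ X) (q : B ⟶ Y) :
    ap (yoMul X Y) (tmul (toYo p) (toYo q)) = toYo (p ⊗ₘ q) :=
  Day.yoTensor_kap _ p q

instance : (yonedaFunctor V).LaxMonoidal where
  ε := 𝟙 (𝟙_ (Psh V))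
  μ X Y := yoMul X Y
  μ_natural_left f X' := tensor_ext fun p q => by
    obtain ⟨p, rfl⟩ := exists_toYo p
    obtain ⟨q, rfl⟩ := exists_toYo q
    rw [ap_comp, ap_comp, ap_whiskerRight_tmul, Day.yoMap_toYo, ap_yoMul, ap_yoMul,
      Day.yoMap_toYo, ← tensorHom_id, tensorHom_comp_tensorHom, Category.comp_id]
  μ_natural_right X' f := tensor_ext fun p q => by
    obtain ⟨p, rfl⟩ := exists_toYo p
    obtain ⟨q, rfl⟩ := exists_toYo q
    rw [ap_comp, ap_comp, ap_whiskerLeft_tmul, Day.yoMap_toYo, ap_yoMul, ap_yoMul,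
      Day.yoMap_toYo, ← id_tensorHom, tensorHom_comp_tensorHom, Category.comp_id]
  associativity X Y Z := tensor_ext_left fun p q r => by
    obtain ⟨p, rfl⟩ := exists_toYo p
    obtain ⟨q, rfl⟩ := exists_toYo q
    obtain ⟨r, rfl⟩ := exists_toYo r
    rw [ap_comp, ap_comp, ap_whiskerRight_tmul, ap_yoMul, ap_yoMul, Day.yoMap_toYo, ap_comp,
      ap_comp, ap_assoc_tmul, ap_res, ap_whiskerLeft_tmul, ap_yoMul, ap_res, ap_yoMul, yo_res,
      associator_naturality]
  left_unitality X := tensor_ext fun p q => by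
    obtain ⟨p, rfl⟩ := exists_toYo p
    obtain ⟨q, rfl⟩ := exists_toYo q
    rw [ap_leftUnitor_tmul, ap_comp, ap_comp, ap_whiskerRight_tmul, ap_id, ap_yoMul,
      Day.yoMap_toYo, yo_res, MonoidalCategory.tensorHom_def, Category.assoc, Category.assoc,
      leftUnitor_naturality]
  right_unitality X := tensor_ext fun p q => by
    obtain ⟨p, rfl⟩ := exists_toYo p
    obtain ⟨q, rfl⟩ := exists_toYo q
    rw [ap_rightUnitor_tmul, ap_comp, ap_comp, ap_whiskerLeft_tmul, ap_id, ap_yoMul,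
      Day.yoMap_toYo, yo_res, MonoidalCategory.tensorHom_def', Category.assoc, Category.assoc,
      rightUnitor_naturality]

end

section

variable {V W : Type u} [SmallCategory V] [SmallCategory W] (F : V ⥤ W)

/-- An element of `S` at `F X` as an element of the presheaf `S ∘ F` at `X`. -/
def toPre (S : Psh W) {X : V} (s : S.el (F.obj X)) : (pre F S).el X := s

theorem exists_toPre {S : Psh W} {X : V} (s : (pre F S).el X) : ∃ s', s = toPre F S s' := ⟨s, rfl⟩

/-- An element of the presheaf `S ∘ F` at `X` as an element of `S` at `F X`. -/
def ofPre {S : Psh W} {X : V} (s : (pre F S).el X) : S.el (F.obj X) := s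

theorem ofPre_toPre (S : Psh W) {X : V} (s : S.el (F.obj X)) : ofPre F (toPre F S s) = s := Eq.trans rfl rfl

theorem res_toPre (S : Psh W) {X Y : V} (w : Y ⟶ X) (s : S.el (F.obj X)) :
    (pre F S).res w (toPre F S s) = toPre F S (S.res (F.map w) s) := Eq.trans rfl rfl

theorem ofPre_res {S : Psh W} {X Y : V} (w : Y ⟶ X) (s : (pre F S).el X) :
    ofPre F ((pre F S).res w s) = S.res (F.map w) (ofPre F s) := Eq.trans rfl rfl

attribute [irreducible] toPre ofPre

theorem preMap_res {S T : Psh W} (f : S ⟶ T) {X Y : V} (w : Y ⟶ X) (s : (pre F S).el X) :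
    toPre F T (ap f (ofPre F ((pre F S).res w s))) =
      (pre F T).res w (toPre F T (ap f (ofPre F s))) := by
  rw [ofPre_res, ap_res, res_toPre]

/-- The morphism `S ∘ F ⟶ T ∘ F` induced by a morphism `S ⟶ T`. -/
def preMap {S T : Psh W} (f : S ⟶ T) : pre F S ⟶ pre F T :=
  homMk (fun {_} s => toPre F T (ap f (ofPre F s))) (preMap_res F f)

theorem ap_preMap {S T : Psh W} (f : S ⟶ T) {X : V} (s : S.el (F.obj X)) :
    ap (preMap F f) (toPre F S s) = toPre F T (ap f s) :=
  (ap_homMk _ (preMap_res F f) _).trans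
    (congrArg (fun s => toPre F T (ap f s)) (ofPre_toPre F S s))

/-- The functor `S ↦ S ∘ F`. -/
@[reducible] def preFunctor : Psh W ⥤ Psh V where
  obj S := pre F S
  map f := preMap F f
  map_id S := hom_ext fun _ s => by
    obtain ⟨s, rfl⟩ := exists_toPre F s
    rw [ap_preMap, ap_id, ap_id]
  map_comp f g := hom_ext fun _ s => by
    obtain ⟨s, rfl⟩ := exists_toPre F s
    rw [ap_comp, ap_preMap, ap_preMap, ap_preMap, ap_comp]

variable [MonoidalCategory V] [MonoidalCategory W] [F.OplaxMonoidal]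

open Functor.OplaxMonoidal

theorem preOne_res {X Y : V} (w : Y ⟶ X) (j : (yo (𝟙_ V)).el X) :
    toPre F (yo (𝟙_ W)) (toYo (F.map (ofYo ((yo (𝟙_ V)).res w j)) ≫ η F)) =
      (pre F (yo (𝟙_ W))).res w (toPre F (yo (𝟙_ W)) (toYo (F.map (ofYo j) ≫ η F))) := by
  rw [ofYo_res, res_toPre, yo_res, F.map_comp, Category.assoc]

/-- The morphism `yo I ⟶ yo I ∘ F` induced by `F I ⟶ I`. -/
def preOne : 𝟙_ (Psh V) ⟶ pre F (𝟙_ (Psh W)) :=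
  homMk (P := yo (𝟙_ V)) (Q := pre F (yo (𝟙_ W)))
    (fun {_} j => toPre F (yo (𝟙_ W)) (toYo (F.map (ofYo j) ≫ η F))) (preOne_res F)

theorem ap_preOne {X : V} (j : X ⟶ 𝟙_ V) : ap (preOne F) (P := 𝟙_ (Psh V)) (toYo j) =
    toPre F (𝟙_ (Psh W)) (toYo (F.map j ≫ η F)) :=
  (ap_homMk _ (preOne_res F) _).trans
    (congrArg (fun j => toPre F (yo (𝟙_ W)) (toYo (F.map j ≫ η F))) (ofYo_toYo j))

/-- The morphism `(S ∘ F) ⊗ (T ∘ F) ⟶ (S ⊗ T) ∘ F` induced by the morphisms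
`F (X ⊗ Y) ⟶ F X ⊗ F Y`. -/
def preMul (S T : Psh W) : pre F S ⊗ pre F T ⟶ pre F (S ⊗ T) :=
  Day.desc (fun {Y Z} s t => toPre F (S ⊗ T) ((S ⊗ T).res (δ F Y Z) (tmul (ofPre F s) (ofPre F t))))
    (fun {Y Z Y' Z'} f g s t => by
      rw [ofPre_res, ofPre_res, tmul_res, res_res, res_toPre, res_res, δ_natural])

theorem ap_preMul {S T : Psh W} {X Y : V} (s : S.el (F.obj X)) (t : T.el (F.obj Y)) :
    ap (preMul F S T) (tmul (toPre F S s) (toPre F T t)) =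
      toPre F (S ⊗ T) ((S ⊗ T).res (δ F X Y) (tmul s t)) := by
  refine (Day.desc_kap _ _ _ _).trans ?_
  rw [ofPre_toPre, ofPre_toPre]

instance : (preFunctor F).LaxMonoidal where
  ε := preOne F
  μ S T := preMul F S T
  μ_natural_left f T := tensor_ext fun s t => by
    obtain ⟨s, rfl⟩ := exists_toPre F s
    obtain ⟨t, rfl⟩ := exists_toPre F t
    rw [ap_comp, ap_comp, ap_whiskerRight_tmul, ap_preMap, ap_preMul, ap_preMul, ap_preMap,
      ap_res, ap_whiskerRight_tmul]
  μ_natural_right S f := tensor_ext fun s t => by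
    obtain ⟨s, rfl⟩ := exists_toPre F s
    obtain ⟨t, rfl⟩ := exists_toPre F t
    rw [ap_comp, ap_comp, ap_whiskerLeft_tmul, ap_preMap, ap_preMul, ap_preMul, ap_preMap,
      ap_res, ap_whiskerLeft_tmul]
  associativity S T U := tensor_ext_left fun s t z => by
    obtain ⟨s, rfl⟩ := exists_toPre F s
    obtain ⟨t, rfl⟩ := exists_toPre F t
    obtain ⟨z, rfl⟩ := exists_toPre F z
    rw [ap_comp, ap_comp, ap_whiskerRight_tmul, ap_preMul, ap_preMul, ap_preMap, ap_comp,
      ap_comp, ap_assoc_tmul, ap_res, ap_res, ap_whiskerLeft_tmul, ap_preMul, ap_res, ap_preMul,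
      tmul_res_left, tmul_res_right, ap_res, ap_assoc_tmul, res_res, res_res, res_res, res_toPre,
      res_res, Category.assoc, oplax_associativity]
  left_unitality S := tensor_ext fun j s => by
    obtain ⟨j, rfl⟩ := exists_toYo j
    obtain ⟨s, rfl⟩ := exists_toPre F s
    refine (ap_leftUnitor_tmul j (toPre F S s)).trans ?_
    rw [ap_comp, ap_comp, ap_whiskerRight_tmul]
    refine Eq.trans ?_ (congrArg (fun x => ap _ (ap _ (tmul x (toPre F S s)))) (ap_preOne F j).symm)
    rw [ap_preMul, ap_preMap, ap_res, ap_leftUnitor_tmul, res_toPre, res_res]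
    congr 2
    rw [F.map_comp, comp_whiskerRight, Category.assoc, ← Category.assoc (δ F _ _),
      δ_natural_left, Category.assoc, left_unitality_hom]
  right_unitality S := tensor_ext fun s j => by
    obtain ⟨j, rfl⟩ := exists_toYo j
    obtain ⟨s, rfl⟩ := exists_toPre F s
    refine (ap_rightUnitor_tmul (toPre F S s) j).trans ?_
    rw [ap_comp, ap_comp, ap_whiskerLeft_tmul]
    refine Eq.trans ?_ (congrArg (fun x => ap _ (ap _ (tmul (toPre F S s) x))) (ap_preOne F j).symm)
    rw [ap_preMul, ap_preMap, ap_res, ap_rightUnitor_tmul, res_toPre, res_res]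
    congr 2
    rw [F.map_comp, whiskerLeft_comp, Category.assoc, ← Category.assoc (δ F _ _),
      δ_natural_right, Category.assoc, right_unitality_hom]

end

end Psh

namespace Psh

section

variable {V W : Type u} [SmallCategory V] [SmallCategory W] [MonoidalCategory V]
  [MonoidalCategory W] (F : V ⥤ W) [F.OplaxMonoidal]

open Functor.OplaxMonoidal

/-- The Yoneda lemma. -/
theorem yo_hom_ext {X : V} {S : Psh V} {f g : yo X ⟶ S} (h : ap f (toYo (𝟙 X)) = ap g (toYo (𝟙 X))) :
    f = g :=
  hom_ext fun Y p => by
    obtain ⟨p, rfl⟩ := exists_toYo p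
    have h' := congrArg (S.res p) h
    rwa [← ap_res, ← ap_res, yo_res, Category.comp_id] at h'

theorem exists_yo_hom {X : V} {S : Psh V} (s : S.el X) :
    ∃ f : yo X ⟶ S, ap f (toYo (𝟙 X)) = s := by
  have h : ∀ {A B : V} (w : B ⟶ A) (p : (yo X).el A),
      S.res (ofYo ((yo X).res w p)) s = S.res w (S.res (ofYo p) s) := fun w p => by
    rw [ofYo_res, res_res]
  refine ⟨homMk (fun {_} p => S.res (ofYo p) s) h, (ap_homMk _ h _).trans ?_⟩
  rw [ofYo_toYo, res_id]

/-- Precomposition with an opmonoidal functor whose counit `F I ⟶ I` is invertible is normal. -/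
instance [IsIso (η F)] : NormalLax (preFunctor F) where
  bij S := by
    have key : ∀ x : 𝟙_ (Psh W) ⟶ S,
        ap (Functor.LaxMonoidal.ε (preFunctor F) ≫ (preFunctor F).map x) (toYo (𝟙 (𝟙_ V))) =
          toPre F S (S.res (η F) (ap x (toYo (𝟙 (𝟙_ W))))) := fun x => by
      rw [ap_comp]
      refine (congrArg (fun t => ap (preMap F x) t) (ap_preOne F (𝟙 (𝟙_ V)))).trans ?_
      rw [ap_preMap, F.map_id, Category.id_comp, ← ap_res]
      refine congrArg (fun t => toPre F S (ap x t)) ?_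
      exact ((yo_res (𝟙_ W) (η F) (𝟙 (𝟙_ W))).trans
        (congrArg toYo (Category.comp_id (η F)))).symm
    constructor
    · intro x y h
      have h' := congrArg (fun f => ofPre F (S := S) (ap f (toYo (𝟙 (𝟙_ V))))) h
      have h'' := ((congrArg (ofPre F) (key x)).symm.trans h').trans (congrArg (ofPre F) (key y))
      rw [ofPre_toPre, ofPre_toPre] at h''
      refine yo_hom_ext ?_
      have h₃ := congrArg (S.res (inv (η F))) h''
      rwa [res_res, res_res, IsIso.inv_hom_id, res_id, res_id] at h₃
    · intro f
      obtain ⟨s, hs⟩ := exists_toPre F (ap f (toYo (𝟙 (𝟙_ V))))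
      obtain ⟨x, hx⟩ := exists_yo_hom (S.res (inv (η F)) s)
      refine ⟨x, yo_hom_ext ((key x).trans ?_)⟩
      refine Eq.trans ?_ hs.symm
      refine congrArg (toPre F S) ((congrArg (S.res (η F)) hx).trans ?_)
      rw [res_res, IsIso.hom_inv_id, res_id]

end

section

variable (V : Type u) [SmallCategory V] [MonoidalCategory V] [StarMonoidal V] [DuoidalCategory V]

/-- The functor `⋆ : V × V ⥤ V`. -/
@[reducible] def starFunctor : V × V ⥤ V where
  obj X := starObj X.1 X.2
  map f := starHom f.1 f.2
  map_id X := starHom_id X.1 X.2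
  map_comp f g := (starHom_comp f.1 f.2 g.1 g.2).symm

/-- The opmonoidal structure of `⋆ : V × V ⥤ V` given by `ξ` and `μ`. -/
instance : (starFunctor V).OplaxMonoidal where
  η := DuoidalCategory.μ
  δ X Y := DuoidalCategory.ξ X.1 Y.1 X.2 Y.2
  δ_natural_left f X' := (ξ_whiskerRight f.1 f.2).symm
  δ_natural_right X' f := (ξ_whiskerLeft f.1 f.2).symm
  oplax_associativity X Y Z := DuoidalCategory.ξ_assoc X.1 Y.1 Z.1 X.2 Y.2 Z.2
  oplax_left_unitality X := by
    have h := DuoidalCategory.ξ_left_unit X.1 X.2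
    change (λ_ (starObj X.1 X.2)).inv = starHom (λ_ X.1).inv (λ_ X.2).inv ≫ _ ≫ _
    rw [← cancel_mono (λ_ (starObj X.1 X.2)).hom, Iso.inv_hom_id, Category.assoc, Category.assoc]
    refine Eq.symm ((congrArg (starHom (λ_ X.1).inv (λ_ X.2).inv ≫ ·) h).trans ?_)
    rw [starHom_comp, Iso.inv_hom_id, Iso.inv_hom_id, starHom_id]
  oplax_right_unitality X := by
    have h := DuoidalCategory.ξ_right_unit X.1 X.2
    change (ρ_ (starObj X.1 X.2)).inv = starHom (ρ_ X.1).inv (ρ_ X.2).inv ≫ _ ≫ _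
    rw [← cancel_mono (ρ_ (starObj X.1 X.2)).hom, Iso.inv_hom_id, Category.assoc, Category.assoc]
    refine Eq.symm ((congrArg (starHom (ρ_ X.1).inv (ρ_ X.2).inv ≫ ·) h).trans ?_)
    rw [starHom_comp, Iso.inv_hom_id, Iso.inv_hom_id, starHom_id]

end

section

variable (V W : Type u) [SmallCategory V] [SmallCategory W] [MonoidalCategory V]
  [MonoidalCategory W]

/-- The functor `X ↦ (X, I)`. -/
@[reducible] def inLeft : V ⥤ V × W where
  obj X := (X, 𝟙_ W)
  map f := (f, 𝟙 (𝟙_ W))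

/-- The functor `X ↦ (I, X)`. -/
@[reducible] def inRight : W ⥤ V × W where
  obj X := (𝟙_ V, X)
  map f := (𝟙 (𝟙_ V), f)

theorem unit_assoc : (λ_ (𝟙_ V)).inv ≫ ((λ_ (𝟙_ V)).inv ▷ 𝟙_ V) ≫ (α_ (𝟙_ V) (𝟙_ V) (𝟙_ V)).hom =
    𝟙 (𝟙_ V) ≫ (λ_ (𝟙_ V)).inv ≫ (𝟙_ V ◁ (λ_ (𝟙_ V)).inv) := by
  monoidal

theorem id_assoc (X Y Z : V) : 𝟙 ((X ⊗ Y) ⊗ Z) ≫ (𝟙 (X ⊗ Y) ▷ Z) ≫ (α_ X Y Z).hom =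
    (α_ X Y Z).hom ≫ 𝟙 (X ⊗ Y ⊗ Z) ≫ (X ◁ 𝟙 (Y ⊗ Z)) := by
  simp

instance : (inLeft V W).OplaxMonoidal where
  η := 𝟙 _
  δ X Y := (𝟙 (X ⊗ Y), (λ_ (𝟙_ W)).inv)
  oplax_associativity X Y Z := Prod.ext (id_assoc V X Y Z) (unit_assoc W)
  oplax_right_unitality X := Prod.ext (by simp) (by simp [unitors_inv_equal])

instance : (inRight V W).OplaxMonoidal where
  η := 𝟙 _
  δ X Y := ((λ_ (𝟙_ V)).inv, 𝟙 (X ⊗ Y))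
  oplax_associativity X Y Z := Prod.ext (unit_assoc V) (id_assoc W X Y Z)
  oplax_right_unitality X := Prod.ext (by simp [unitors_inv_equal]) (by simp)

instance : IsIso (Functor.OplaxMonoidal.η (inLeft V W)) :=
  inferInstanceAs (IsIso (𝟙 _))

instance : IsIso (Functor.OplaxMonoidal.η (inRight V W)) :=
  inferInstanceAs (IsIso (𝟙 _))

end

end Psh

section

open Psh

variable {V W : Type u} [SmallCategory V] [SmallCategory W] [MonoidalCategory V]
  [MonoidalCategory W]

/-- Bigraded squares in a `(V × W)`-graded category. -/
def LCat.BigradedSquare {C : LCat.{u} (Psh (V × W))} {X : V} {X' : W} {a a' b b' : C.ob}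
    (f : (C.hom a a').el (X, 𝟙_ W)) (g : (C.hom b b').el (X, 𝟙_ W))
    (φ : (C.hom a b).el (𝟙_ V, X')) (φ' : (C.hom a' b').el (𝟙_ V, X')) : Prop :=
  (C.hom a b').res (X := (X, 𝟙_ W) ⊗ (𝟙_ V, X')) (Y := (X, X'))
      ((ρ_ X).inv, (λ_ X').inv) (gcomp g φ) =
    (C.hom a b').res (X := (𝟙_ V, X') ⊗ (X, 𝟙_ W)) (Y := (X, X'))
      ((λ_ X).inv, (ρ_ X').inv) (gcomp φ' f)

theorem Psh.ofPre_ap_preMap (F : V ⥤ W) {S T : Psh W} (f : S ⟶ T) {X : V} (s : (pre F S).el X) :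
    ofPre F (ap (preMap F f) s) = ap f (ofPre F s) := by
  obtain ⟨s, rfl⟩ := exists_toPre F s
  rw [ap_preMap, ofPre_toPre, ofPre_toPre]

theorem LCat.ofPre_hom0_el (F : V ⥤ W) [F.OplaxMonoidal] {C : LCat.{u} (Psh W)} {a b : C.ob}
    (x : C.Und a b) : ofPre F (Und.el (hom0 (preFunctor F) x)) =
      (C.hom a b).res (Functor.OplaxMonoidal.η F) (Und.el x) := by
  refine (congrArg (ofPre F) (ap_comp _ _ _)).trans ?_
  refine (congrArg (fun t => ofPre F (ap (preMap F x) t)) (ap_preOne F (𝟙 (𝟙_ V)))).trans ?_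
  rw [ap_preMap, ofPre_toPre, F.map_id, Category.id_comp, Und.el, ← ap_res]
  refine congrArg (fun t => ap x t) ?_
  exact ((yo_res (𝟙_ W) (Functor.OplaxMonoidal.η F) (𝟙 (𝟙_ W))).trans
    (congrArg toYo (Category.comp_id (Functor.OplaxMonoidal.η F)))).symm

namespace BiSesq

variable {A A' : LCat.{u} (Psh V)} {B B' : LCat.{u} (Psh W)} {C C' : LCat.{u} (Psh (V × W))}

/-- Graded bifunctors from a `V`-graded category and a `W`-graded category to a
`(V × W)`-graded category. -/
def IsGradedBifunctor
    (F : BiSesq (preFunctor (inLeft V W)) (preFunctor (inRight V W)) A B C) : Prop :=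
  ∀ (a a' : A.ob) (b b' : B.ob) (X : V) (X' : W) (f : (A.hom a a').el X) (g : (B.hom b b').el X'),
    LCat.BigradedSquare (ofPre (inLeft V W) (ap (F.mapL a a' b) f))
      (ofPre (inLeft V W) (ap (F.mapL a a' b') f)) (ofPre (inRight V W) (ap (F.mapR a b b') g))
      (ofPre (inRight V W) (ap (F.mapR a' b b') g))

variable {F : BiSesq (preFunctor (inLeft V W)) (preFunctor (inRight V W)) A B C}

theorem IsGradedBifunctor.act (hF : F.IsGradedBifunctor) (P : LFunctor A' A) (Q : LFunctor B' B)
    (S : LFunctor C C') : (act P Q S F).IsGradedBifunctor :=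
  fun a a' b b' X X' f g => by
    have h := congrArg (ap (S.map _ _)) (hF _ _ _ _ X X' (ap (P.map a a') f) (ap (Q.map b b') g))
    rw [ap_res, ap_res, LCat.map_gcomp, LCat.map_gcomp] at h
    simp only [LCat.BigradedSquare, ap_comp, ofPre_ap_preMap]
    exact h

theorem el_onR (a : A.ob) {b b' : B.ob} (y : B.Und b b') :
    LCat.Und.el (F.onR a y) = ofPre (inRight V W) (ap (F.mapR a b b') (LCat.Und.el y)) := by
  have h := LCat.ofPre_hom0_el (inRight V W) (F.onR a y)
  rw [hom0_onR] at h
  refine ((congrArg _ (ap_comp _ _ _)).symm.trans (h.trans ?_)).symm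
  exact res_id _ _

theorem el_onL {a a' : A.ob} (x : A.Und a a') (b : B.ob) :
    LCat.Und.el (F.onL x b) = ofPre (inLeft V W) (ap (F.mapL a a' b) (LCat.Und.el x)) := by
  have h := LCat.ofPre_hom0_el (inLeft V W) (F.onL x b)
  rw [hom0_onL] at h
  refine ((congrArg _ (ap_comp _ _ _)).symm.trans (h.trans ?_)).symm
  exact res_id _ _

theorem ofPre_inj (G : V ⥤ W) {S : Psh W} {X : V} {s t : (pre G S).el X}
    (h : ofPre G s = ofPre G t) : s = t := by
  obtain ⟨s, rfl⟩ := exists_toPre G s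
  obtain ⟨t, rfl⟩ := exists_toPre G t
  rw [ofPre_toPre, ofPre_toPre] at h
  rw [h]

theorem IsGradedBifunctor.central (hF : F.IsGradedBifunctor) : F.Central where
  natL {b b'} y a a' := Psh.hom_ext fun X f => ofPre_inj _ (by
    have h := hF a a' b b' X (𝟙_ W) f (LCat.Und.el y)
    rw [LCat.BigradedSquare, ← el_onR, ← el_onR] at h
    rw [ap_comp, ap_comp, LCat.post_hom0, LCat.pre_hom0, ofPre_ap_preMap, ofPre_ap_preMap,
      LCat.ap_post, LCat.ap_pre]
    have e : (λ_ (𝟙_ W)).inv = (ρ_ (𝟙_ W)).inv := unitors_inv_equal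
    exact (congrArg (fun z => (C.hom _ _).res (X := (𝟙_ V, 𝟙_ W) ⊗ (X, 𝟙_ W)) (Y := (X, 𝟙_ W))
      ((λ_ X).inv, z) (LCat.gcomp _ _)) e).trans (h.symm.trans (congrArg (fun z =>
        (C.hom _ _).res (X := (X, 𝟙_ W) ⊗ (𝟙_ V, 𝟙_ W)) (Y := (X, 𝟙_ W))
          ((ρ_ X).inv, z) (LCat.gcomp _ _)) e)))
  natR {a a'} x b b' := Psh.hom_ext fun X g => ofPre_inj _ (by
    have h := hF a a' b b' (𝟙_ V) X (LCat.Und.el x) g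
    rw [LCat.BigradedSquare, ← el_onL, ← el_onL] at h
    rw [ap_comp, ap_comp, LCat.post_hom0, LCat.pre_hom0, ofPre_ap_preMap, ofPre_ap_preMap,
      LCat.ap_post, LCat.ap_pre]
    have e : (λ_ (𝟙_ V)).inv = (ρ_ (𝟙_ V)).inv := unitors_inv_equal
    exact (congrArg (fun z => (C.hom _ _).res (X := (𝟙_ V, 𝟙_ W) ⊗ (𝟙_ V, X)) (Y := (𝟙_ V, X))
      (z, (λ_ X).inv) (LCat.gcomp _ _)) e).trans (h.trans (congrArg (fun z =>
        (C.hom _ _).res (X := (𝟙_ V, X) ⊗ (𝟙_ V, 𝟙_ W)) (Y := (𝟙_ V, X))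
          (z, (ρ_ X).inv) (LCat.gcomp _ _)) e)))

end BiSesq

/-- The 2-functor `GBif` of graded bifunctors valued in `(V × W)`-graded categories. -/
noncomputable def gBif (V W : Type u) [SmallCategory V] [SmallCategory W] [MonoidalCategory V]
    [MonoidalCategory W] :
    TriFunctor.{u} (LCat.{u} (Psh V)) (LCat.{u} (Psh W)) (LCat.{u} (Psh (V × W))) :=
  BiSesq.triFunctor (L := preFunctor (inLeft V W)) (R := preFunctor (inRight V W))
    BiSesq.IsGradedBifunctor (fun h => h.central) (fun P Q S _ h => h.act P Q S)

end

/-- Change of base of pairs of families of functors. -/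
def Sesq.baseFunctor {W : Type v₁} [Category.{u} W] [MonoidalCategory W] {W' : Type v₂}
    [Category.{u} W'] [MonoidalCategory W'] (Φ : W ⥤ W') [Φ.LaxMonoidal] (A B C : LCat.{u} W) :
    Sesq A B C ⥤ Sesq (LCat.baseObj Φ A) (LCat.baseObj Φ B) (LCat.baseObj Φ C) where
  obj F :=
    { obj := F.obj
      mapL := fun a a' b => Φ.map (F.mapL a a' b)
      mapR := fun a b b' => Φ.map (F.mapR a b b')
      mapL_one := fun a b => (LCat.baseMap Φ (F.left b)).map_one a
      mapL_comp := fun a a' a'' b => (LCat.baseMap Φ (F.left b)).map_comp a a' a''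
      mapR_one := fun a b => (LCat.baseMap Φ (F.right a)).map_one b
      mapR_comp := fun a b b' b'' => (LCat.baseMap Φ (F.right a)).map_comp b b' b'' }
  map θ :=
    { app := fun a b => LCat.hom0 Φ (Sesq.Trans.app θ a b)
      natL := fun a a' b => (LCat.baseMap₂ Φ (Sesq.Trans.left θ b)).naturality a a'
      natR := fun a b b' => (LCat.baseMap₂ Φ (Sesq.Trans.right θ a)).naturality b b' }
  map_id F := Sesq.hom_ext fun a b => LCat.hom0_one Φ _ _
  map_comp θ κ := Sesq.hom_ext fun a b => LCat.hom0_ucomp Φ _ _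

namespace Psh

open DuoidalCategory

section

variable {V : Type v} [Category.{w} V] [MonoidalCategory V] [StarMonoidal V] [DuoidalCategory V]
  [NormalDuoidal V]

theorem γ_ν : γ ≫ (ν (V := V) ⊗ₘ ν) = ν ≫ (λ_ (𝟙_ V)).inv := by
  have h := γ_left_counit (V := V)
  have h' : γ ≫ (ν (V := V) ▷ starUnit V) = (λ_ _).inv := by
    rw [← cancel_mono (λ_ (starUnit V)).hom, Category.assoc, h, Iso.inv_hom_id]
  rw [MonoidalCategory.tensorHom_def, ← Category.assoc, h', leftUnitor_inv_naturality]

theorem inv_ν_γ : inv (ν (V := V)) ≫ γ = (λ_ (𝟙_ V)).inv ≫ (inv ν ⊗ₘ inv ν) := by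
  rw [IsIso.inv_comp_eq, ← Category.assoc, ← γ_ν, Category.assoc, tensorHom_comp_tensorHom,
    IsIso.hom_inv_id, id_tensorHom_id, Category.comp_id]

theorem duoR_tensor (X Y : V) : starHom (𝟙 (X ⊗ Y)) (λ_ (𝟙_ V)).inv ≫ ξ X Y (𝟙_ V) (𝟙_ V) ≫
    (duoR X ⊗ₘ duoR Y) = duoR (X ⊗ Y) := by
  have h := ξ_natural (𝟙 X) (𝟙 Y) (inv (ν (V := V))) (inv ν)
  rw [id_tensorHom_id] at h
  rw [duoR, duoR, duoR, ← tensorHom_comp_tensorHom, ← Category.assoc (ξ _ _ _ _), ← h,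
    Category.assoc, starHom_comp_assoc, Category.comp_id, ← inv_ν_γ, ← ξ_star_right_unit,
    starHom_comp_assoc, Category.comp_id]

theorem duoL_tensor (X Y : V) : starHom (λ_ (𝟙_ V)).inv (𝟙 (X ⊗ Y)) ≫ ξ (𝟙_ V) (𝟙_ V) X Y ≫
    (duoL X ⊗ₘ duoL Y) = duoL (X ⊗ Y) := by
  have h := ξ_natural (inv (ν (V := V))) (inv ν) (𝟙 X) (𝟙 Y)
  rw [id_tensorHom_id] at h
  rw [duoL, duoL, duoL, ← tensorHom_comp_tensorHom, ← Category.assoc (ξ _ _ _ _), ← h,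
    Category.assoc, starHom_comp_assoc, Category.comp_id, ← inv_ν_γ, ← ξ_star_left_unit,
    starHom_comp_assoc, Category.comp_id]

end

variable {V : Type u} [SmallCategory V] [MonoidalCategory V] [StarMonoidal V] [DuoidalCategory V]
  [NormalDuoidal V]

theorem toLeft_res {S : Psh V} {X Y : V} (w : Y ⟶ X) (s : S.el X) :
    toPre (inLeft V V) (pre (starFunctor V) S) (toPre (starFunctor V) (X := (inLeft V V).obj Y) S
        (S.res (duoR Y) (S.res w s))) =
      (pre (inLeft V V) (pre (starFunctor V) S)).res w (toPre (inLeft V V) (pre (starFunctor V) S)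
        (toPre (starFunctor V) (X := (inLeft V V).obj X) S (S.res (duoR X) s))) := by
  rw [res_toPre, res_toPre, res_res, res_res, ← duoR_naturality]

/-- Reindexing along the unitors `X ⋆ I ⟶ X`. -/
noncomputable def toLeft (S : Psh V) : S ⟶ pre (inLeft V V) (pre (starFunctor V) S) :=
  homMk (fun {X} s => toPre (inLeft V V) (pre (starFunctor V) S)
    (toPre (starFunctor V) (X := (inLeft V V).obj X) S (S.res (duoR X) s))) toLeft_res

theorem ap_toLeft {S : Psh V} {X : V} (s : S.el X) :
    ap (toLeft S) s = toPre (inLeft V V) (pre (starFunctor V) S)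
      (toPre (starFunctor V) (X := (inLeft V V).obj X) S (S.res (duoR X) s)) :=
  ap_homMk _ toLeft_res s

theorem toLeft_naturality {S T : Psh V} (f : S ⟶ T) :
    f ≫ toLeft T = toLeft S ≫
      (preFunctor (inLeft V V)).map ((preFunctor (starFunctor V)).map f) :=
  hom_ext fun X s => by
    rw [ap_comp, ap_comp, ap_toLeft, ap_toLeft]
    refine Eq.symm ((ap_preMap _ _ _).trans ?_)
    rw [ap_preMap, ap_res]

open Functor.LaxMonoidal in
theorem toLeft_unit : toLeft (𝟙_ (Psh V)) = ε (preFunctor (inLeft V V)) ≫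
    (preFunctor (inLeft V V)).map (ε (preFunctor (starFunctor V))) :=
  hom_ext fun X j => by
    obtain ⟨j, rfl⟩ := exists_toYo j
    rw [ap_comp]
    refine (ap_toLeft _).trans (Eq.symm ?_)
    refine (congrArg (fun t => ap _ t) (ap_preOne (inLeft V V) j)).trans ?_
    refine (ap_preMap _ _ _).trans (congrArg (toPre (inLeft V V) _) ?_)
    refine (ap_preOne (starFunctor V) _).trans (congrArg (toPre (starFunctor V) _) ?_)
    refine Eq.trans ?_ (yo_res (𝟙_ V) (duoR X) j).symm
    refine congrArg toYo ?_
    rw [← duoR_naturality, duoR_unit]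
    change starHom (_ ≫ _) (_ ≫ _) ≫ μ = _
    erw [Category.comp_id, Category.comp_id]

open Functor.LaxMonoidal in
theorem toLeft_tensor (S T : Psh V) : toLeft (S ⊗ T) =
    (toLeft S ⊗ₘ toLeft T) ≫ μ (preFunctor (inLeft V V)) _ _ ≫
      (preFunctor (inLeft V V)).map (μ (preFunctor (starFunctor V)) S T) :=
  tensor_ext fun {X Y} s t => by
    rw [ap_toLeft, ap_comp, ap_comp, ap_tmul, ap_toLeft, ap_toLeft]
    refine Eq.symm ((congrArg (fun t => ap _ t) (ap_preMul (inLeft V V) _ _)).trans ?_)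
    refine (ap_preMap _ _ _).trans (congrArg (toPre (inLeft V V) _) ?_)
    rw [ap_res]
    refine (congrArg _ (ap_preMul (starFunctor V) _ _)).trans ?_
    rw [res_toPre, tmul_res, res_res, res_res, ← duoR_tensor, Category.assoc]
    rfl

end Psh

namespace LCat

open Psh

variable {V : Type u} [SmallCategory V] [MonoidalCategory V] [StarMonoidal V] [DuoidalCategory V]
  [NormalDuoidal V]

theorem und_toLeft {C : LCat.{u} (Psh V)} {a b : C.ob} (x : C.Und a b) :
    x ≫ toLeft (C.hom a b) = hom0 (preFunctor (inLeft V V))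
      (C := baseObj (preFunctor (starFunctor V)) C) (hom0 (preFunctor (starFunctor V)) x) := by
  rw [toLeft_naturality, toLeft_unit, Category.assoc, ← (preFunctor (inLeft V V)).map_comp]
  rfl

/-- The functor `C ⟶ U_ℓ^* C_⋆` which is the identity on objects and reindexes along
`X ⋆ I ⟶ X`. -/
@[reducible] noncomputable def intoLeft (C : LCat.{u} (Psh V)) : LFunctor C
    (baseObj (preFunctor (inLeft V V)) (baseObj (preFunctor (starFunctor V)) C)) where
  obj a := a
  map a b := toLeft (C.hom a b)
  map_one a := und_toLeft (C.one a)
  map_comp a b c := by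
    rw [toLeft_naturality, toLeft_tensor, Category.assoc, Category.assoc,
      ← (preFunctor (inLeft V V)).map_comp]

end LCat

namespace Psh

open DuoidalCategory

variable {V : Type u} [SmallCategory V] [MonoidalCategory V] [StarMonoidal V] [DuoidalCategory V]
  [NormalDuoidal V]

theorem toRight_res {S : Psh V} {X Y : V} (w : Y ⟶ X) (s : S.el X) :
    toPre (inRight V V) (pre (starFunctor V) S) (toPre (starFunctor V) (X := (inRight V V).obj Y) S
        (S.res (duoL Y) (S.res w s))) =
      (pre (inRight V V) (pre (starFunctor V) S)).res w (toPre (inRight V V) (pre (starFunctor V) S)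
        (toPre (starFunctor V) (X := (inRight V V).obj X) S (S.res (duoL X) s))) := by
  rw [res_toPre, res_toPre, res_res, res_res, ← duoL_naturality]

/-- Reindexing along the unitors `I ⋆ X ⟶ X`. -/
noncomputable def toRight (S : Psh V) : S ⟶ pre (inRight V V) (pre (starFunctor V) S) :=
  homMk (fun {X} s => toPre (inRight V V) (pre (starFunctor V) S)
    (toPre (starFunctor V) (X := (inRight V V).obj X) S (S.res (duoL X) s))) toRight_res

theorem ap_toRight {S : Psh V} {X : V} (s : S.el X) :
    ap (toRight S) s = toPre (inRight V V) (pre (starFunctor V) S)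
      (toPre (starFunctor V) (X := (inRight V V).obj X) S (S.res (duoL X) s)) :=
  ap_homMk _ toRight_res s

theorem toRight_naturality {S T : Psh V} (f : S ⟶ T) :
    f ≫ toRight T = toRight S ≫
      (preFunctor (inRight V V)).map ((preFunctor (starFunctor V)).map f) :=
  hom_ext fun X s => by
    rw [ap_comp, ap_comp, ap_toRight, ap_toRight]
    refine Eq.symm ((ap_preMap _ _ _).trans ?_)
    rw [ap_preMap, ap_res]

open Functor.LaxMonoidal in
theorem toRight_unit : toRight (𝟙_ (Psh V)) = ε (preFunctor (inRight V V)) ≫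
    (preFunctor (inRight V V)).map (ε (preFunctor (starFunctor V))) :=
  hom_ext fun X j => by
    obtain ⟨j, rfl⟩ := exists_toYo j
    rw [ap_comp]
    refine (ap_toRight _).trans (Eq.symm ?_)
    refine (congrArg (fun t => ap _ t) (ap_preOne (inRight V V) j)).trans ?_
    refine (ap_preMap _ _ _).trans (congrArg (toPre (inRight V V) _) ?_)
    refine (ap_preOne (starFunctor V) _).trans (congrArg (toPre (starFunctor V) _) ?_)
    refine Eq.trans ?_ (yo_res (𝟙_ V) (duoL X) j).symm
    refine congrArg toYo ?_
    rw [← duoL_naturality, duoL_unit]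
    change starHom (_ ≫ _) (_ ≫ _) ≫ μ = _
    erw [Category.comp_id, Category.comp_id]

open Functor.LaxMonoidal in
theorem toRight_tensor (S T : Psh V) : toRight (S ⊗ T) =
    (toRight S ⊗ₘ toRight T) ≫ μ (preFunctor (inRight V V)) _ _ ≫
      (preFunctor (inRight V V)).map (μ (preFunctor (starFunctor V)) S T) :=
  tensor_ext fun {X Y} s t => by
    rw [ap_toRight, ap_comp, ap_comp, ap_tmul, ap_toRight, ap_toRight]
    refine Eq.symm ((congrArg (fun t => ap _ t) (ap_preMul (inRight V V) _ _)).trans ?_)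
    refine (ap_preMap _ _ _).trans (congrArg (toPre (inRight V V) _) ?_)
    rw [ap_res]
    refine (congrArg _ (ap_preMul (starFunctor V) _ _)).trans ?_
    rw [res_toPre, tmul_res, res_res, res_res, ← duoL_tensor, Category.assoc]
    rfl

end Psh

namespace LCat

open Psh

variable {V : Type u} [SmallCategory V] [MonoidalCategory V] [StarMonoidal V] [DuoidalCategory V]
  [NormalDuoidal V]

theorem und_toRight {C : LCat.{u} (Psh V)} {a b : C.ob} (x : C.Und a b) :
    x ≫ toRight (C.hom a b) = hom0 (preFunctor (inRight V V))
      (C := baseObj (preFunctor (starFunctor V)) C) (hom0 (preFunctor (starFunctor V)) x) := by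
  rw [toRight_naturality, toRight_unit, Category.assoc, ← (preFunctor (inRight V V)).map_comp]
  rfl

/-- The functor `C ⟶ U_r^* C_⋆` which is the identity on objects and reindexes along
`I ⋆ X ⟶ X`. -/
@[reducible] noncomputable def intoRight (C : LCat.{u} (Psh V)) : LFunctor C
    (baseObj (preFunctor (inRight V V)) (baseObj (preFunctor (starFunctor V)) C)) where
  obj a := a
  map a b := toRight (C.hom a b)
  map_one a := und_toRight (C.one a)
  map_comp a b c := by
    rw [toRight_naturality, toRight_tensor, Category.assoc, Category.assoc,
      ← (preFunctor (inRight V V)).map_comp]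

end LCat

section

open Psh

variable {V : Type u} [SmallCategory V] [MonoidalCategory V] [StarMonoidal V] [DuoidalCategory V]
  [NormalDuoidal V]

/-- Postcomposition with the isomorphisms `C ≅ U_ℓ^* C_⋆` and `C ≅ U_r^* C_⋆`. -/
noncomputable def Sesq.starFunctor (A B C : LCat.{u} (Psh V)) :
    Sesq A B C ⥤ BiSesq (preFunctor (inLeft V V)) (preFunctor (inRight V V)) A B
      (LCat.baseObj (preFunctor (Psh.starFunctor V)) C) where
  obj F :=
    { obj := F.obj
      mapL := fun a a' b => F.mapL a a' b ≫ toLeft _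
      mapR := fun a b b' => F.mapR a b b' ≫ toRight _
      mapL_one := fun a b => ((F.left b).comp (LCat.intoLeft C)).map_one a
      mapL_comp := fun a a' a'' b => ((F.left b).comp (LCat.intoLeft C)).map_comp a a' a''
      mapR_one := fun a b => ((F.right a).comp (LCat.intoRight C)).map_one b
      mapR_comp := fun a b b' b'' => ((F.right a).comp (LCat.intoRight C)).map_comp b b' b'' }
  map {F G} θ :=
    { app := fun a b => LCat.hom0 (preFunctor (Psh.starFunctor V)) (Sesq.Trans.app θ a b)
      natL := fun a a' b => by
        have h := (LNatTrans.whiskerRight (Sesq.Trans.left θ b) (LCat.intoLeft C)).naturality a a'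
        have e : ∀ a, LNatTrans.app (LNatTrans.whiskerRight (Sesq.Trans.left θ b) (LCat.intoLeft C)) a =
            LCat.hom0 (preFunctor (inLeft V V)) (LCat.hom0 (preFunctor (Psh.starFunctor V))
              (Sesq.Trans.app θ a b)) := fun a => LCat.und_toLeft _
        rw [e, e] at h
        exact h
      natR := fun a b b' => by
        have h := (LNatTrans.whiskerRight (Sesq.Trans.right θ a) (LCat.intoRight C)).naturality b b'
        have e : ∀ b, LNatTrans.app (LNatTrans.whiskerRight (Sesq.Trans.right θ a) (LCat.intoRight C)) b =
            LCat.hom0 (preFunctor (inRight V V)) (LCat.hom0 (preFunctor (Psh.starFunctor V))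
              (Sesq.Trans.app θ a b)) := fun b => LCat.und_toRight _
        rw [e, e] at h
        exact h }
  map_id F := BiSesq.hom_ext fun a b => LCat.hom0_one _ _ _
  map_comp θ κ := BiSesq.hom_ext fun a b => LCat.hom0_ucomp _ _ _

end

/-- The inclusion of enriched bifunctors into pairs of families of functors. -/
noncomputable def enrBif.incl {W : Type v} [Category.{u} W] [MonoidalCategory W] [StarMonoidal W]
    [DuoidalCategory W] [NormalDuoidal W] (A B C : LCat.{u} W) :
    (enrBif W).obj A B C ⥤ Sesq A B C :=
  ObjectProperty.ι (C := Sesq A B C) (fun F => F.IsEnrichedBifunctor)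

/-- The inclusion of `V`-graded bifunctors into pairs of families of functors. -/
noncomputable def grBif.incl {V : Type u} [SmallCategory V] [MonoidalCategory V] [StarMonoidal V]
    [DuoidalCategory V] [NormalDuoidal V] (A B C : LCat.{u} (Psh V)) :
    (grBif V).obj A B C ⥤ Sesq A B C :=
  ObjectProperty.ι (C := Sesq A B C) (fun F => F.IsGradedBifunctor)

/-- The inclusion of graded bifunctors into pairs of families of functors. -/
noncomputable def gBif.incl {V W : Type u} [SmallCategory V] [SmallCategory W] [MonoidalCategory V]
    [MonoidalCategory W] (A : LCat.{u} (Psh V)) (B : LCat.{u} (Psh W))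
    (C : LCat.{u} (Psh (V × W))) :
    (gBif V W).obj A B C ⥤
      BiSesq (Psh.preFunctor (Psh.inLeft V W)) (Psh.preFunctor (Psh.inRight V W)) A B C :=
  ObjectProperty.ι (C := BiSesq (Psh.preFunctor (Psh.inLeft V W))
    (Psh.preFunctor (Psh.inRight V W)) A B C) (fun F => F.IsGradedBifunctor)

/-- The 2-functor regarding `V`-categories as `V`-graded categories. -/
def LCat.yonedaBase (V : Type u) [SmallCategory V] [MonoidalCategory V] :
    StrictPseudofunctor (LCat.{u} V) (LCat.{u} (Psh V)) :=
  LCat.changeBase (Psh.yonedaFunctor V)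

/-- The 2-functor `C ↦ C_⋆` from `V`-graded categories to `(V × V)`-graded categories. -/
def LCat.starBase (V : Type u) [SmallCategory V] [MonoidalCategory V] [StarMonoidal V]
    [DuoidalCategory V] : StrictPseudofunctor (LCat.{u} (Psh V)) (LCat.{u} (Psh (V × V))) :=
  LCat.changeBase (Psh.preFunctor (Psh.starFunctor V))

/-! All three notions of bifunctor have the same shape: a pair of families of functors agreeing on
objects, subject to one square equation for each pair of hom objects. Morphisms do not see that
equation, so each category of bifunctors is a full subcategory of a category `Sesq` or `BiSesq` of
pairs of families. To compare two notions it therefore suffices to compare the pairs of families by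
an invertible functor, and to show that the two square equations correspond.

Part 2 rests on the fact that a Day convolution `P ⋆ Q` is generated under reindexing by its pure
elements `smul p q`. The Day structure on presheaves is given on such generators by the formulas of
`V`, so the `σ` and `τ` of presheaves act on them as reindexing along the `σ` and `τ` of `V`
(`ap_duoSigma`, `ap_duoTau`). An enriched square over presheaves is an equality of two morphisms out
of a convolution. Testing it on generators gives exactly the graded squares
(`enrichedSquare_iff_gradedSquare`). The two predicates are equivalent on the same pairs of
families, so the 2-functors are equal and not merely isomorphic.

The first isomorphism of part 1 is the Yoneda lemma. The Yoneda embedding is fully faithful,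
preserves the unit on the nose, and has epimorphic comparison maps `yo X ⊗ yo Y ⟶ yo (X ⊗ Y)`. Hence
change of base along it loses nothing about functors, transformations or underlying morphisms
(`changeBaseIso`). A graded square between representables is stable under reindexing, so it needs to
be tested only on the two identity elements, where it is the enriched square
(`enrichedSquare_iff_yoneda`).

The second isomorphism uses normality. The unitors `ρ : X ⋆ I ⟶ X` and `λ : I ⋆ X ⟶ X` are
invertible, so `C` is isomorphic to both `U_ℓ^* C_⋆` and `U_r^* C_⋆`. In particular `μ`, which is
`ρ` at the unit, is invertible, so that `C` and `C_⋆` have the same underlying category. Composition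
in `C_⋆` is composition in `C` reindexed along `ξ`. Surrounding `ξ` by the unitors that occur in the
bigraded square yields precisely `σ` and `τ`, so both squares are the same equation
(`gradedSquare_iff_bigradedSquare`).

Strict 2-naturality costs little: object assignments never change, the maps on hom objects are
functorial or natural, and the passage to underlying morphisms `hom0` preserves composition. The
components of all 2-cells thus agree on the nose. -/

namespace Psh

/-! ### The morphisms `σ` and `τ` of the Day convolutions, computed on generators. -/

open DuoidalCategory

variable {V : Type u} [SmallCategory V] [MonoidalCategory V] [StarMonoidal V] [DuoidalCategory V]

/-- The element of the Day convolution `P ⋆ Q` given by a pair of elements. -/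
def smul {P Q : Psh V} {X Y : V} (p : P.el X) (q : Q.el Y) : (starObj P Q).el (starObj X Y) :=
  Day.kap (starM V) p q

/-- Every element of a convolution is a reindexing of a generator, and morphisms of presheaves
commute with reindexing. -/
theorem star_ext {P Q S : Psh V} {f g : starObj P Q ⟶ S}
    (h : ∀ {Y Z : V} (p : P.el Y) (q : Q.el Z), ap f (smul p q) = ap g (smul p q)) : f = g :=
  Day.conv_ext h

theorem ap_smul {P Q P' Q' : Psh V} (f : P ⟶ P') (g : Q ⟶ Q') {X Y : V} (p : P.el X)
    (q : Q.el Y) : ap (starHom f g) (smul p q) = smul (ap f p) (ap g q) :=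
  Day.map_kap _ f g p q

theorem smul_res {P Q : Psh V} {X Y X' Y' : V} (f : X ⟶ X') (g : Y ⟶ Y') (p : P.el X')
    (q : Q.el Y') : smul (P.res f p) (Q.res g q) = (starObj P Q).res (starHom f g) (smul p q) :=
  Day.kap_res f g p q

theorem ap_ξ {P Q P' Q' : Psh V} {X Y X' Y' : V} (p : P.el X) (q : Q.el Y)
    (p' : P'.el X') (q' : Q'.el Y') : ap (ξ P Q P' Q') (smul (tmul p q) (tmul p' q')) =
      (starObj P P' ⊗ starObj Q Q').res (ξ X Y X' Y') (tmul (smul p p') (smul q q')) :=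
  Day.xi_kap p q p' q'

variable [NormalDuoidal V]

/-- The `ν` of presheaves is the Yoneda image of that of `V`, and inverses are unique. This makes
the unitors `duoR` and `duoL` of presheaves, which are defined through the inverse of `ν`,
computable on elements. -/
theorem inv_ν : inv (ν (V := Psh V)) = Day.yoMap (inv (ν (V := V))) := by
  refine IsIso.inv_eq_of_hom_inv_id (hom_ext fun _ p => ?_)
  obtain ⟨p, rfl⟩ := exists_toYo p
  refine (ap_comp _ _ _).trans ((congrArg _ (Day.yoMap_toYo _ _)).trans ?_)
  rw [Day.yoMap_toYo, Category.assoc, IsIso.hom_inv_id, Category.comp_id, ap_id]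

/-- The inverse of `ν` sends the identity of `I` to the element `inv ν : I ⟶ J` of the representable
on `J`. The Day right unitor then reindexes `p` along `X ⋆ inv ν` followed by the unitor at `J`,
which is the definition of `duoR X`. -/
theorem ap_duoR {P : Psh V} {X : V} (p : P.el X) :
    ap (duoR P) (smul (Q := 𝟙_ (Psh V)) p (toYo (𝟙 (𝟙_ V)))) = P.res (duoR X) p := by
  rw [duoR, ap_comp, ap_smul, inv_ν, ap_id]
  refine (congrArg (fun t => ap _ (smul p t)) (Day.yoMap_toYo _ _)).trans ?_
  refine (Day.rightUnitor_kap (starM V) P p _).trans ?_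
  rw [Category.id_comp, star_whiskerLeft]
  rfl

theorem ap_duoL {P : Psh V} {X : V} (p : P.el X) :
    ap (duoL P) (smul (P := 𝟙_ (Psh V)) (toYo (𝟙 (𝟙_ V))) p) = P.res (duoL X) p := by
  rw [duoL, ap_comp, ap_smul, inv_ν, ap_id]
  refine (congrArg (fun t => ap _ (smul t p)) (Day.yoMap_toYo _ _)).trans ?_
  refine (Day.leftUnitor_kap (starM V) P _ p).trans ?_
  rw [Category.id_comp, star_whiskerRight]
  rfl

/-- The inverse unitors of `⊗` insert the identity of `I` as a second factor, the interchange
regroups the four generators, and the unitors of `⋆` absorb the identities again. Each move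
contributes one reindexing, and these compose to the three factors of `σ` in `V`. -/
theorem ap_duoSigma {P Q : Psh V} {X Y : V} (p : P.el X) (q : Q.el Y) :
    ap (duoSigma P Q) (smul p q) = (P ⊗ Q).res (duoSigma X Y) (tmul p q) := by
  rw [duoSigma, ap_comp, ap_comp, ap_smul, ap_rightUnitor_inv, ap_leftUnitor_inv, smul_res, ap_res,
    ap_ξ, ap_res, ap_res, ap_tmul, ap_duoR, ap_duoL, tmul_res, res_res, res_res, duoSigma,
    Category.assoc]

/-- As for `ap_duoSigma`, with the identities of `I` inserted on the opposite sides, so that `p` and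
`q` come out in exchanged order. -/
theorem ap_duoTau {P Q : Psh V} {X Y : V} (p : P.el X) (q : Q.el Y) :
    ap (duoTau P Q) (smul p q) = (Q ⊗ P).res (duoTau X Y) (tmul q p) := by
  rw [duoTau, ap_comp, ap_comp, ap_smul, ap_rightUnitor_inv, ap_leftUnitor_inv, smul_res, ap_res,
    ap_ξ, ap_res, ap_res, ap_tmul, ap_duoR, ap_duoL, tmul_res, res_res, res_res, duoTau,
    Category.assoc]

end Psh

/-! ### Enriched squares compared with graded squares. -/

section

open Psh

variable {V : Type u} [SmallCategory V] [MonoidalCategory V] [StarMonoidal V] [DuoidalCategory V]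
  [NormalDuoidal V]

/-- The enriched square equates two morphisms out of `P ⋆ Q`, hence may be tested on the generators
`smul p q`; its value there is the graded square for the images of `p` and `q`. -/
theorem LCat.enrichedSquare_iff_gradedSquare {C : LCat.{u} (Psh V)} {P Q : Psh V}
    {a a' b b' : C.ob} (f : P ⟶ C.hom a a') (g : P ⟶ C.hom b b') (φ : Q ⟶ C.hom a b)
    (φ' : Q ⟶ C.hom a' b') : EnrichedSquare f g φ φ' ↔
      ∀ (X X' : V) (p : P.el X) (q : Q.el X'),
        GradedSquare (ap f p) (ap g p) (ap φ q) (ap φ' q) := by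
  -- The two legs of the enriched square, evaluated on a generator, are the two sides of the graded
  -- square.
  have h₁ : ∀ {X X' : V} (p : P.el X) (q : Q.el X'),
      ap (duoSigma P Q ≫ (g ⊗ₘ φ) ≫ C.comp a b b') (smul p q) =
        (C.hom a b').res (duoSigma X X') (gcomp (ap g p) (ap φ q)) := fun p q => by
    rw [ap_comp, ap_comp, ap_duoSigma, ap_res, ap_res, ap_tmul, gcomp]
  have h₂ : ∀ {X X' : V} (p : P.el X) (q : Q.el X'),
      ap (duoTau P Q ≫ (φ' ⊗ₘ f) ≫ C.comp a a' b') (smul p q) =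
        (C.hom a b').res (duoTau X X') (gcomp (ap φ' q) (ap f p)) := fun p q => by
    rw [ap_comp, ap_comp, ap_duoTau, ap_res, ap_res, ap_tmul, gcomp]
  constructor
  · intro h X X' p q
    rw [GradedSquare, ← h₁, ← h₂, h]
  · intro h
    exact star_ext fun p q => by rw [h₁, h₂, h]

/-- Graded morphisms `f` and `g` are elements of the hom presheaves, so quantifying over them is the
same as testing on all generators of `A(a, a') ⋆ B(b, b')`. -/
theorem Sesq.isGradedBifunctor_iff_isEnrichedBifunctor {A B C : LCat.{u} (Psh V)}
    (F : Sesq A B C) : F.IsGradedBifunctor ↔ F.IsEnrichedBifunctor :=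
  forall₄_congr fun a a' b b' => (LCat.enrichedSquare_iff_gradedSquare _ _ _ _).symm

/-- The predicate enters `triFunctor` only through the choice of full subcategories. Its purpose is
to give an equality of 2-functors, as part 2 demands, instead of an isomorphism. -/
theorem Sesq.triFunctor_congr {W : Type v} [Category.{u} W] [MonoidalCategory W]
    {p q : ∀ {A B C : LCat.{u} W}, Sesq A B C → Prop}
    (h : ∀ {A B C : LCat.{u} W} (F : Sesq A B C), p F ↔ q F) (hp) (hp') (hq) (hq') :
    Sesq.triFunctor p hp hp' = Sesq.triFunctor q hq hq' := by
  -- Extensionality turns the equivalence into an equality of predicates; the closure and centrality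
  -- proofs then agree by proof irrelevance.
  obtain rfl : @p = @q := by
    funext A B C F
    exact propext (h F)
  rfl

theorem grBif_eq_enrBif : grBif V = enrBif (Psh V) :=
  Sesq.triFunctor_congr Sesq.isGradedBifunctor_iff_isEnrichedBifunctor _ _ _ _

/-- The square of morphisms of representables is graded if and only if the square of
representing morphisms is enriched. -/
theorem LCat.enrichedSquare_iff_yoneda {C : LCat.{u} V} {P Q : V} {a a' b b' : C.ob}
    (f : P ⟶ C.hom a a') (g : P ⟶ C.hom b b') (φ : Q ⟶ C.hom a b) (φ' : Q ⟶ C.hom a' b') :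
    EnrichedSquare f g φ φ' ↔ ∀ (X X' : V) (p : (yo P).el X) (q : (yo Q).el X'),
      GradedSquare (C := baseObj (yonedaFunctor V) C) (ap (Day.yoMap f) p) (ap (Day.yoMap g) p)
        (ap (Day.yoMap φ) q) (ap (Day.yoMap φ') q) := by
  -- Graded morphisms of `Y_* C` are morphisms of `V` into the hom objects of `C`, and their graded
  -- composite is the enriched composite of their tensor product.
  have key : ∀ {a b c : C.ob} {X Y : V} (k : Y ⟶ C.hom b c) (l : X ⟶ C.hom a b),
      gcomp (C := baseObj (yonedaFunctor V) C) (a := a) (b := b) (c := c) (toYo k) (toYo l) =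
        toYo ((k ⊗ₘ l) ≫ C.comp a b c) := fun k l => by
    refine (ap_comp _ _ _).trans ((congrArg _ (ap_yoMul k l)).trans ?_)
    exact Day.yoMap_toYo _ _
  -- Both sides of the graded square are elements at `X ⋆ X'` of the representable on `C(a, b')`,
  -- where reindexing is precomposition. The equation is thus the enriched square restricted along
  -- `p` and `q`.
  have sq : ∀ {X X' : V} (p : X ⟶ P) (q : X' ⟶ Q),
      GradedSquare (C := baseObj (yonedaFunctor V) C) (ap (Day.yoMap f) (toYo p))
        (ap (Day.yoMap g) (toYo p)) (ap (Day.yoMap φ) (toYo q)) (ap (Day.yoMap φ') (toYo q)) ↔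
      EnrichedSquare (p ≫ f) (p ≫ g) (q ≫ φ) (q ≫ φ') := fun p q => by
    rw [GradedSquare, Day.yoMap_toYo, Day.yoMap_toYo, Day.yoMap_toYo, Day.yoMap_toYo, key, key]
    refine Iff.trans (b := toYo _ = toYo _) (Eq.congr (yo_res _ _ _) (yo_res _ _ _)) ?_
    exact ⟨fun h => (ofYo_toYo _).symm.trans ((congrArg ofYo h).trans (ofYo_toYo _)),
      fun h => congrArg toYo h⟩
  constructor
  · intro h X X' p q
    obtain ⟨p, rfl⟩ := exists_toYo p
    obtain ⟨q, rfl⟩ := exists_toYo q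
    -- By naturality of `σ` and `τ`, an enriched square may be restricted along any `p` and `q`.
    exact (sq p q).2 (h.precomp p q)
  · intro h
    -- Conversely the two universal elements, the identities of `P` and `Q`, already give the
    -- unrestricted square.
    simpa only [Category.id_comp] using (sq _ _).1 (h P Q (toYo (𝟙 P)) (toYo (𝟙 Q)))

end

/-! ### Change of base along a fully faithful normal lax monoidal functor. -/

section

variable {W : Type v₁} [Category.{u} W] [MonoidalCategory W] {W' : Type v₂} [Category.{u} W']
  [MonoidalCategory W'] (Φ : W ⥤ W') [Φ.LaxMonoidal]

open Functor.LaxMonoidal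

namespace Sesq

/-- Composition with `hom0 Φ x` in the base-changed category is the image under `Φ` of composition
with `x`, so the second equation is the image of the first under a faithful functor. -/
theorem hom0_natural_iff [Φ.Faithful] {C : LCat.{u} W} {P : W} {a a' b b' : C.ob}
    (f : P ⟶ C.hom a a') (g : P ⟶ C.hom b b') (x : C.Und a b) (y : C.Und a' b') :
    f ≫ LCat.post y a = g ≫ LCat.pre x b' ↔
      Φ.map f ≫ LCat.post (C := LCat.baseObj Φ C) (LCat.hom0 Φ y) a =
        Φ.map g ≫ LCat.pre (C := LCat.baseObj Φ C) (LCat.hom0 Φ x) b' := by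
  rw [LCat.post_hom0, LCat.pre_hom0, ← Φ.map_comp, ← Φ.map_comp, Φ.map_injective.eq_iff]

variable [Φ.Full] [Φ.Faithful] [NormalLax Φ] [∀ X Y : W, Epi (μ Φ X Y)]

/-- Two morphisms out of the unit of `W` are equal as soon as their images agree after composition
with `ε`; this is the injectivity half of normality. -/
theorem preimage_one {A C : LCat.{u} W} {a : A.ob} {c : C.ob}
    {f : Φ.obj (A.hom a a) ⟶ Φ.obj (C.hom c c)}
    (h : (LCat.baseObj Φ A).one a ≫ f = (LCat.baseObj Φ C).one c) :
    A.one a ≫ Φ.preimage f = C.one c :=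
  (NormalLax.bij (Φ := Φ) _).1 (by simpa using h)

/-- The composition law of the base-changed categories gives the image of the desired law only after
precomposition with `μ`. Since `μ` is epimorphic it can be cancelled, and then `Φ` is faithful. Full
faithfulness of `Φ` alone would not be enough for this argument. -/
theorem preimage_comp {A C : LCat.{u} W} {a a' a'' : A.ob} {c c' c'' : C.ob}
    {f : Φ.obj (A.hom a a'') ⟶ Φ.obj (C.hom c c'')}
    {g : Φ.obj (A.hom a a') ⟶ Φ.obj (C.hom c c')}
    {k : Φ.obj (A.hom a' a'') ⟶ Φ.obj (C.hom c' c'')}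
    (h : (LCat.baseObj Φ A).comp a a' a'' ≫ f = (k ⊗ₘ g) ≫ (LCat.baseObj Φ C).comp c c' c'') :
    A.comp a a' a'' ≫ Φ.preimage f =
      (Φ.preimage k ⊗ₘ Φ.preimage g) ≫ C.comp c c' c'' := by
  apply Φ.map_injective
  rw [← cancel_epi (μ Φ _ _), Φ.map_comp, Φ.map_comp, ← μ_natural_assoc, Φ.map_preimage,
    Φ.map_preimage, Φ.map_preimage, ← Category.assoc]
  exact h

/-- The inverse of change of base of pairs of families of functors along a fully faithful
functor. -/
noncomputable def unbaseFunctor (A B C : LCat.{u} W) :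
    Sesq (LCat.baseObj Φ A) (LCat.baseObj Φ B) (LCat.baseObj Φ C) ⥤ Sesq A B C where
  obj F :=
    { obj := F.obj
      mapL := fun a a' b => Φ.preimage (F.mapL a a' b)
      mapR := fun a b b' => Φ.preimage (F.mapR a b b')
      mapL_one := fun a b => preimage_one Φ (F.mapL_one a b)
      mapL_comp := fun a a' a'' b => preimage_comp Φ (F.mapL_comp a a' a'' b)
      mapR_one := fun a b => preimage_one Φ (F.mapR_one a b)
      mapR_comp := fun a b b' b'' => preimage_comp Φ (F.mapR_comp a b b' b'') }
  map {F G} θ :=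
    { app := fun a b => LCat.und0 Φ (Trans.app θ a b)
      natL := fun a a' b => by
        -- Naturality is reflected by `Φ`, and its image is the given naturality, as `und0` and the
        -- preimages are undone by `hom0` and `Φ`.
        rw [hom0_natural_iff Φ, LCat.hom0_und0, LCat.hom0_und0, Φ.map_preimage, Φ.map_preimage]
        exact Trans.natL θ a a' b
      natR := fun a b b' => by
        rw [hom0_natural_iff Φ, LCat.hom0_und0, LCat.hom0_und0, Φ.map_preimage, Φ.map_preimage]
        exact Trans.natR θ a b b' }
  map_id F := hom_ext fun a b => LCat.und0_one Φ _ _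
  map_comp θ κ := hom_ext fun a b => LCat.und0_ucomp Φ _ _

theorem base_unbase_obj {A B C : LCat.{u} W} (F : Sesq A B C) :
    (unbaseFunctor Φ A B C).obj ((baseFunctor Φ A B C).obj F) = F := by
  simp only [unbaseFunctor, baseFunctor, Φ.preimage_map]

theorem unbase_base_obj {A B C : LCat.{u} W}
    (F : Sesq (LCat.baseObj Φ A) (LCat.baseObj Φ B) (LCat.baseObj Φ C)) :
    (baseFunctor Φ A B C).obj ((unbaseFunctor Φ A B C).obj F) = F := by
  simp only [unbaseFunctor, baseFunctor, Φ.map_preimage]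

/-- The object assignments on both sides are literally the same and `Φ` preserves composites of the
hom morphisms. Strict naturality in 1-cells comes from this. -/
theorem base_act {A B C A' B' C' : LCat.{u} W} (P : LFunctor A' A) (Q : LFunctor B' B)
    (R : LFunctor C C') (F : Sesq A B C) :
    act (LCat.baseMap Φ P) (LCat.baseMap Φ Q) (LCat.baseMap Φ R) ((baseFunctor Φ A B C).obj F) =
      (baseFunctor Φ A' B' C').obj (act P Q R F) := by
  simp only [act, baseFunctor, Φ.map_comp]

/-- The components are composites in underlying categories of images under the functors `F(-, b)`,
`F(a, -)` and `R`, and `hom0` is compatible with both operations. The conjugating identities occur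
only because the pairs in `base_act` are equal without being definitionally equal. -/
theorem base_act₂ {A B C A' B' C' : LCat.{u} W} {P P' : LFunctor A' A} {Q Q' : LFunctor B' B}
    {R R' : LFunctor C C'} (ε : P ⟶ P') (ζ : Q ⟶ Q') (χ : R ⟶ R') (F : Sesq A B C)
    (hF : F.Central) (hF' : ((baseFunctor Φ A B C).obj F).Central) :
    act₂ (A := LCat.baseObj Φ A) (B := LCat.baseObj Φ B) (C := LCat.baseObj Φ C)
        (A' := LCat.baseObj Φ A') (B' := LCat.baseObj Φ B') (C' := LCat.baseObj Φ C')
        (P := LCat.baseMap Φ P) (P' := LCat.baseMap Φ P') (Q := LCat.baseMap Φ Q)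
        (Q' := LCat.baseMap Φ Q') (R := LCat.baseMap Φ R) (R' := LCat.baseMap Φ R')
        (LCat.baseMap₂ Φ ε) (LCat.baseMap₂ Φ ζ) (LCat.baseMap₂ Φ χ)
        ((baseFunctor Φ A B C).obj F) hF' =
      eqToHom (base_act Φ P Q R F) ≫ (baseFunctor Φ A' B' C').map (act₂ ε ζ χ F hF) ≫
        eqToHom (base_act Φ P' Q' R' F).symm := by
  -- The underlying objects agree definitionally, so the transports are invisible on components and
  -- an ordinary equation for each `a` and `b` remains.
  refine (eqToHom_comp_comp_eqToHom (A := LCat.baseObj Φ A') (B := LCat.baseObj Φ B')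
    (C := LCat.baseObj Φ C') (base_act Φ P Q R F) (base_act Φ P' Q' R' F).symm _ _
    fun a b => heq_of_eq ?_).symm
  -- The component runs along `ε`, then `ζ`, then `χ`; `hom0` is distributed over this composite one
  -- factor at a time.
  change LCat.hom0 Φ (LCat.ucomp (LCat.ucomp (LNatTrans.app ε a ≫ F.mapL _ _ _)
    (LNatTrans.app ζ b ≫ F.mapR _ _ _) ≫ R.map _ _) (LNatTrans.app χ _)) = _
  rw [LCat.hom0_ucomp, LCat.hom0_map, LCat.hom0_ucomp]
  have h₁ := LCat.hom0_map Φ (F.left (Q.obj b)) (LNatTrans.app ε a)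
  have h₂ := LCat.hom0_map Φ (F.right (P'.obj a)) (LNatTrans.app ζ b)
  rw [h₁, h₂]
  rfl

variable (p : ∀ {A B C : LCat.{u} W}, Sesq A B C → Prop)
  (hp : ∀ {A B C : LCat.{u} W} {F : Sesq A B C}, p F → F.Central)
  (hp' : ∀ {A B C A' B' C' : LCat.{u} W} (P : LFunctor A' A) (Q : LFunctor B' B)
    (R : LFunctor C C') {F : Sesq A B C}, p F → p (act P Q R F))
  (q : ∀ {A B C : LCat.{u} W'}, Sesq A B C → Prop)
  (hq : ∀ {A B C : LCat.{u} W'} {F : Sesq A B C}, q F → F.Central)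
  (hq' : ∀ {A B C A' B' C' : LCat.{u} W'} (P : LFunctor A' A) (Q : LFunctor B' B)
    (R : LFunctor C C') {F : Sesq A B C}, q F → q (act P Q R F))
  (hpq : ∀ {A B C : LCat.{u} W} (F : Sesq A B C), p F ↔ q ((baseFunctor Φ A B C).obj F))

/-- Change of base along a fully faithful functor is a 2-natural isomorphism between the
2-functors determined by corresponding predicates. -/
noncomputable def changeBaseIso : TwoNatIso (triFunctor p hp hp')
    (StrictPseudofunctor.id (LCat.{u} W)) (StrictPseudofunctor.id (LCat.{u} W))
    (StrictPseudofunctor.id (LCat.{u} W)) (triFunctor q hq hq') (LCat.changeBase Φ)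
    (LCat.changeBase Φ) (LCat.changeBase Φ) where
  hom A B C := ObjectProperty.lift (fun F => q F) (ObjectProperty.ι (C := Sesq A B C) (fun F => p F) ⋙
    baseFunctor Φ A B C) (fun F => (hpq F.obj).1 F.property)
  inv A B C := ObjectProperty.lift (fun F => p F) (ObjectProperty.ι (C := Sesq (LCat.baseObj Φ A)
    (LCat.baseObj Φ B) (LCat.baseObj Φ C)) (fun F => q F) ⋙ unbaseFunctor Φ A B C)
    (fun F => (hpq _).2 (by
      -- The hypothesis `hpq` concerns base-changed pairs, so `F` is first written as the base
      -- change of its own preimage.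
      have h := F.property
      rw [← unbase_base_obj Φ F.obj] at h
      exact h))
  hom_inv A B C := functor_ext (fun F => base_unbase_obj Φ F.obj)
    (fun θ a b => heq_of_eq (LCat.hom0_inj Φ (LCat.hom0_und0 Φ _)))
  inv_hom A B C := functor_ext (fun F => unbase_base_obj Φ F.obj)
    (fun θ a b => heq_of_eq (LCat.hom0_und0 Φ _))
  naturality P Q R := functor_ext (fun F => base_act Φ P Q R F.obj)
    (fun θ a b => heq_of_eq (LCat.hom0_map Φ R _).symm)
  -- The action of 2-cells is defined only for central pairs; `hp` and `hq` provide centrality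
  -- before and after change of base.
  naturality₂ ε ζ χ := nat_ext _ _ _ _ fun F => base_act₂ Φ ε ζ χ F.obj (hp F.property)
    (hq ((hpq F.obj).1 F.property))

end Sesq

end

/-! ### The Yoneda embedding is fully faithful and normal, with epimorphic comparison maps. -/

namespace Psh

variable {V : Type u} [SmallCategory V] [MonoidalCategory V]

instance : (yonedaFunctor V).Faithful where
  map_injective {X Y f g} h := by
    have h' := congrArg (fun k => ofYo (ap k (toYo (𝟙 X)))) h
    simpa using h'

instance : (yonedaFunctor V).Full where
  map_surjective {X Y} f := by
    obtain ⟨g, hg⟩ := exists_toYo (ap f (toYo (𝟙 X)))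
    exact ⟨g, yo_hom_ext (by rw [hg, Day.yoMap_toYo, Category.id_comp])⟩

/-- The unit of presheaves is the representable on `I` and the lax unit `ε` is an identity, so
normality reduces to full faithfulness on morphisms out of `I`. -/
instance : NormalLax (yonedaFunctor V) where
  bij S := by
    have h : (fun x : 𝟙_ V ⟶ S => Functor.LaxMonoidal.ε (yonedaFunctor V) ≫
        (yonedaFunctor V).map x) = fun x => (yonedaFunctor V).map x :=
      funext fun x => Category.id_comp _
    rw [h]
    exact ⟨(yonedaFunctor V).map_injective, (yonedaFunctor V).map_surjective⟩

/-- A morphism out of the representable on `X ⊗ Y` is determined by its value at the identity, and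
the identity lies in the image of `μ`, being hit by the generator formed from the identities of `X`
and `Y`. -/
instance (X Y : V) : Epi (Functor.LaxMonoidal.μ (yonedaFunctor V) X Y) where
  left_cancellation {S} f g h := yo_hom_ext (by
    have h' := congrArg (fun k => ap k (tmul (toYo (𝟙 X)) (toYo (𝟙 Y)))) h
    have e : ap (Functor.LaxMonoidal.μ (yonedaFunctor V) X Y) (tmul (toYo (𝟙 X)) (toYo (𝟙 Y))) =
      toYo (𝟙 (X ⊗ Y)) := (ap_yoMul _ _).trans (congrArg toYo (id_tensorHom_id X Y))
    simpa only [ap_comp, e] using h')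

end Psh

/-! ### The first isomorphism, from enriched to graded bifunctors. -/

section

open Psh

variable {V : Type u} [SmallCategory V] [MonoidalCategory V] [StarMonoidal V] [DuoidalCategory V]
  [NormalDuoidal V]

/-- For fixed objects this is the comparison of squares `enrichedSquare_iff_yoneda`, with `P` and
`Q` the hom objects `A(a, a')` and `B(b, b')`. -/
theorem Sesq.isEnrichedBifunctor_iff_isGradedBifunctor_base {A B C : LCat.{u} V}
    (F : Sesq A B C) : F.IsEnrichedBifunctor ↔
      ((Sesq.baseFunctor (yonedaFunctor V) A B C).obj F).IsGradedBifunctor :=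
  forall₄_congr fun a a' b b' => LCat.enrichedSquare_iff_yoneda _ _ _ _

variable (V) in
/-- The 2-natural isomorphism between enriched bifunctors and graded bifunctors of the
associated graded categories. -/
noncomputable def yonedaBifIso : TwoNatIso (enrBif V) (StrictPseudofunctor.id (LCat.{u} V))
    (StrictPseudofunctor.id (LCat.{u} V)) (StrictPseudofunctor.id (LCat.{u} V)) (grBif V)
    (LCat.yonedaBase V) (LCat.yonedaBase V) (LCat.yonedaBase V) :=
  Sesq.changeBaseIso (yonedaFunctor V) Sesq.IsEnrichedBifunctor _ _ Sesq.IsGradedBifunctor _ _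
    (hpq := Sesq.isEnrichedBifunctor_iff_isGradedBifunctor_base)

/-- The isomorphism was built as a lift of change of base through the inclusion of a full
subcategory. The equation certifies that it is the functor described in the theorem and not some
other isomorphism. -/
theorem yonedaBifIso_hom_incl (A B C : LCat.{u} V) :
    (yonedaBifIso V).hom A B C ⋙ grBif.incl _ _ _ =
      enrBif.incl A B C ⋙ Sesq.baseFunctor (Psh.yonedaFunctor V) A B C :=
  rfl

end

/-! ### Composition in `C_⋆`, and invertibility of the reindexings along the unitors. -/

namespace Psh

theorem isIso_of_bijective {V : Type u} [SmallCategory V] {P Q : Psh V} (f : P ⟶ Q)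
    (h : ∀ X : V, Function.Bijective fun p : P.el X => ap f p) : IsIso f := by
  let e (X : V) := Equiv.ofBijective _ (h X)
  -- The pointwise inverses commute with reindexing because `f` does.
  have he : ∀ {X Y : V} (w : Y ⟶ X) (q : Q.el X),
      (e Y).symm (Q.res w q) = P.res w ((e X).symm q) := fun {X Y} w q => by
    rw [Equiv.symm_apply_eq]
    exact (congrArg _ ((e X).apply_symm_apply q)).symm.trans (ap_res f w _).symm
  exact (isoMk f (homMk (fun {X} q => (e X).symm q) he)
    (fun {X} p => (ap_homMk _ he _).trans ((e X).symm_apply_apply p))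
    (fun {X} q => (congrArg _ (ap_homMk _ he _)).trans ((e X).apply_symm_apply q))).isIso_hom

theorem res_bijective {V : Type u} [SmallCategory V] (P : Psh V) {X Y : V} (w : Y ⟶ X) [IsIso w] :
    Function.Bijective (P.res w) :=
  Function.bijective_iff_has_inverse.2 ⟨P.res (inv w), fun p => by simp, fun p => by simp⟩

theorem toPre_bijective {V W : Type u} [SmallCategory V] [SmallCategory W] (F : V ⥤ W)
    (S : Psh W) (X : V) : Function.Bijective fun s : S.el (F.obj X) => toPre F S s :=
  ⟨fun s t h => by simpa only [ofPre_toPre] using congrArg (ofPre F) h,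
    fun s => (exists_toPre F s).imp fun _ h => h.symm⟩

variable {V : Type u} [SmallCategory V] [MonoidalCategory V] [StarMonoidal V] [DuoidalCategory V]

/-- Composition in a base change is the lax structure map followed by the old composition, and for
restriction along `⋆` that structure map reindexes along the opmonoidal constraint, which is `ξ`.
This is how the interchange enters the bigraded square. -/
theorem gcomp_starBase {C : LCat.{u} (Psh V)} {a b c : C.ob} {X Y : V × V}
    (g : (C.hom b c).el ((starFunctor V).obj Y)) (f : (C.hom a b).el ((starFunctor V).obj X)) :
    LCat.gcomp (C := LCat.baseObj (preFunctor (starFunctor V)) C) (a := a) (b := b) (c := c)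
        (toPre (starFunctor V) _ g) (toPre (starFunctor V) _ f) =
      toPre (starFunctor V) (X := Y ⊗ X) (C.hom a c)
        ((C.hom a c).res (DuoidalCategory.ξ Y.1 X.1 Y.2 X.2) (LCat.gcomp g f)) := by
  refine (ap_comp _ _ _).trans ((congrArg _ (ap_preMul (starFunctor V) g f)).trans ?_)
  refine (ap_preMap _ _ _).trans (congrArg (toPre (starFunctor V) _) ?_)
  -- The composition of `C` is a morphism of presheaves, so the reindexing along `ξ` can be moved
  -- outside.
  exact ap_res _ _ _

theorem gcomp_res {C : LCat.{u} (Psh V)} {a b c : C.ob} {X Y X' Y' : V} (v : Y' ⟶ Y) (w : X' ⟶ X)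
    (g : (C.hom b c).el Y) (f : (C.hom a b).el X) :
    LCat.gcomp ((C.hom b c).res v g) ((C.hom a b).res w f) =
      (C.hom a c).res (v ⊗ₘ w) (LCat.gcomp g f) := by
  rw [LCat.gcomp, tmul_res, ap_res, LCat.gcomp]

variable [NormalDuoidal V]

/-- The counit of `⋆` is `μ : I ⋆ I ⟶ I`, which coincides with the unitor `duoR` at `I` and is
invertible by normality. Consequently restriction along `⋆` is normal, and `C` and `C_⋆` share their
underlying category. -/
instance : IsIso (Functor.OplaxMonoidal.η (starFunctor V)) := by
  change IsIso (DuoidalCategory.μ (V := V))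
  rw [← duoR_unit]
  infer_instance

/-- On elements this is reindexing along `X ⋆ I ⟶ X`, invertible by normality, followed by two
bijections that only change the presheaf to which an element is regarded as belonging. -/
instance (S : Psh V) : IsIso (toLeft S) :=
  isIso_of_bijective _ fun X => by
    simp only [ap_toLeft]
    exact (toPre_bijective _ _ _).comp ((toPre_bijective _ _ _).comp (res_bijective S (duoR X)))

instance (S : Psh V) : IsIso (toRight S) :=
  isIso_of_bijective _ fun X => by
    simp only [ap_toRight]
    exact (toPre_bijective _ _ _).comp ((toPre_bijective _ _ _).comp (res_bijective S (duoL X)))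

end Psh

/-! ### The isomorphisms of `C` with `U_ℓ^* C_⋆` and `U_r^* C_⋆`, and the comparison of squares. -/

namespace LCat

open Psh

variable {V : Type u} [SmallCategory V] [MonoidalCategory V] [StarMonoidal V] [DuoidalCategory V]
  [NormalDuoidal V]

/-- The inverse of `C ⟶ U_ℓ^* C_⋆`. -/
@[reducible] noncomputable def outLeft (C : LCat.{u} (Psh V)) : LFunctor
    (baseObj (preFunctor (inLeft V V)) (baseObj (preFunctor (Psh.starFunctor V)) C)) C where
  obj a := a
  map a b := inv (toLeft (C.hom a b))
  map_one a := by
    rw [IsIso.comp_inv_eq]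
    exact ((intoLeft C).map_one a).symm
  map_comp a b c := by
    rw [IsIso.comp_inv_eq, Category.assoc, (intoLeft C).map_comp, ← Category.assoc,
      tensorHom_comp_tensorHom, IsIso.inv_hom_id, IsIso.inv_hom_id, id_tensorHom_id,
      Category.id_comp]

/-- The inverse of `C ⟶ U_r^* C_⋆`. -/
@[reducible] noncomputable def outRight (C : LCat.{u} (Psh V)) : LFunctor
    (baseObj (preFunctor (inRight V V)) (baseObj (preFunctor (Psh.starFunctor V)) C)) C where
  obj a := a
  map a b := inv (toRight (C.hom a b))
  map_one a := by
    rw [IsIso.comp_inv_eq]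
    exact ((intoRight C).map_one a).symm
  map_comp a b c := by
    rw [IsIso.comp_inv_eq, Category.assoc, (intoRight C).map_comp, ← Category.assoc,
      tensorHom_comp_tensorHom, IsIso.inv_hom_id, IsIso.inv_hom_id, id_tensorHom_id,
      Category.id_comp]

variable {C : LCat.{u} (Psh V)} {a b : C.ob}

/-- By `und_toLeft`, passing from `C` to `U_ℓ^* C_⋆` agrees on underlying morphisms with passing
through `C_⋆`. With `hom0_inv_toRight` it shows that transporting back along either variable gives
the same morphism of `C`, so that a transformation of bifunctors into `C_⋆` has well-defined
components in `C`. -/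
theorem hom0_inv_toLeft (x : (baseObj (preFunctor (Psh.starFunctor V)) C).Und a b) :
    hom0 (preFunctor (inLeft V V)) x ≫ inv (toLeft (C.hom a b)) =
      und0 (preFunctor (Psh.starFunctor V)) x := by
  rw [IsIso.comp_inv_eq, und_toLeft, hom0_und0]

theorem hom0_inv_toRight (x : (baseObj (preFunctor (Psh.starFunctor V)) C).Und a b) :
    hom0 (preFunctor (inRight V V)) x ≫ inv (toRight (C.hom a b)) =
      und0 (preFunctor (Psh.starFunctor V)) x := by
  rw [IsIso.comp_inv_eq, und_toRight, hom0_und0]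

/-- By `gcomp_starBase`, the first side of the bigraded square is `g ∘ φ` reindexed along `ρ ⊗ λ`,
then `ξ`, then the `⋆` of the inverse unitors of `⊗`: these are the three factors of `σ`. The other
side assembles `τ` in the same way. -/
theorem gradedSquare_iff_bigradedSquare {X X' : V} {a a' b b' : C.ob} (f : (C.hom a a').el X)
    (g : (C.hom b b').el X) (φ : (C.hom a b).el X') (φ' : (C.hom a' b').el X') :
    GradedSquare f g φ φ' ↔
      BigradedSquare (C := baseObj (preFunctor (Psh.starFunctor V)) C)
        (toPre (Psh.starFunctor V) (X := (X, 𝟙_ V)) _ ((C.hom a a').res (duoR X) f))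
        (toPre (Psh.starFunctor V) (X := (X, 𝟙_ V)) _ ((C.hom b b').res (duoR X) g))
        (toPre (Psh.starFunctor V) (X := (𝟙_ V, X')) _ ((C.hom a b).res (duoL X') φ))
        (toPre (Psh.starFunctor V) (X := (𝟙_ V, X')) _ ((C.hom a' b').res (duoL X') φ')) := by
  rw [BigradedSquare, gcomp_starBase, gcomp_starBase, res_toPre, res_toPre,
    (toPre_bijective (Psh.starFunctor V) _ (X, X')).1.eq_iff, gcomp_res, gcomp_res, res_res,
    res_res, res_res, res_res, GradedSquare, duoSigma, duoTau]
  simp only [Category.assoc]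

end LCat

/-! ### Pairs of families into `C` compared with pairs of families into `C_⋆`. -/

namespace Sesq

open Psh

variable {V : Type u} [SmallCategory V] [MonoidalCategory V] [StarMonoidal V] [DuoidalCategory V]
  [NormalDuoidal V] {A B C A' B' C' : LCat.{u} (Psh V)}

variable (A B C) in
/-- Postcomposition with the isomorphisms `U_ℓ^* C_⋆ ≅ C` and `U_r^* C_⋆ ≅ C`. -/
noncomputable def unstarFunctor : BiSesq (preFunctor (inLeft V V)) (preFunctor (inRight V V)) A B
      (LCat.baseObj (preFunctor (Psh.starFunctor V)) C) ⥤ Sesq A B C where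
  obj F :=
    { obj := F.obj
      mapL := fun a a' b => F.mapL a a' b ≫ inv (toLeft _)
      mapR := fun a b b' => F.mapR a b b' ≫ inv (toRight _)
      mapL_one := fun a b => ((F.left b).comp (LCat.outLeft C)).map_one a
      mapL_comp := fun a a' a'' b => ((F.left b).comp (LCat.outLeft C)).map_comp a a' a''
      mapR_one := fun a b => ((F.right a).comp (LCat.outRight C)).map_one b
      mapR_comp := fun a b b' b'' => ((F.right a).comp (LCat.outRight C)).map_comp b b' b'' }
  map {F G} θ :=
    { app := fun a b => LCat.und0 (preFunctor (Psh.starFunctor V)) (BiSesq.Trans.app θ a b)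
      natL := fun a a' b => by
        have h := (LNatTrans.whiskerRight (BiSesq.Trans.left θ b) (LCat.outLeft C)).naturality a a'
        -- Whiskering with `outLeft` gives a natural transformation whose components are the
        -- underlying morphisms of `C` recovered by `und0`.
        have e : ∀ a, LNatTrans.app (LNatTrans.whiskerRight (BiSesq.Trans.left θ b)
            (LCat.outLeft C)) a = LCat.und0 (preFunctor (Psh.starFunctor V))
              (BiSesq.Trans.app θ a b) := fun a => LCat.hom0_inv_toLeft _
        rw [e, e] at h
        exact h
      natR := fun a b b' => by
        have h := (LNatTrans.whiskerRight (BiSesq.Trans.right θ a)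
          (LCat.outRight C)).naturality b b'
        have e : ∀ b, LNatTrans.app (LNatTrans.whiskerRight (BiSesq.Trans.right θ a)
            (LCat.outRight C)) b = LCat.und0 (preFunctor (Psh.starFunctor V))
              (BiSesq.Trans.app θ a b) := fun b => LCat.hom0_inv_toRight _
        rw [e, e] at h
        exact h }
  map_id F := hom_ext fun a b => LCat.und0_one _ _ _
  map_comp θ κ := hom_ext fun a b => LCat.und0_ucomp _ _ _

theorem star_unstar_obj (F : Sesq A B C) :
    (unstarFunctor A B C).obj ((starFunctor A B C).obj F) = F := by
  simp only [unstarFunctor, starFunctor, Category.assoc, IsIso.hom_inv_id, Category.comp_id]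

theorem unstar_star_obj (F : BiSesq (preFunctor (inLeft V V)) (preFunctor (inRight V V)) A B
      (LCat.baseObj (preFunctor (Psh.starFunctor V)) C)) :
    (starFunctor A B C).obj ((unstarFunctor A B C).obj F) = F := by
  simp only [unstarFunctor, starFunctor, Category.assoc, IsIso.inv_hom_id, Category.comp_id]

/-- `toLeft` and `toRight` are natural in the presheaf, so they can be moved past the hom morphisms
of `R`; precomposition with `P` and `Q` is unaffected by them. -/
theorem star_act (P : LFunctor A' A) (Q : LFunctor B' B) (R : LFunctor C C') (F : Sesq A B C) :
    BiSesq.act P Q (LCat.baseMap (preFunctor (Psh.starFunctor V)) R) ((starFunctor A B C).obj F) =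
      (starFunctor A' B' C').obj (act P Q R F) := by
  simp only [act, BiSesq.act, starFunctor, Category.assoc, fun c c' => toLeft_naturality (R.map c c'),
    fun c c' => toRight_naturality (R.map c c')]

/-- The functors into `C_⋆` act by reindexing the values of `F` along the unitors, and these are
exactly the morphisms for which `gradedSquare_iff_bigradedSquare` identifies the two squares. -/
theorem isGradedBifunctor_iff_star (F : Sesq A B C) :
    F.IsGradedBifunctor ↔ ((starFunctor A B C).obj F).IsGradedBifunctor := by
  -- Removing the restriction along `U_ℓ` leaves an element of `C_⋆` of grade `(X, I)`, namely the
  -- reindexing along `ρ` of the value of `F`.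
  have h₁ : ∀ (a a' : A.ob) (b : B.ob) {X : V} (f : (A.hom a a').el X),
      ofPre (inLeft V V) (ap (((starFunctor A B C).obj F).mapL a a' b) f) =
        toPre (Psh.starFunctor V) (X := (X, 𝟙_ V)) _ ((C.hom _ _).res (duoR X)
          (ap (F.mapL a a' b) f)) := fun a a' b X f =>
    (congrArg (ofPre _) ((ap_comp _ _ _).trans (ap_toLeft _))).trans (ofPre_toPre _ _ _)
  have h₂ : ∀ (a : A.ob) (b b' : B.ob) {X : V} (g : (B.hom b b').el X),
      ofPre (inRight V V) (ap (((starFunctor A B C).obj F).mapR a b b') g) =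
        toPre (Psh.starFunctor V) (X := (𝟙_ V, X)) _ ((C.hom _ _).res (duoL X)
          (ap (F.mapR a b b') g)) := fun a b b' X g =>
    (congrArg (ofPre _) ((ap_comp _ _ _).trans (ap_toRight _))).trans (ofPre_toPre _ _ _)
  simp only [IsGradedBifunctor, BiSesq.IsGradedBifunctor, h₁, h₂,
    LCat.gradedSquare_iff_bigradedSquare]
  rfl

/-- The morphism `F(x, b)` of `C_⋆` is characterised by its image in `U_ℓ^* C_⋆`, where the claim
becomes `und_toLeft`. Together with `star_onR` it eliminates the choices of inverses in the
definition of `BiSesq.act₂`. -/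
theorem star_onL (F : Sesq A B C) {a a' : A.ob} (x : A.Und a a') (b : B.ob) :
    ((starFunctor A B C).obj F).onL x b =
      LCat.hom0 (preFunctor (Psh.starFunctor V)) (x ≫ F.mapL a a' b) :=
  LCat.hom0_inj (preFunctor (inLeft V V)) ((BiSesq.hom0_onL _ _ _).trans
    ((Category.assoc _ _ _).symm.trans (LCat.und_toLeft _)))

theorem star_onR (F : Sesq A B C) (a : A.ob) {b b' : B.ob} (y : B.Und b b') :
    ((starFunctor A B C).obj F).onR a y =
      LCat.hom0 (preFunctor (Psh.starFunctor V)) (y ≫ F.mapR a b b') :=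
  LCat.hom0_inj (preFunctor (inRight V V)) ((BiSesq.hom0_onR _ _ _).trans
    ((Category.assoc _ _ _).symm.trans (LCat.und_toRight _)))

/-- Once `star_onL` and `star_onR` have been applied, every factor of the component on the `C_⋆`
side is a `hom0` image, and `hom0` preserves composition and is compatible with `R`. -/
theorem star_act₂ {P P' : LFunctor A' A} {Q Q' : LFunctor B' B} {R R' : LFunctor C C'}
    (ε : P ⟶ P') (ζ : Q ⟶ Q') (χ : R ⟶ R') (F : Sesq A B C) (hF : F.Central)
    (hF' : ((starFunctor A B C).obj F).Central) :
    BiSesq.act₂ (C := LCat.baseObj (preFunctor (Psh.starFunctor V)) C)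
        (C' := LCat.baseObj (preFunctor (Psh.starFunctor V)) C')
        (S := LCat.baseMap (preFunctor (Psh.starFunctor V)) R)
        (S' := LCat.baseMap (preFunctor (Psh.starFunctor V)) R') ε ζ
        (LCat.baseMap₂ (preFunctor (Psh.starFunctor V)) χ) ((starFunctor A B C).obj F) hF' =
      eqToHom (star_act P Q R F) ≫ (starFunctor A' B' C').map (act₂ ε ζ χ F hF) ≫
        eqToHom (star_act P' Q' R' F).symm := by
  refine (BiSesq.eqToHom_comp_comp_eqToHom (star_act P Q R F) (star_act P' Q' R' F).symm _ _
    fun a b => heq_of_eq ?_).symm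
  -- On the left the composite along `ε`, `ζ`, `χ` is formed in `C` and then carried to `C_⋆`; on
  -- the right it is formed in `C_⋆`.
  change LCat.hom0 _ (LCat.ucomp (LCat.ucomp (LNatTrans.app ε a ≫ F.mapL _ _ _)
      (LNatTrans.app ζ b ≫ F.mapR _ _ _) ≫ R.map _ _) (LNatTrans.app χ _)) =
    LCat.ucomp (LCat.ucomp (((starFunctor A B C).obj F).onL (LNatTrans.app ε a) _)
      (((starFunctor A B C).obj F).onR _ (LNatTrans.app ζ b)) ≫ _) _
  rw [LCat.hom0_ucomp, LCat.hom0_map, LCat.hom0_ucomp, star_onL, star_onR]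
  rfl

end Sesq

/-! ### The second isomorphism, from graded bifunctors into `C` to graded bifunctors into `C_⋆`. -/

section

open Psh Sesq

variable (V : Type u) [SmallCategory V] [MonoidalCategory V] [StarMonoidal V] [DuoidalCategory V]
  [NormalDuoidal V]

/-- The 2-natural isomorphism between `V`-graded bifunctors into `C` and graded bifunctors
into `C_⋆`. -/
noncomputable def starBifIso : TwoNatIso (grBif V)
    (StrictPseudofunctor.id (LCat.{u} (Psh V))) (StrictPseudofunctor.id (LCat.{u} (Psh V)))
    (StrictPseudofunctor.id (LCat.{u} (Psh V))) (gBif V V)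
    (StrictPseudofunctor.id (LCat.{u} (Psh V))) (StrictPseudofunctor.id (LCat.{u} (Psh V)))
    (LCat.starBase V) where
  hom A B C := ObjectProperty.lift (fun F : BiSesq (preFunctor (inLeft V V))
      (preFunctor (inRight V V)) A B (LCat.baseObj (preFunctor (Psh.starFunctor V)) C) =>
        F.IsGradedBifunctor) (grBif.incl A B C ⋙ Sesq.starFunctor A B C)
    (fun F => (isGradedBifunctor_iff_star F.obj).1 F.property)
  inv A B C := ObjectProperty.lift (fun F : Sesq A B C => F.IsGradedBifunctor)
    (gBif.incl A B (LCat.baseObj (preFunctor (Psh.starFunctor V)) C) ⋙ unstarFunctor A B C)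
    (fun F => (isGradedBifunctor_iff_star _).2 (by
      -- The comparison of squares applies to pairs coming from `C`, so `F` is replaced by the image
      -- of its transport back to `C`.
      have h := F.property
      rw [← unstar_star_obj F.obj] at h
      exact h))
  hom_inv A B C := Sesq.functor_ext (fun F => star_unstar_obj F.obj)
    (fun θ a b => heq_of_eq (LCat.hom0_inj _ (LCat.hom0_und0 _ _)))
  inv_hom A B C := BiSesq.functor_ext (fun F => unstar_star_obj F.obj)
    (fun θ a b => heq_of_eq (LCat.hom0_und0 _ _))
  naturality P Q R := BiSesq.functor_ext (fun F => star_act P Q R F.obj)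
    (fun θ a b => heq_of_eq (LCat.hom0_map _ R _).symm)
  -- Centrality, needed for the action of 2-cells, follows on either side from the bifunctor
  -- equation with one grade equal to the unit.
  naturality₂ ε ζ χ := BiSesq.nat_ext _ _ _ _ fun F =>
    star_act₂ ε ζ χ F.obj (IsGradedBifunctor.central F.property)
      (BiSesq.IsGradedBifunctor.central ((isGradedBifunctor_iff_star F.obj).1 F.property))

/-- The restriction of `starBifIso` to graded categories arising from `V`-categories. -/
noncomputable def starYonedaBifIso : TwoNatIso (grBif V) (LCat.yonedaBase V) (LCat.yonedaBase V)
    (LCat.yonedaBase V) (gBif V V) (LCat.yonedaBase V) (LCat.yonedaBase V)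
    ((LCat.yonedaBase V).comp (LCat.starBase V)) where
  hom A B C := (starBifIso V).hom ((LCat.yonedaBase V).obj A) ((LCat.yonedaBase V).obj B)
    ((LCat.yonedaBase V).obj C)
  inv A B C := (starBifIso V).inv ((LCat.yonedaBase V).obj A) ((LCat.yonedaBase V).obj B)
    ((LCat.yonedaBase V).obj C)
  hom_inv A B C := (starBifIso V).hom_inv _ _ _
  inv_hom A B C := (starBifIso V).inv_hom _ _ _
  -- Strict 2-naturality on all graded categories specialises to the 1-cells and 2-cells in the
  -- image of the Yoneda 2-functor.
  naturality P Q R := (starBifIso V).naturality ((LCat.yonedaBase V).map P)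
    ((LCat.yonedaBase V).map Q) ((LCat.yonedaBase V).map R)
  naturality₂ ε ζ χ := (starBifIso V).naturality₂ ((LCat.yonedaBase V).map₂ ε)
    ((LCat.yonedaBase V).map₂ ζ) ((LCat.yonedaBase V).map₂ χ)

end

/-- The equations with the inclusions pin the two isomorphisms down: an inclusion of a full
subcategory is faithful and injective on objects, so composition with it determines a functor. Both
hold definitionally, the isomorphisms being lifts through these inclusions. -/
theorem mainTheorem9 (V : Type u) [SmallCategory V] [MonoidalCategory V] [StarMonoidal V]
    [DuoidalCategory V] [NormalDuoidal V] :
    (∃ (Φ : TwoNatIso (enrBif V) (StrictPseudofunctor.id (LCat.{u} V))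
          (StrictPseudofunctor.id (LCat.{u} V)) (StrictPseudofunctor.id (LCat.{u} V))
          (grBif V) (LCat.yonedaBase V) (LCat.yonedaBase V) (LCat.yonedaBase V))
        (Ψ : TwoNatIso (grBif V) (LCat.yonedaBase V) (LCat.yonedaBase V) (LCat.yonedaBase V)
          (gBif V V) (LCat.yonedaBase V) (LCat.yonedaBase V)
          ((LCat.yonedaBase V).comp (LCat.starBase V))),
      (∀ A B C : LCat.{u} V, Φ.hom A B C ⋙ grBif.incl _ _ _ =
        enrBif.incl A B C ⋙ Sesq.baseFunctor (Psh.yonedaFunctor V) A B C) ∧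
      (∀ A B C : LCat.{u} V, Ψ.hom A B C ⋙ gBif.incl _ _ _ =
        grBif.incl _ _ _ ⋙ Sesq.starFunctor ((LCat.yonedaBase V).obj A)
          ((LCat.yonedaBase V).obj B) ((LCat.yonedaBase V).obj C))) ∧
    ((∀ (A B C : LCat.{u} (Psh V)) (F : Sesq A B C),
        F.IsGradedBifunctor ↔ F.IsEnrichedBifunctor) ∧
      grBif V = enrBif (Psh V)) :=
  ⟨⟨yonedaBifIso V, starYonedaBifIso V, fun A B C => yonedaBifIso_hom_incl A B C,
    fun A B C => rfl⟩,
    fun A B C F => F.isGradedBifunctor_iff_isEnrichedBifunctor, grBif_eq_enrBif⟩
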